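/- Let $G$ be a finite graph with $n\ge 1$ vertices. For a vertex $v$ of a graph $H$ let $\mathrm{cl}_H(v)$ be the maximum of $|N_H(v)\cap N_H(u)|$ over all vertices $u\neq v$ of $H$ not adjacent to $v$ (and $0$ if there is no such $u$). The graph $G$ is weakly $\gamma$-closed if every nonempty induced subgraph $H$ of $G$ has a vertex $v$ with $\mathrm{cl}_H(v)<\gamma$, and the weak closure $\gamma(G)$ is the smallest $\gamma$ such that $G$ is weakly $\gamma$-closed. For $s\in\mathbb{N}$, the problem $s$-Defective Clique asks, given $G$ and $k\in\mathbb{N}$, whether there is a set $S\subseteq V(G)$ with $|S|\ge k$ such that $G[S]$ has at least $\binom{|S|}{2}-s$ edges. Theorem. For $s\ge 1$, $s$-Defective Clique can be solved in $$2^{O(\gamma(G)\sqrt{s}+s\log k)}\cdot n^{O(\sqrt{s})}$$ time. Precisely: there are one random access machine (unit-cost instructions: constants, copying, addition, truncated subtraction, indirect addressing, branching, loops) and one constant $C>0$ such that for all $s\ge 1$, $n\ge 1$, $k\ge 0$ and every graph $G$ on the vertex set $\{0,\dots,n-1\}$, the machine, given $n$, $k$, $s$ and the adjacency matrix of $G$,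 decides whether $(G,k)$ is a Yes-instance of $s$-Defective Clique in at most $$2^{C\left(\gamma(G)\sqrt{s}+s\log_2\max\{k,1\}\right)}\cdot n^{C\sqrt{s}}$$ steps. -/

import Mathlib

namespace DefectiveClique

/-! ## Weak closure -/

section Graphs

variable {V : Type*} [Fintype V]

open Classical in
/-- The closure number `cl_G(v)`: the maximum of `|N(v) ∩ N(u)|` over all vertices `u ≠ v` that
are not adjacent to `v`. The maximum over the empty set is `0`. -/
noncomputable def closureNumber (G : SimpleGraph V) (v : V) : ℕ :=
  (Finset.univ.filter fun u : V => u ≠ v ∧ ¬ G.Adj v u).sup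
    fun u => (G.commonNeighbors v u).ncard

/-- `G` is weakly `γ`-closed: every (nonempty) induced subgraph `G[X]` has a vertex `v` with
`cl_{G[X]}(v) < γ`. -/
def WeaklyClosed (γ : ℕ) (G : SimpleGraph V) : Prop :=
  ∀ X : Finset V, X.Nonempty →
    ∃ v : (X : Set V), closureNumber (G.induce (X : Set V)) v < γ

/-- The weak closure `γ(G)`: the smallest `γ` such that `G` is weakly `γ`-closed. -/
noncomputable def weakClosure (G : SimpleGraph V) : ℕ :=
  sInf {γ : ℕ | WeaklyClosed γ G}

/-- Some `γ` always works, so the infimum in `weakClosure` is a minimum. -/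
theorem weaklyClosed_weakClosure (G : SimpleGraph V) : WeaklyClosed (weakClosure G) G := by
  refine Nat.sInf_mem (s := {γ : ℕ | WeaklyClosed γ G}) ⟨Fintype.card V + 1, ?_⟩
  intro X hX
  obtain ⟨x, hx⟩ := hX
  refine ⟨⟨x, hx⟩, Nat.lt_succ_of_le (Finset.sup_le fun u _ => ?_)⟩
  calc _ ≤ Nat.card (X : Set V) := Set.ncard_le_card _
    _ ≤ Nat.card V := Nat.card_le_card_of_injective _ Subtype.val_injective
    _ = Fintype.card V := Nat.card_eq_fintype_card

/-- `S` is an `s`-defective clique of `G`: the graph `G[S]` has at least `binom(|S|, 2) - s`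
edges. -/
def IsDefectiveClique (s : ℕ) (G : SimpleGraph V) (S : Finset V) : Prop :=
  S.card.choose 2 ≤ (G.induce (S : Set V)).edgeSet.ncard + s

/-- `(G, k)` is a Yes-instance of the problem `s`-Defective Clique: there is an `s`-defective
clique with at least `k` vertices. -/
def HasDefectiveClique (s : ℕ) (G : SimpleGraph V) (k : ℕ) : Prop :=
  ∃ S : Finset V, k ≤ S.card ∧ IsDefectiveClique s G S

end Graphs

/-! ## Random access machines -/

/-- Programs of a random access machine. The machine has registers (a program uses finitely many
of them) and a memory; every register and every memory cell holds a natural number. The input is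
a list of numbers that can only be read. The arithmetic instructions are addition and
(truncated) subtraction; there is no multiplication. -/
inductive Prog : Type
  /-- `r_x := c` -/
  | const (x c : ℕ) : Prog
  /-- `r_x := r_y` -/
  | copy (x y : ℕ) : Prog
  /-- `r_x := r_y + r_z` -/
  | add (x y z : ℕ) : Prog
  /-- `r_x := r_y - r_z`, or `0` if `r_y < r_z` -/
  | sub (x y z : ℕ) : Prog
  /-- `r_x := input[r_y]` (`0` beyond the end of the input) -/
  | read (x y : ℕ) : Prog
  /-- `r_x := mem[r_y]` -/
  | load (x y : ℕ) : Prog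
  /-- `mem[r_x] := r_y` -/
  | store (x y : ℕ) : Prog
  /-- run `p`, then `q` -/
  | seq (p q : Prog) : Prog
  /-- if `r_x ≠ 0` then run `p`, else run `q` -/
  | ite (x : ℕ) (p q : Prog) : Prog
  /-- while `r_x ≠ 0`, run `p` -/
  | while (x : ℕ) (p : Prog) : Prog

/-- The contents of the registers and of the memory. -/
structure State : Type where
  reg : ℕ → ℕ
  mem : ℕ → ℕ

/-- At the start all registers and all memory cells hold `0`. -/
def State.init : State := ⟨fun _ => 0, fun _ => 0⟩

/-- Write the number `a` into register `x`. -/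
def State.setReg (σ : State) (x a : ℕ) : State := ⟨Function.update σ.reg x a, σ.mem⟩

/-- Write the number `a` into memory cell `i`. -/
def State.setMem (σ : State) (i a : ℕ) : State := ⟨σ.reg, Function.update σ.mem i a⟩

/-- `Exec inp p σ τ t`: on the input `inp`, the program `p` started in state `σ` halts in state
`τ` after exactly `t` steps. Each instruction and each test of a branch or of a loop is one
step. -/
inductive Exec (inp : List ℕ) : Prog → State → State → ℕ → Prop
  | const (x c : ℕ) (σ : State) : Exec inp (.const x c) σ (σ.setReg x c) 1
  | copy (x y : ℕ) (σ : State) : Exec inp (.copy x y) σ (σ.setReg x (σ.reg y)) 1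
  | add (x y z : ℕ) (σ : State) :
      Exec inp (.add x y z) σ (σ.setReg x (σ.reg y + σ.reg z)) 1
  | sub (x y z : ℕ) (σ : State) :
      Exec inp (.sub x y z) σ (σ.setReg x (σ.reg y - σ.reg z)) 1
  | read (x y : ℕ) (σ : State) :
      Exec inp (.read x y) σ (σ.setReg x (inp.getD (σ.reg y) 0)) 1
  | load (x y : ℕ) (σ : State) :
      Exec inp (.load x y) σ (σ.setReg x (σ.mem (σ.reg y))) 1
  | store (x y : ℕ) (σ : State) :
      Exec inp (.store x y) σ (σ.setMem (σ.reg x) (σ.reg y)) 1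
  | seq {p q : Prog} {σ τ υ : State} {t u : ℕ} (hp : Exec inp p σ τ t)
      (hq : Exec inp q τ υ u) : Exec inp (.seq p q) σ υ (t + u)
  | ite_true {x : ℕ} {p q : Prog} {σ τ : State} {t : ℕ} (hx : σ.reg x ≠ 0)
      (hp : Exec inp p σ τ t) : Exec inp (.ite x p q) σ τ (t + 1)
  | ite_false {x : ℕ} {p q : Prog} {σ τ : State} {t : ℕ} (hx : σ.reg x = 0)
      (hq : Exec inp q σ τ t) : Exec inp (.ite x p q) σ τ (t + 1)
  | while_true {x : ℕ} {p : Prog} {σ τ υ : State} {t u : ℕ} (hx : σ.reg x ≠ 0)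
      (hp : Exec inp p σ τ t) (hw : Exec inp (.while x p) τ υ u) :
      Exec inp (.while x p) σ υ (t + u + 1)
  | while_false {x : ℕ} {p : Prog} {σ : State} (hx : σ.reg x = 0) :
      Exec inp (.while x p) σ σ 1

/-- The machine is deterministic: the final state and the number of steps are determined. -/
theorem Exec.deterministic {inp : List ℕ} {p : Prog} {σ τ τ' : State} {t t' : ℕ}
    (h : Exec inp p σ τ t) (h' : Exec inp p σ τ' t') : τ = τ' ∧ t = t' := by
  induction h generalizing τ' t' with
  | const | copy | add | sub | read | load | store => cases h'; exact ⟨rfl, rfl⟩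
  | seq _ _ ih₁ ih₂ =>
    cases h' with
    | seq h₁ h₂ =>
      obtain ⟨rfl, rfl⟩ := ih₁ h₁
      obtain ⟨rfl, rfl⟩ := ih₂ h₂
      exact ⟨rfl, rfl⟩
  | ite_true hx _ ih =>
    cases h' with
    | ite_true _ h₁ => obtain ⟨rfl, rfl⟩ := ih h₁; exact ⟨rfl, rfl⟩
    | ite_false hx' _ => exact absurd hx' hx
  | ite_false hx _ ih =>
    cases h' with
    | ite_true hx' _ => exact absurd hx hx'
    | ite_false _ h₁ => obtain ⟨rfl, rfl⟩ := ih h₁; exact ⟨rfl, rfl⟩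
  | while_true hx _ _ ih₁ ih₂ =>
    cases h' with
    | while_true _ h₁ h₂ =>
      obtain ⟨rfl, rfl⟩ := ih₁ h₁
      obtain ⟨rfl, rfl⟩ := ih₂ h₂
      exact ⟨rfl, rfl⟩
    | while_false hx' => exact absurd hx' hx
  | while_false hx =>
    cases h' with
    | while_true hx' _ _ => exact absurd hx hx'
    | while_false _ => exact ⟨rfl, rfl⟩

/-- On the input `inp`, the program `p` halts within `T` steps (`T` a real number), and it accepts
(it leaves a nonzero number in register `0`) if and only if `answer` holds. -/
def Prog.DecidesWithin (p : Prog) (inp : List ℕ) (answer : Prop) (T : ℝ) : Prop :=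
  ∃ (τ : State) (t : ℕ), Exec inp p State.init τ t ∧ (τ.reg 0 ≠ 0 ↔ answer) ∧ (t : ℝ) ≤ T

open Classical in
/-- The input for a graph `G` on the vertices `0, …, n - 1` and the numbers `s` and `k`: the
numbers `n`, `k`, `s`, followed by the adjacency matrix of `G`, row by row. The entry of row `i`
and column `j` has position `3 + (i * n + j)`. -/
noncomputable def encode {n : ℕ} (s : ℕ) (G : SimpleGraph (Fin n)) (k : ℕ) : List ℕ :=
  n :: k :: s ::
    List.ofFn fun e : Fin (n * n) => if G.Adj e.divNat e.modNat then 1 else 0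

end DefectiveClique

namespace DefectiveClique

/-! ## A structured language compiled to the random access machine -/

/-! Let `S` be a solution, so that `G[S]` misses at most `s` edges. Greedy colouring of the
complement covers `S` by `q = O(√s)` cliques (`exists_clique_partition`). The set `D` of vertices of
`S` that meet a missing edge has at most `2 * s` elements, and `S \ D` is a clique. Extend the `q`
cliques and `S \ D` to maximal cliques of `G`. If some maximal clique has `k` vertices, it is itself
a solution. Otherwise every vertex of `D` is named by the index of a clique and a position below `k`
in it, which leaves at most `((q + 1) * k) ^ (2 * s)` choices. The set `D`, together with all
members of the last clique that are adjacent to all of `D`, contains `S` and misses edges only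
inside `D`, so it is a solution too (`exists_certificate`).

There are few maximal cliques. Repeatedly removing a vertex of small closure number ranks the
vertices so that each has fewer than `Γ ≤ γ(G)` later common neighbours with any later nonneighbour
(`Program.run_peel`). By `IsMaxClique.exists_seed`, a maximal clique has a member `c` whose later
members are later common neighbours of `c` and one vertex `u`. Either there are no later members, or
fewer than `Γ` such common neighbours. The members before `c` can be recovered greedily by
decreasing rank. So `c`, `u` and a number below `2 ^ Γ` determine the clique.

The search decodes all `T = (n * n * 2 ^ Γ) ^ (q + 1) * ((q + 1) * k) ^ (2 * s)` combinations and
tests the resulting sets. The test makes it sound; the certificates make it complete. First `k` is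
brought between `1` and `n + 1`, and `s` is replaced by its minimum with `k * k`. This forces `q =
O(k)`, so that the powers of `q` are absorbed into `2 ^ O(s log k)` (`candidateNumber_le`). The weak
closure need not be known: the elimination tries increasing bounds.

For the machine, the program is written in a small language with bounded loops, whose compiler has
an exact step count (`Cmd.exec_comp`). The program is fixed and all its loop bounds are at most `T`,
so its time is polynomial in `T` (`Cmd.time_le_cost`, `Cmd.polyBounded_cost`). A polynomial in `T`
only changes the constant `C`. -/

/-- A store: variables and eight unbounded arrays. -/
@[ext] structure Env : Type where
  var : ℕ → ℕ
  arr : Fin 8 → ℕ → ℕ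

namespace Env

def set (ρ : Env) (x v : ℕ) : Env := ⟨Function.update ρ.var x v, ρ.arr⟩

def setArr (ρ : Env) (a : Fin 8) (i v : ℕ) : Env :=
  ⟨ρ.var, Function.update ρ.arr a (Function.update (ρ.arr a) i v)⟩

@[simp] theorem set_var (ρ : Env) (x v y : ℕ) :
    (ρ.set x v).var y = if y = x then v else ρ.var y := by
  simp [set, Function.update_apply]

@[simp] theorem set_arr (ρ : Env) (x v : ℕ) : (ρ.set x v).arr = ρ.arr := rfl

@[simp] theorem setArr_var (ρ : Env) (a : Fin 8) (i v : ℕ) : (ρ.setArr a i v).var = ρ.var := rfl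

@[simp] theorem setArr_arr (ρ : Env) (a b : Fin 8) (i v j : ℕ) :
    (ρ.setArr a i v).arr b j = if b = a ∧ j = i then v else ρ.arr b j := by
  unfold setArr
  by_cases h : b = a
  · subst h; simp [Function.update_apply]
  · simp [h]

theorem set_set (ρ : Env) (x v w : ℕ) : (ρ.set x v).set x w = ρ.set x w := by
  simp [set]

theorem set_self (ρ : Env) (x : ℕ) : ρ.set x (ρ.var x) = ρ := by
  simp [set]

end Env

/-- Expressions. `sum x b e` is the sum of `e` over `x < b`, where `b` is a variable. -/
inductive Exp : Type
  | lit (c : ℕ) : Exp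
  | var (x : ℕ) : Exp
  | arr (a : Fin 8) (i : Exp) : Exp
  | inp (i : Exp) : Exp
  | add (e f : Exp) : Exp
  | sub (e f : Exp) : Exp
  | ite (c e f : Exp) : Exp
  | sum (x b : ℕ) (e : Exp) : Exp

/-- Commands. `loop x b c` runs `c` for `x = 0, …, b - 1`, where `b` is a variable that is read
once, at the start. -/
inductive Cmd : Type
  | skip : Cmd
  | assign (x : ℕ) (e : Exp) : Cmd
  | store (a : Fin 8) (i e : Exp) : Cmd
  | seq (c d : Cmd) : Cmd
  | ite (e : Exp) (c d : Cmd) : Cmd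
  | loop (x b : ℕ) (c : Cmd) : Cmd

/-- `f (m - 1) ∘ ⋯ ∘ f 0`. -/
def iter {α : Type*} (f : ℕ → α → α) : ℕ → α → α
  | 0, a => a
  | m + 1, a => f m (iter f m a)

theorem iter_induction {α : Type*} {f : ℕ → α → α} {a : α} (I : ℕ → α → Prop) (m : ℕ)
    (h0 : I 0 a) (hs : ∀ i b, i < m → I i b → I (i + 1) (f i b)) : I m (iter f m a) := by
  induction m with
  | zero => exact h0
  | succ m ih => exact hs m _ (Nat.lt_succ_self m) (ih fun i b hi => hs i b (by omega))

namespace Exp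

def eval (inp : List ℕ) : Exp → Env → ℕ
  | lit c, _ => c
  | var x, ρ => ρ.var x
  | arr a i, ρ => ρ.arr a (i.eval inp ρ)
  | .inp i, ρ => inp.getD (i.eval inp ρ) 0
  | add e f, ρ => e.eval inp ρ + f.eval inp ρ
  | sub e f, ρ => e.eval inp ρ - f.eval inp ρ
  | ite c e f, ρ => if c.eval inp ρ ≠ 0 then e.eval inp ρ else f.eval inp ρ
  | sum x b e, ρ => ∑ i ∈ Finset.range (ρ.var b), e.eval inp (ρ.set x i)

/-- The number of steps of the compiled expression. -/
def time (inp : List ℕ) : Exp → Env → ℕ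
  | lit _, _ => 1
  | var _, _ => 1
  | arr _ i, ρ => i.time inp ρ + 6
  | .inp i, ρ => i.time inp ρ + 1
  | add e f, ρ => e.time inp ρ + f.time inp ρ + 1
  | sub e f, ρ => e.time inp ρ + f.time inp ρ + 1
  | ite c e f, ρ =>
    c.time inp ρ + (if c.eval inp ρ ≠ 0 then e.time inp ρ else f.time inp ρ) + 1
  | sum x b e, ρ => ∑ i ∈ Finset.range (ρ.var b), (e.time inp (ρ.set x i) + 5) + 7

/-- All sums range up to variables in `B`, and no variable in `B` is a summation variable. -/
def bdd (B : List ℕ) : Exp → Bool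
  | lit _ => true
  | var _ => true
  | arr _ i => i.bdd B
  | .inp i => i.bdd B
  | add e f => e.bdd B && f.bdd B
  | sub e f => e.bdd B && f.bdd B
  | ite c e f => c.bdd B && e.bdd B && f.bdd B
  | sum x b e => B.contains b && !B.contains x && e.bdd B

/-- A bound for the number of steps if all sums have at most `M` terms. -/
def cost (M : ℕ) : Exp → ℕ
  | lit _ => 1
  | var _ => 1
  | arr _ i => i.cost M + 6
  | .inp i => i.cost M + 1
  | add e f => e.cost M + f.cost M + 1
  | sub e f => e.cost M + f.cost M + 1
  | ite c e f => c.cost M + (e.cost M + f.cost M) + 1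
  | sum _ _ e => M * (e.cost M + 5) + 7

/-- Summation variables are never in `B`, so the bounds on the variables in `B` persist inside a
sum, and sums at every nesting level have at most `M` terms. -/
theorem time_le_cost {inp : List ℕ} {B : List ℕ} {M : ℕ} (e : Exp) {ρ : Env} (he : e.bdd B)
    (hB : ∀ b ∈ B, ρ.var b ≤ M) : e.time inp ρ ≤ e.cost M := by
  induction e generalizing ρ with
  | lit c => simp [time, cost]
  | var x => simp [time, cost]
  | arr a i ih => simpa [time, cost] using ih he hB
  | inp i ih => simpa [time, cost] using ih he hB
  | add e f ih₁ ih₂ =>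
    simp only [bdd, Bool.and_eq_true] at he
    have := ih₁ he.1 hB; have := ih₂ he.2 hB
    simp only [time, cost]; omega
  | sub e f ih₁ ih₂ =>
    simp only [bdd, Bool.and_eq_true] at he
    have := ih₁ he.1 hB; have := ih₂ he.2 hB
    simp only [time, cost]; omega
  | ite c e f ih₀ ih₁ ih₂ =>
    simp only [bdd, Bool.and_eq_true] at he
    have := ih₀ he.1.1 hB; have := ih₁ he.1.2 hB; have := ih₂ he.2 hB
    simp only [time, cost]; split <;> omega
  | sum x b e ih =>
    simp only [bdd, Bool.and_eq_true, Bool.not_eq_true',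
      List.contains_eq_mem, decide_eq_false_iff_not] at he
    simp only [time, cost]
    have h1 : ∀ i ∈ Finset.range (ρ.var b), e.time inp (ρ.set x i) + 5 ≤ e.cost M + 5 := by
      intro i _
      refine Nat.add_le_add_right (ih he.2 fun c hc => ?_) 5
      have : c ≠ x := fun h => he.1.2 (h ▸ hc)
      simpa [this] using hB c hc
    have h2 := Finset.sum_le_card_nsmul _ _ _ h1
    rw [Finset.card_range, smul_eq_mul] at h2
    have h3 := Nat.mul_le_mul_right (e.cost M + 5) (hB b (by simpa using he.1.1))
    omega

end Exp

namespace Cmd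

def run (inp : List ℕ) : Cmd → Env → Env
  | skip, ρ => ρ
  | assign x e, ρ => ρ.set x (e.eval inp ρ)
  | store a i e, ρ => ρ.setArr a (i.eval inp ρ) (e.eval inp ρ)
  | seq c d, ρ => d.run inp (c.run inp ρ)
  | ite e c d, ρ => if e.eval inp ρ ≠ 0 then c.run inp ρ else d.run inp ρ
  | loop x b c, ρ => iter (fun i τ => c.run inp (τ.set x i)) (ρ.var b) ρ

/-- The number of steps of the compiled command. -/
def time (inp : List ℕ) : Cmd → Env → ℕ
  | skip, _ => 1
  | assign _ e, ρ => e.time inp ρ + 1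
  | store _ i e, ρ => i.time inp ρ + e.time inp ρ + 6
  | seq c d, ρ => c.time inp ρ + d.time inp (c.run inp ρ)
  | ite e c d, ρ =>
    e.time inp ρ + (if e.eval inp ρ ≠ 0 then c.time inp ρ else d.time inp ρ) + 1
  | loop x b c, ρ =>
    ∑ i ∈ Finset.range (ρ.var b),
      (c.time inp ((iter (fun i τ => c.run inp (τ.set x i)) i ρ).set x i) + 5) + 3

/-- All loops and sums range up to variables in `B`, and no variable in `B` is written. -/
def bdd (B : List ℕ) : Cmd → Bool
  | skip => true
  | assign x e => !B.contains x && e.bdd B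
  | store _ i e => i.bdd B && e.bdd B
  | seq c d => c.bdd B && d.bdd B
  | ite e c d => e.bdd B && c.bdd B && d.bdd B
  | loop x b c => B.contains b && !B.contains x && c.bdd B

def cost (M : ℕ) : Cmd → ℕ
  | skip => 1
  | assign _ e => e.cost M + 1
  | store _ i e => i.cost M + e.cost M + 6
  | seq c d => c.cost M + d.cost M
  | ite e c d => e.cost M + (c.cost M + d.cost M) + 1
  | loop _ _ c => M * (c.cost M + 5) + 3

/-- The command does not write the variable `x`. -/
def keepsVar (x : ℕ) : Cmd → Bool
  | skip => true
  | assign y _ => y != x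
  | store _ _ _ => true
  | seq c d => c.keepsVar x && d.keepsVar x
  | ite _ c d => c.keepsVar x && d.keepsVar x
  | loop y _ c => y != x && c.keepsVar x

/-- The command does not write the array `a`. -/
def keepsArr (a : Fin 8) : Cmd → Bool
  | skip => true
  | assign _ _ => true
  | store b _ _ => b != a
  | seq c d => c.keepsArr a && d.keepsArr a
  | ite _ c d => c.keepsArr a && d.keepsArr a
  | loop _ _ c => c.keepsArr a

/-- Frame properties are syntactic, so for a concrete command they are settled by `decide`. -/
theorem run_var {inp : List ℕ} {x : ℕ} (c : Cmd) (hc : c.keepsVar x) (ρ : Env) :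
    (c.run inp ρ).var x = ρ.var x := by
  induction c generalizing ρ with
  | skip => rfl
  | assign y e =>
    have : x ≠ y := Ne.symm (by simpa [keepsVar] using hc)
    simp [run, this]
  | store a i e => rfl
  | seq c d ih₁ ih₂ =>
    simp only [keepsVar, Bool.and_eq_true] at hc
    simp only [run]; rw [ih₂ hc.2, ih₁ hc.1]
  | ite e c d ih₁ ih₂ =>
    simp only [keepsVar, Bool.and_eq_true] at hc
    simp only [run]; split
    · exact ih₁ hc.1 ρ
    · exact ih₂ hc.2 ρ
  | loop y b c ih =>
    simp only [keepsVar, Bool.and_eq_true, bne_iff_ne] at hc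
    simp only [run]
    refine iter_induction (fun _ (τ : Env) => τ.var x = ρ.var x) _ rfl fun i τ _ h => ?_
    rw [ih hc.2, Env.set_var, if_neg (Ne.symm hc.1), h]

theorem run_arr {inp : List ℕ} {a : Fin 8} (c : Cmd) (hc : c.keepsArr a) (ρ : Env) :
    (c.run inp ρ).arr a = ρ.arr a := by
  induction c generalizing ρ with
  | skip => rfl
  | assign y e => rfl
  | store b i e =>
    have : a ≠ b := Ne.symm (by simpa [keepsArr] using hc)
    funext j; simp [run, this]
  | seq c d ih₁ ih₂ =>
    simp only [keepsArr, Bool.and_eq_true] at hc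
    simp only [run]; rw [ih₂ hc.2, ih₁ hc.1]
  | ite e c d ih₁ ih₂ =>
    simp only [keepsArr, Bool.and_eq_true] at hc
    simp only [run]; split
    · exact ih₁ hc.1 ρ
    · exact ih₂ hc.2 ρ
  | loop y b c ih =>
    simp only [keepsArr] at hc
    simp only [run]
    refine iter_induction (fun _ (τ : Env) => τ.arr a = ρ.arr a) _ rfl fun i τ _ h => ?_
    rw [ih hc, Env.set_arr, h]

theorem keepsVar_of_bdd {B : List ℕ} {b : ℕ} (hb : b ∈ B) (c : Cmd) (hc : c.bdd B) :
    c.keepsVar b := by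
  induction c with
  | skip => rfl
  | assign y e =>
    simp only [bdd, Bool.and_eq_true, Bool.not_eq_true', List.contains_eq_mem,
      decide_eq_false_iff_not] at hc
    simp only [keepsVar, bne_iff_ne]
    exact fun h => hc.1 (h ▸ hb)
  | store a i e => rfl
  | seq c d ih₁ ih₂ =>
    simp only [bdd, Bool.and_eq_true] at hc
    simp [keepsVar, ih₁ hc.1, ih₂ hc.2]
  | ite e c d ih₁ ih₂ =>
    simp only [bdd, Bool.and_eq_true] at hc
    simp [keepsVar, ih₁ hc.1.2, ih₂ hc.2]
  | loop y b' c ih =>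
    simp only [bdd, Bool.and_eq_true, Bool.not_eq_true', List.contains_eq_mem,
      decide_eq_false_iff_not] at hc
    simp only [keepsVar, Bool.and_eq_true, bne_iff_ne]
    exact ⟨fun h => hc.1.2 (h ▸ hb), ih hc.2⟩

/-- Loop bounds are variables that no part of the command writes, so a bound that holds at the start
holds in every iteration. -/
theorem time_le_cost {inp : List ℕ} {B : List ℕ} {M : ℕ} (c : Cmd) {ρ : Env} (hc : c.bdd B)
    (hB : ∀ b ∈ B, ρ.var b ≤ M) : c.time inp ρ ≤ c.cost M := by
  induction c generalizing ρ with
  | skip => simp [time, cost]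
  | assign x e =>
    simp only [bdd, Bool.and_eq_true] at hc
    simpa [time, cost] using e.time_le_cost hc.2 hB
  | store a i e =>
    simp only [bdd, Bool.and_eq_true] at hc
    have := i.time_le_cost (inp := inp) hc.1 hB
    have := e.time_le_cost (inp := inp) hc.2 hB
    simp only [time, cost]; omega
  | seq c d ih₁ ih₂ =>
    simp only [bdd, Bool.and_eq_true] at hc
    have := ih₁ hc.1 hB
    have := ih₂ (ρ := c.run inp ρ) hc.2 fun b hb => by
      rw [run_var c (keepsVar_of_bdd hb c hc.1)]; exact hB b hb
    simp only [time, cost]; omega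
  | ite e c d ih₁ ih₂ =>
    simp only [bdd, Bool.and_eq_true] at hc
    have := e.time_le_cost (inp := inp) hc.1.1 hB
    have := ih₁ hc.1.2 hB
    have := ih₂ hc.2 hB
    simp only [time, cost]; split <;> omega
  | loop x b c ih =>
    simp only [bdd, Bool.and_eq_true, Bool.not_eq_true', List.contains_eq_mem,
      decide_eq_false_iff_not, decide_eq_true_eq] at hc
    simp only [time, cost]
    have hx : ∀ b ∈ B, b ≠ x := fun b hb h => hc.1.2 (h ▸ hb)
    have h1 : ∀ i ∈ Finset.range (ρ.var b),
        c.time inp ((iter (fun i τ => c.run inp (τ.set x i)) i ρ).set x i) + 5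
          ≤ c.cost M + 5 := by
      intro i _
      refine Nat.add_le_add_right (ih hc.2 fun b hb => ?_) 5
      rw [Env.set_var, if_neg (hx b hb)]
      refine iter_induction (fun _ (τ : Env) => τ.var b ≤ M) _ (hB b hb) fun j τ _ h => ?_
      rw [run_var c (keepsVar_of_bdd hb c hc.2), Env.set_var, if_neg (hx b hb)]
      exact h
    have h2 := Finset.sum_le_card_nsmul _ _ _ h1
    rw [Finset.card_range, smul_eq_mul] at h2
    have h3 := Nat.mul_le_mul_right (c.cost M + 5) (hB b hc.1.1)
    omega

end Cmd

/-! ### Costs are polynomial -/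

/-- `f` is bounded by a polynomial. -/
def PolyBounded (f : ℕ → ℕ) : Prop := ∃ A d : ℕ, ∀ M, f M ≤ A * (M + 1) ^ d

namespace PolyBounded

theorem const (c : ℕ) : PolyBounded fun _ => c := ⟨c, 0, fun M => by simp⟩

theorem add {f g : ℕ → ℕ} (hf : PolyBounded f) (hg : PolyBounded g) :
    PolyBounded fun M => f M + g M := by
  obtain ⟨A, d, hA⟩ := hf
  obtain ⟨B, e, hB⟩ := hg
  refine ⟨A + B, d + e, fun M => ?_⟩
  have h1 : (M + 1) ^ d ≤ (M + 1) ^ (d + e) := Nat.pow_le_pow_right (by omega) (by omega)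
  have h2 : (M + 1) ^ e ≤ (M + 1) ^ (d + e) := Nat.pow_le_pow_right (by omega) (by omega)
  calc f M + g M ≤ A * (M + 1) ^ d + B * (M + 1) ^ e := Nat.add_le_add (hA M) (hB M)
    _ ≤ A * (M + 1) ^ (d + e) + B * (M + 1) ^ (d + e) := by gcongr
    _ = _ := by ring

theorem id_mul {f : ℕ → ℕ} (hf : PolyBounded f) : PolyBounded fun M => M * f M := by
  obtain ⟨A, d, hA⟩ := hf
  refine ⟨A, d + 1, fun M => ?_⟩
  calc M * f M ≤ (M + 1) * (A * (M + 1) ^ d) := Nat.mul_le_mul (by omega) (hA M)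
    _ = _ := by ring

end PolyBounded

/-- The coefficient and the degree depend on the expression only; this is the source of a constant
`C` that is uniform over all inputs. -/
theorem Exp.polyBounded_cost (e : Exp) : PolyBounded fun M => e.cost M := by
  induction e with
  | lit c => exact .const 1
  | var x => exact .const 1
  | arr a i ih => exact ih.add (.const 6)
  | inp i ih => exact ih.add (.const 1)
  | add e f ih₁ ih₂ => exact (ih₁.add ih₂).add (.const 1)
  | sub e f ih₁ ih₂ => exact (ih₁.add ih₂).add (.const 1)
  | ite c e f ih₀ ih₁ ih₂ => exact (ih₀.add (ih₁.add ih₂)).add (.const 1)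
  | sum x b e ih => exact (ih.add (.const 5)).id_mul.add (.const 7)

theorem Cmd.polyBounded_cost (c : Cmd) : PolyBounded fun M => c.cost M := by
  induction c with
  | skip => exact .const 1
  | assign x e => exact e.polyBounded_cost.add (.const 1)
  | store a i e => exact (i.polyBounded_cost.add e.polyBounded_cost).add (.const 6)
  | seq c d ih₁ ih₂ => exact ih₁.add ih₂
  | ite e c d ih₁ ih₂ => exact (e.polyBounded_cost.add (ih₁.add ih₂)).add (.const 1)
  | loop x b c ih => exact (ih.add (.const 5)).id_mul.add (.const 3)

/-! ### Compilation -/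

/-- The store of a machine state: variable `x` is register `2 * x`, and cell `i` of array `a` is
memory cell `8 * i + a`. -/
def State.env (σ : State) : Env := ⟨fun x => σ.reg (2 * x), fun a i => σ.mem (8 * i + a)⟩

namespace State

theorem reg_setReg (σ : State) (x a y : ℕ) :
    (σ.setReg x a).reg y = if y = x then a else σ.reg y := by
  simp [setReg, Function.update_apply]

theorem reg_setReg_self (σ : State) (x a : ℕ) : (σ.setReg x a).reg x = a := by
  simp [setReg]

theorem reg_setReg_ne (σ : State) {x y : ℕ} (a : ℕ) (h : y ≠ x) :
    (σ.setReg x a).reg y = σ.reg y := by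
  simp [setReg, h]

@[simp] theorem mem_setReg (σ : State) (x a : ℕ) : (σ.setReg x a).mem = σ.mem := rfl

@[simp] theorem reg_setMem (σ : State) (i a : ℕ) : (σ.setMem i a).reg = σ.reg := rfl

@[simp] theorem env_setReg_odd (σ : State) (d a : ℕ) : (σ.setReg (2 * d + 1) a).env = σ.env := by
  ext x
  · exact reg_setReg_ne σ a (by omega)
  · rfl

@[simp] theorem env_setReg_even (σ : State) (x a : ℕ) :
    (σ.setReg (2 * x) a).env = σ.env.set x a := by
  ext y
  · simp [env, reg_setReg]
  · rfl

theorem env_setMem (σ : State) (a : Fin 8) (i v : ℕ) :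
    (σ.setMem (8 * i + a) v).env = σ.env.setArr a i v := by
  ext b j
  · rfl
  · rw [Env.setArr_arr]
    have := a.isLt; have := b.isLt
    by_cases h : b = a ∧ j = i
    · simp [env, setMem, h.1, h.2]
    · rw [if_neg h]
      have h' : 8 * j + (b : ℕ) ≠ 8 * i + (a : ℕ) := by
        intro h''
        exact h ⟨Fin.ext (by omega), by omega⟩
      simp [env, setMem, h']

theorem reg_even (σ : State) (x : ℕ) : σ.reg (2 * x) = σ.env.var x := rfl

theorem mem_eq (σ : State) (a : Fin 8) (i : ℕ) : σ.mem (8 * i + a) = σ.env.arr a i := rfl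

end State

/-- A `while` loop whose counter `c` runs down from `m` to `0`. -/
theorem Exec.while_countdown {inp : List ℕ} {c m : ℕ} {body : Prog} (I : ℕ → State → Prop)
    (u : ℕ → ℕ)
    (h : ∀ i σ, i < m → I i σ → σ.reg c = m - i →
      ∃ τ, Exec inp body σ τ (u i) ∧ I (i + 1) τ ∧ τ.reg c = m - (i + 1))
    {σ : State} (h0 : I 0 σ) (hc : σ.reg c = m) :
    ∃ τ, Exec inp (.while c body) σ τ (∑ i ∈ Finset.range m, (u i + 1) + 1) ∧ I m τ := by
  have key : ∀ r i σ, i + r = m → I i σ → σ.reg c = r →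
      ∃ τ, Exec inp (.while c body) σ τ (∑ j ∈ Finset.range r, (u (i + j) + 1) + 1) ∧ I m τ := by
    intro r
    induction r with
    | zero =>
      intro i σ hi hI hr
      obtain rfl : i = m := by omega
      exact ⟨σ, by simpa using Exec.while_false hr, hI⟩
    | succ r ih =>
      intro i σ hi hI hr
      obtain ⟨τ, h1, h2, h3⟩ := h i σ (by omega) hI (by omega)
      obtain ⟨υ, h4, h5⟩ := ih (i + 1) τ (by omega) h2 (by omega)
      refine ⟨υ, ?_, h5⟩
      have h6 := Exec.while_true (by omega) h1 h4
      convert h6 using 1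
      rw [Finset.sum_range_succ']
      have h7 : ∀ j, u (i + (j + 1)) = u (i + 1 + j) := fun j => by congr 1; omega
      simp only [h7, add_zero]
      ring
  simpa using key m 0 σ (by omega) h0 hc

/-- The compiled expression leaves its value in register `2 * d + 1`; it uses the odd registers
from there on. -/
def Exp.comp : Exp → ℕ → Prog
  | lit c, d => .const (2 * d + 1) c
  | var x, d => .copy (2 * d + 1) (2 * x)
  | arr a i, d =>
    .seq (i.comp d) <| .seq (.add (2 * d + 1) (2 * d + 1) (2 * d + 1)) <|
    .seq (.add (2 * d + 1) (2 * d + 1) (2 * d + 1)) <|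
    .seq (.add (2 * d + 1) (2 * d + 1) (2 * d + 1)) <|
    .seq (.const (2 * (d + 1) + 1) a) <|
    .seq (.add (2 * d + 1) (2 * d + 1) (2 * (d + 1) + 1)) <| .load (2 * d + 1) (2 * d + 1)
  | inp i, d => .seq (i.comp d) (.read (2 * d + 1) (2 * d + 1))
  | add e f, d =>
    .seq (e.comp d) <| .seq (f.comp (d + 1)) <|
    .add (2 * d + 1) (2 * d + 1) (2 * (d + 1) + 1)
  | sub e f, d =>
    .seq (e.comp d) <| .seq (f.comp (d + 1)) <|
    .sub (2 * d + 1) (2 * d + 1) (2 * (d + 1) + 1)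
  | ite c e f, d => .seq (c.comp d) (.ite (2 * d + 1) (e.comp d) (f.comp d))
  | sum x b e, d =>
    .seq (.copy (2 * d + 1) (2 * x)) <| .seq (.const (2 * (d + 1) + 1) 0) <|
    .seq (.copy (2 * (d + 2) + 1) (2 * b)) <| .seq (.const (2 * x) 0) <|
    .seq (.while (2 * (d + 2) + 1) <|
      .seq (e.comp (d + 3)) <|
      .seq (.add (2 * (d + 1) + 1) (2 * (d + 1) + 1) (2 * (d + 3) + 1)) <|
      .seq (.const (2 * (d + 3) + 1) 1) <|
      .seq (.add (2 * x) (2 * x) (2 * (d + 3) + 1)) <|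
      .sub (2 * (d + 2) + 1) (2 * (d + 2) + 1) (2 * (d + 3) + 1)) <|
    .seq (.copy (2 * x) (2 * d + 1)) (.copy (2 * d + 1) (2 * (d + 1) + 1))

/-- A loop keeps its index in slot `d` and its countdown in slot `d + 1`, outside the store. Writes
of the body to `x` or `b` therefore do not change the number of iterations, in agreement with
`Cmd.run`. -/
def Cmd.comp : Cmd → ℕ → Prog
  | skip, d => .const (2 * d + 1) 0
  | assign x e, d => .seq (e.comp d) (.copy (2 * x) (2 * d + 1))
  | store a i e, d =>
    .seq (i.comp d) <| .seq (e.comp (d + 1)) <|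
    .seq (.add (2 * d + 1) (2 * d + 1) (2 * d + 1)) <|
    .seq (.add (2 * d + 1) (2 * d + 1) (2 * d + 1)) <|
    .seq (.add (2 * d + 1) (2 * d + 1) (2 * d + 1)) <|
    .seq (.const (2 * (d + 2) + 1) a) <|
    .seq (.add (2 * d + 1) (2 * d + 1) (2 * (d + 2) + 1)) <|
    .store (2 * d + 1) (2 * (d + 1) + 1)
  | seq c c', d => .seq (c.comp d) (c'.comp d)
  | ite e c c', d => .seq (e.comp d) (.ite (2 * d + 1) (c.comp d) (c'.comp d))
  | loop x b c, d =>
    .seq (.const (2 * d + 1) 0) <| .seq (.copy (2 * (d + 1) + 1) (2 * b)) <|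
    .while (2 * (d + 1) + 1) <|
      .seq (.copy (2 * x) (2 * d + 1)) <| .seq (c.comp (d + 2)) <|
      .seq (.const (2 * (d + 2) + 1) 1) <|
      .seq (.add (2 * d + 1) (2 * d + 1) (2 * (d + 2) + 1)) <|
      .sub (2 * (d + 1) + 1) (2 * (d + 1) + 1) (2 * (d + 2) + 1)

theorem Exec.congr_time {inp : List ℕ} {p : Prog} {σ τ : State} {t u : ℕ}
    (h : Exec inp p σ τ t) (e : t = u) : Exec inp p σ τ u := e ▸ h

/-- The odd registers act as an evaluation stack of height `d`: what lies below is preserved, so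
partial results survive. A sum borrows the register of its variable: slot `d` saves the old value,
`d + 1` accumulates, `d + 2` counts down, the summand is evaluated from `d + 3` on, and the variable
is restored at the end. Hence expressions have no side effects on the store. -/
theorem Exp.exec_comp (inp : List ℕ) (e : Exp) (d : ℕ) (σ : State) :
    ∃ τ, Exec inp (e.comp d) σ τ (e.time inp σ.env) ∧ τ.env = σ.env ∧
      (∀ i < d, τ.reg (2 * i + 1) = σ.reg (2 * i + 1)) ∧
      τ.reg (2 * d + 1) = e.eval inp σ.env := by
  induction e generalizing d σ with
  | lit c =>
    refine ⟨_, .const _ _ _, by simp, fun i hi => ?_, ?_⟩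
    · exact State.reg_setReg_ne _ _ (by omega)
    · simp [State.reg_setReg, eval]
  | var x =>
    refine ⟨_, .copy _ _ _, by simp, fun i hi => ?_, ?_⟩
    · exact State.reg_setReg_ne _ _ (by omega)
    · simp [State.reg_setReg, eval, State.reg_even]
  | arr a i ih =>
    obtain ⟨τ, h1, h2, h3, h4⟩ := ih d σ
    refine ⟨_, (Exec.seq h1 <| .seq (.add _ _ _ _) <| .seq (.add _ _ _ _) <|
      .seq (.add _ _ _ _) <| .seq (.const _ _ _) <| .seq (.add _ _ _ _) <|
      .load _ _ _).congr_time rfl, by simp [h2], fun j hj => ?_, ?_⟩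
    · simp (disch := omega) only [State.reg_setReg_ne, h3 j hj]
    · simp (disch := omega) only [State.reg_setReg_ne, State.reg_setReg_self, h4, eval,
        State.mem_setReg]
      rw [← h2, ← State.mem_eq]
      congr 1; ring
  | inp i ih =>
    obtain ⟨τ, h1, h2, h3, h4⟩ := ih d σ
    refine ⟨_, Exec.seq h1 (.read _ _ _), by simp [h2], fun j hj => ?_, ?_⟩
    · simp (disch := omega) only [State.reg_setReg_ne, h3 j hj]
    · simp only [State.reg_setReg_self, h4, eval]
  | add e f ih₁ ih₂ =>
    obtain ⟨τ, h1, h2, h3, h4⟩ := ih₁ d σ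
    obtain ⟨υ, k1, k2, k3, k4⟩ := ih₂ (d + 1) τ
    rw [h2] at k1 k2 k4
    refine ⟨_, (Exec.seq h1 <| .seq k1 <| .add _ _ _ _).congr_time (by simp only [time]; ring),
      by simp [k2], fun j hj => ?_, ?_⟩
    · simp (disch := omega) only [State.reg_setReg_ne, h3 j hj, k3 j (by omega)]
    · simp only [State.reg_setReg_self, k4, k3 d (by omega), h4, eval]
  | sub e f ih₁ ih₂ =>
    obtain ⟨τ, h1, h2, h3, h4⟩ := ih₁ d σ
    obtain ⟨υ, k1, k2, k3, k4⟩ := ih₂ (d + 1) τ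
    rw [h2] at k1 k2 k4
    refine ⟨_, (Exec.seq h1 <| .seq k1 <| .sub _ _ _ _).congr_time (by simp only [time]; ring),
      by simp [k2], fun j hj => ?_, ?_⟩
    · simp (disch := omega) only [State.reg_setReg_ne, h3 j hj, k3 j (by omega)]
    · simp only [State.reg_setReg_self, k4, k3 d (by omega), h4, eval]
  | ite c e f ih₀ ih₁ ih₂ =>
    obtain ⟨τ, h1, h2, h3, h4⟩ := ih₀ d σ
    by_cases hc : c.eval inp σ.env ≠ 0
    · obtain ⟨υ, k1, k2, k3, k4⟩ := ih₁ d τ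
      rw [h2] at k1 k2 k4
      refine ⟨υ, (Exec.seq h1 (.ite_true (by rwa [h4]) k1)).congr_time ?_, k2,
        fun j hj => (k3 j hj).trans (h3 j hj), ?_⟩
      · simp only [time, if_pos hc]; ring
      · simp only [eval, if_pos hc, k4]
    · obtain ⟨υ, k1, k2, k3, k4⟩ := ih₂ d τ
      rw [h2] at k1 k2 k4
      refine ⟨υ, (Exec.seq h1 (.ite_false (by rw [h4]; omega) k1)).congr_time ?_, k2,
        fun j hj => (k3 j hj).trans (h3 j hj), ?_⟩
      · simp only [time, if_neg hc]; ring
      · simp only [eval, if_neg hc, k4]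
  | sum x b e ih =>
    set ρ := σ.env with hρ
    obtain ⟨τ, h1, h2, h3, h4, h5⟩ := Exec.while_countdown (inp := inp)
      (c := 2 * (d + 2) + 1) (m := ρ.var b)
      (body := .seq (e.comp (d + 3)) <|
        .seq (.add (2 * (d + 1) + 1) (2 * (d + 1) + 1) (2 * (d + 3) + 1)) <|
        .seq (.const (2 * (d + 3) + 1) 1) <|
        .seq (.add (2 * x) (2 * x) (2 * (d + 3) + 1)) <|
        .sub (2 * (d + 2) + 1) (2 * (d + 2) + 1) (2 * (d + 3) + 1))
      (fun i τ => τ.env = ρ.set x i ∧ (∀ j < d, τ.reg (2 * j + 1) = σ.reg (2 * j + 1)) ∧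
        τ.reg (2 * d + 1) = ρ.var x ∧
        τ.reg (2 * (d + 1) + 1) = ∑ j ∈ Finset.range i, e.eval inp (ρ.set x j))
      (fun i => e.time inp (ρ.set x i) + 4)
      (by
        rintro i τ hi ⟨h1, h2, h3, h4⟩ h5
        obtain ⟨υ, k1, k2, k3, k4⟩ := ih (d + 3) τ
        rw [h1] at k1 k2 k4
        refine ⟨_, Exec.seq k1 <| .seq (.add _ _ _ _) <| .seq (.const _ _ _) <|
          .seq (.add _ _ _ _) <| .sub _ _ _ _, ⟨?_, fun j hj => ?_, ?_, ?_⟩, ?_⟩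
        · simp (disch := omega) only [State.env_setReg_odd, State.env_setReg_even, k2,
            Env.set_set, State.reg_setReg_self, State.reg_setReg_ne]
          rw [State.reg_even, k2]; simp
        · simp (disch := omega) only [State.reg_setReg_ne, k3 j (by omega), h2 j hj]
        · simp (disch := omega) only [State.reg_setReg_ne, k3 d (by omega), h3]
        · simp (disch := omega) only [State.reg_setReg_ne, State.reg_setReg_self,
            k3 (d + 1) (by omega), h4, k4, Finset.sum_range_succ]
        · simp (disch := omega) only [State.reg_setReg_ne, State.reg_setReg_self,
            k3 (d + 2) (by omega), h5]
          omega)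
      (σ := (((σ.setReg (2 * d + 1) (σ.reg (2 * x))).setReg (2 * (d + 1) + 1) 0).setReg
        (2 * (d + 2) + 1) (((σ.setReg (2 * d + 1) (σ.reg (2 * x))).setReg
          (2 * (d + 1) + 1) 0).reg (2 * b))).setReg (2 * x) 0)
      (by
        refine ⟨by simp [← hρ], fun j hj => ?_, ?_, ?_⟩
        · simp (disch := omega) only [State.reg_setReg_ne]
        · simp (disch := omega) only [State.reg_setReg_ne, State.reg_setReg_self]; rfl
        · simp (disch := omega) only [State.reg_setReg_ne, State.reg_setReg_self]; simp)
      (by simp (disch := omega) only [State.reg_setReg_ne, State.reg_setReg_self]; rfl)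
    refine ⟨_, (Exec.seq (.copy _ _ _) <| .seq (.const _ _ _) <| .seq (.copy _ _ _) <|
      .seq (.const _ _ _) <| .seq h1 <| .seq (.copy _ _ _) (.copy _ _ _)).congr_time
      (by simp only [time]; ring), ?_, fun j hj => ?_, ?_⟩
    · simp only [State.env_setReg_odd, State.env_setReg_even, h2, h4, Env.set_set, Env.set_self]
    · simp (disch := omega) only [State.reg_setReg_ne, h3 j hj]
    · simp (disch := omega) only [State.reg_setReg_ne, State.reg_setReg_self, h5, eval]

theorem Cmd.exec_comp (inp : List ℕ) (c : Cmd) (d : ℕ) (σ : State) :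
    ∃ τ, Exec inp (c.comp d) σ τ (c.time inp σ.env) ∧ τ.env = c.run inp σ.env ∧
      (∀ i < d, τ.reg (2 * i + 1) = σ.reg (2 * i + 1)) := by
  induction c generalizing d σ with
  | skip =>
    refine ⟨_, .const _ _ _, by simp [run], fun i hi => ?_⟩
    exact State.reg_setReg_ne _ _ (by omega)
  | assign x e =>
    obtain ⟨τ, h1, h2, h3, h4⟩ := e.exec_comp inp d σ
    refine ⟨_, .seq h1 (.copy _ _ _), by simp [run, h2, h4], fun i hi => ?_⟩
    simp (disch := omega) only [State.reg_setReg_ne, h3 i hi]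
  | store a i e =>
    obtain ⟨τ, h1, h2, h3, h4⟩ := i.exec_comp inp d σ
    obtain ⟨υ, k1, k2, k3, k4⟩ := e.exec_comp inp (d + 1) τ
    rw [h2] at k1 k2 k4
    refine ⟨_, (Exec.seq h1 <| .seq k1 <| .seq (.add _ _ _ _) <| .seq (.add _ _ _ _) <|
      .seq (.add _ _ _ _) <| .seq (.const _ _ _) <| .seq (.add _ _ _ _) <|
      .store _ _ _).congr_time (by simp only [time]; ring), ?_, fun j hj => ?_⟩
    · simp (disch := omega) only [State.reg_setReg_ne, State.reg_setReg_self, k4,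
        k3 d (by omega), h4, run]
      rw [← k2]
      have h8 : ∀ m, m + m + (m + m) + (m + m + (m + m)) + (a : ℕ) = 8 * m + a := fun m => by ring
      rw [h8, State.env_setMem]
      simp
    · simp (disch := omega) only [State.reg_setMem, State.reg_setReg_ne, k3 j (by omega), h3 j hj]
  | seq c c' ih₁ ih₂ =>
    obtain ⟨τ, h1, h2, h3⟩ := ih₁ d σ
    obtain ⟨υ, k1, k2, k3⟩ := ih₂ d τ
    rw [h2] at k1 k2
    exact ⟨υ, .seq h1 k1, k2, fun i hi => (k3 i hi).trans (h3 i hi)⟩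
  | ite e c c' ih₁ ih₂ =>
    obtain ⟨τ, h1, h2, h3, h4⟩ := e.exec_comp inp d σ
    by_cases hc : e.eval inp σ.env ≠ 0
    · obtain ⟨υ, k1, k2, k3⟩ := ih₁ d τ
      rw [h2] at k1 k2
      refine ⟨υ, (Exec.seq h1 (.ite_true (by rwa [h4]) k1)).congr_time ?_, ?_,
        fun j hj => (k3 j hj).trans (h3 j hj)⟩
      · simp only [time, if_pos hc]; ring
      · simp only [run, if_pos hc, k2]
    · obtain ⟨υ, k1, k2, k3⟩ := ih₂ d τ
      rw [h2] at k1 k2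
      refine ⟨υ, (Exec.seq h1 (.ite_false (by rw [h4]; omega) k1)).congr_time ?_, ?_,
        fun j hj => (k3 j hj).trans (h3 j hj)⟩
      · simp only [time, if_neg hc]; ring
      · simp only [run, if_neg hc, k2]
  | loop x b c ih =>
    set ρ := σ.env with hρ
    obtain ⟨τ, h1, h2, h3, -⟩ := Exec.while_countdown (inp := inp)
      (c := 2 * (d + 1) + 1) (m := ρ.var b)
      (body := .seq (.copy (2 * x) (2 * d + 1)) <| .seq (c.comp (d + 2)) <|
        .seq (.const (2 * (d + 2) + 1) 1) <|
        .seq (.add (2 * d + 1) (2 * d + 1) (2 * (d + 2) + 1)) <|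
        .sub (2 * (d + 1) + 1) (2 * (d + 1) + 1) (2 * (d + 2) + 1))
      (fun i τ => τ.env = iter (fun i τ => c.run inp (τ.set x i)) i ρ ∧
        (∀ j < d, τ.reg (2 * j + 1) = σ.reg (2 * j + 1)) ∧ τ.reg (2 * d + 1) = i)
      (fun i => c.time inp ((iter (fun i τ => c.run inp (τ.set x i)) i ρ).set x i) + 4)
      (by
        rintro i τ hi ⟨h1, h2, h3⟩ h4
        obtain ⟨υ, k1, k2, k3⟩ := ih (d + 2) (τ.setReg (2 * x) (τ.reg (2 * d + 1)))
        simp only [State.env_setReg_even, h1, h3] at k1 k2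
        have k4 : ∀ j < d + 2, υ.reg (2 * j + 1) = τ.reg (2 * j + 1) := fun j hj => by
          rw [k3 j hj]; exact State.reg_setReg_ne _ _ (by omega)
        rw [← h3] at k1
        refine ⟨_, (Exec.seq (.copy _ _ _) <| .seq k1 <| .seq (.const _ _ _) <|
          .seq (.add _ _ _ _) <| .sub _ _ _ _).congr_time (by rw [h3]; ring),
          ⟨?_, fun j hj => ?_, ?_⟩, ?_⟩
        · simp only [State.env_setReg_odd, k2, iter]
        · simp (disch := omega) only [State.reg_setReg_ne, k4 j (by omega), h2 j hj]
        · simp (disch := omega) only [State.reg_setReg_ne, State.reg_setReg_self,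
            k4 d (by omega), h3]
        · simp (disch := omega) only [State.reg_setReg_ne, State.reg_setReg_self,
            k4 (d + 1) (by omega), h4]
          omega)
      (σ := (σ.setReg (2 * d + 1) 0).setReg (2 * (d + 1) + 1)
        ((σ.setReg (2 * d + 1) 0).reg (2 * b)))
      (by
        refine ⟨by simp [← hρ, iter], fun j hj => ?_, ?_⟩
        · simp (disch := omega) only [State.reg_setReg_ne]
        · simp (disch := omega) only [State.reg_setReg_ne, State.reg_setReg_self])
      (by simp (disch := omega) only [State.reg_setReg_ne, State.reg_setReg_self]; rfl)
    exact ⟨τ, (Exec.seq (.const _ _ _) <| .seq (.copy _ _ _) h1).congr_time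
      (by simp only [time]; ring), h2, h3⟩

/-! ### Derived expressions -/

namespace Exp

/-- The value of `e` is nonzero. -/
def Tr (inp : List ℕ) (e : Exp) (ρ : Env) : Prop := e.eval inp ρ ≠ 0

instance (inp : List ℕ) (e : Exp) (ρ : Env) : Decidable (e.Tr inp ρ) :=
  inferInstanceAs (Decidable (_ ≠ 0))

def le (e f : Exp) : Exp := .sub (.lit 1) (.sub e f)

def lt (e f : Exp) : Exp := le (.add e (.lit 1)) f

def and (e f : Exp) : Exp := .ite e f (.lit 0)

def or (e f : Exp) : Exp := .ite e (.lit 1) f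

def not (e : Exp) : Exp := .ite e (.lit 0) (.lit 1)

def eq (e f : Exp) : Exp := and (le e f) (le f e)

/-- `e` holds for all `x < b`. -/
def all (x b : ℕ) (e : Exp) : Exp := not (.sum x b (not e))

/-- The number of `x < b` for which `e` holds. -/
def count (x b : ℕ) (e : Exp) : Exp := .sum x b (.ite e (.lit 1) (.lit 0))

section

variable {inp : List ℕ} {ρ : Env} {e f c : Exp}

@[simp] theorem eval_lit (a : ℕ) : (lit a).eval inp ρ = a := rfl

@[simp] theorem eval_var (x : ℕ) : (var x).eval inp ρ = ρ.var x := rfl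

@[simp] theorem eval_arr (a : Fin 8) : (arr a e).eval inp ρ = ρ.arr a (e.eval inp ρ) := rfl

@[simp] theorem eval_inp : (Exp.inp e).eval inp ρ = inp.getD (e.eval inp ρ) 0 := rfl

@[simp] theorem eval_add : (add e f).eval inp ρ = e.eval inp ρ + f.eval inp ρ := rfl

@[simp] theorem eval_sub : (sub e f).eval inp ρ = e.eval inp ρ - f.eval inp ρ := rfl

@[simp] theorem eval_ite :
    (ite c e f).eval inp ρ = if c.Tr inp ρ then e.eval inp ρ else f.eval inp ρ := rfl

@[simp] theorem eval_sum (x b : ℕ) :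
    (sum x b e).eval inp ρ = ∑ i ∈ Finset.range (ρ.var b), e.eval inp (ρ.set x i) := rfl

@[simp] theorem tr_var (x : ℕ) : (var x).Tr inp ρ ↔ ρ.var x ≠ 0 := Iff.rfl

@[simp] theorem tr_arr (a : Fin 8) : (arr a e).Tr inp ρ ↔ ρ.arr a (e.eval inp ρ) ≠ 0 := Iff.rfl

theorem tr_inp : (Exp.inp e).Tr inp ρ ↔ inp.getD (e.eval inp ρ) 0 ≠ 0 := Iff.rfl

@[simp] theorem tr_le : (le e f).Tr inp ρ ↔ e.eval inp ρ ≤ f.eval inp ρ := by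
  simp [le, Tr]; omega

@[simp] theorem tr_lt : (lt e f).Tr inp ρ ↔ e.eval inp ρ < f.eval inp ρ := by
  simp only [lt, tr_le, eval_add, eval_lit, Nat.add_one_le_iff]

@[simp] theorem tr_and : (and e f).Tr inp ρ ↔ e.Tr inp ρ ∧ f.Tr inp ρ := by
  by_cases h : e.Tr inp ρ <;> simp [and, Tr] at * <;> simp [h]

@[simp] theorem tr_or : (or e f).Tr inp ρ ↔ e.Tr inp ρ ∨ f.Tr inp ρ := by
  by_cases h : e.Tr inp ρ <;> simp [or, Tr] at * <;> simp [h]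

@[simp] theorem tr_not : (not e).Tr inp ρ ↔ ¬ e.Tr inp ρ := by
  by_cases h : e.Tr inp ρ <;> simp [not, Tr] at * <;> simp [h]

@[simp] theorem tr_eq : (eq e f).Tr inp ρ ↔ e.eval inp ρ = f.eval inp ρ := by
  simp [eq]; omega

@[simp] theorem tr_all (x b : ℕ) :
    (all x b e).Tr inp ρ ↔ ∀ i < ρ.var b, e.Tr inp (ρ.set x i) := by
  rw [all, tr_not]
  simp only [Tr, eval_sum, ne_eq, not_not, Finset.sum_eq_zero_iff, Finset.mem_range]
  refine forall₂_congr fun i _ => ?_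
  have := tr_not (inp := inp) (ρ := ρ.set x i) (e := e)
  simp only [Tr] at this
  tauto

@[simp] theorem eval_count (x b : ℕ) :
    (count x b e).eval inp ρ
      = ((Finset.range (ρ.var b)).filter fun i => e.Tr inp (ρ.set x i)).card := by
  simp [count]

end

/-- The quotient of the variables `y` and `b`, if the former is at most the variable `t`. -/
def quot (t y b : ℕ) : Exp :=
  .sum 97 t (le (.sum 98 b (.add (.var 97) (.lit 1))) (.var y))

/-- The summand is the truth value, `0` or `1`, of `(i + 1) * b ≤ y`, which says `i < y / b`; the
inner sum replaces the missing multiplication. Cutting off at `t` loses nothing because `y / b ≤ y ≤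
t`. -/
theorem eval_quot {inp : List ℕ} {ρ : Env} {t y b : ℕ} (hy : y ≠ 97)
    (hb : b ≠ 97) (hb' : 0 < ρ.var b) (ht : ρ.var y ≤ ρ.var t) :
    (quot t y b).eval inp ρ = ρ.var y / ρ.var b := by
  have h1 : ∀ i, (le (.sum 98 b (.add (.var 97) (.lit 1))) (.var y)).eval inp (ρ.set 97 i)
      = if i < ρ.var y / ρ.var b then 1 else 0 := by
    intro i
    have h2 := tr_le (inp := inp) (ρ := ρ.set 97 i)
      (e := (.sum 98 b (.add (.var 97) (.lit 1)))) (f := .var y)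
    simp only [eval_sum, eval_add, eval_var, eval_lit, Env.set_var, if_neg hy, if_neg hb,
      Nat.reduceEqDiff, if_true, if_false, Finset.sum_const,
      Finset.card_range, smul_eq_mul] at h2
    rw [mul_comm, ← Nat.le_div_iff_mul_le hb', Nat.add_one_le_iff] at h2
    split_ifs with h
    · have h3 := h2.2 h
      simp only [Tr, le, eval_sub, eval_lit] at h3 ⊢
      omega
    · by_contra h3
      exact h (h2.1 h3)
  simp only [quot, eval_sum, h1]
  rw [← Finset.sum_filter, Finset.sum_const, smul_eq_mul, mul_one]
  have h4 : (Finset.range (ρ.var t)).filter (fun i => i < ρ.var y / ρ.var b)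
      = Finset.range (ρ.var y / ρ.var b) := by
    ext i
    have := Nat.div_le_self (ρ.var y) (ρ.var b)
    simp only [Finset.mem_filter, Finset.mem_range]
    omega
  rw [h4, Finset.card_range]

/-- Adjacency of the vertices in the variables `x` and `y`; variable `1` holds the number of
vertices. -/
def adj (x y : ℕ) : Exp :=
  and (lt (.var x) (.var 1)) <| and (lt (.var y) (.var 1)) <|
    .inp (.add (.lit 3) (.add (.sum 99 1 (.var x)) (.var y)))

end Exp

namespace Cmd

section

variable {inp : List ℕ} {ρ : Env}

@[simp] theorem run_skip : skip.run inp ρ = ρ := rfl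

@[simp] theorem run_assign (x : ℕ) (e : Exp) :
    (assign x e).run inp ρ = ρ.set x (e.eval inp ρ) := rfl

@[simp] theorem run_store (a : Fin 8) (i e : Exp) :
    (store a i e).run inp ρ = ρ.setArr a (i.eval inp ρ) (e.eval inp ρ) := rfl

@[simp] theorem run_seq (c d : Cmd) : (seq c d).run inp ρ = d.run inp (c.run inp ρ) := rfl

@[simp] theorem run_ite (e : Exp) (c d : Cmd) :
    (ite e c d).run inp ρ = if e.Tr inp ρ then c.run inp ρ else d.run inp ρ := rfl

theorem run_loop (x b : ℕ) (c : Cmd) :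
    (loop x b c).run inp ρ = iter (fun i τ => c.run inp (τ.set x i)) (ρ.var b) ρ := rfl

theorem loop_induction {x b m : ℕ} {c : Cmd} (I : ℕ → Env → Prop) (hm : ρ.var b = m)
    (h0 : I 0 ρ) (hs : ∀ i τ, i < m → I i τ → I (i + 1) (c.run inp (τ.set x i))) :
    I m ((loop x b c).run inp ρ) := by
  rw [run_loop, hm]
  exact iter_induction I m h0 hs

end

/-- Split the number in variable `y`, which is at most the variable `t`: put the remainder modulo
the variable `b` into variable `x`, and leave the quotient in `y`. -/
def split (t y b x : ℕ) : Cmd :=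
  seq (assign 96 (.quot t y b)) <|
  seq (assign x (.sub (.var y) (.sum 98 b (.var 96)))) (assign y (.var 96))

theorem run_split {inp : List ℕ} {ρ : Env} {t y b x : ℕ} (hy : y ≠ 96 ∧ y ≠ 97)
    (hb : b ≠ 96 ∧ b ≠ 97) (hx : x ≠ 96) (hb' : 0 < ρ.var b)
    (ht : ρ.var y ≤ ρ.var t) :
    (split t y b x).run inp ρ
      = ((ρ.set 96 (ρ.var y / ρ.var b)).set x (ρ.var y % ρ.var b)).set y (ρ.var y / ρ.var b) := by
  have h1 : ρ.var y - ρ.var b * (ρ.var y / ρ.var b) = ρ.var y % ρ.var b := by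
    have := Nat.div_add_mod (ρ.var y) (ρ.var b)
    omega
  simp only [split, run_seq, run_assign, Exp.eval_quot hy.2 hb.2 hb' ht]
  simp [hy.1, hb.1, Ne.symm hx, h1]

end Cmd

/-! ### The input -/

section Input

variable {n : ℕ} (s : ℕ) (G : SimpleGraph (Fin n)) (k : ℕ)

/-- The graph on the natural numbers with the edges of `G`. -/
def natGraph {n : ℕ} (G : SimpleGraph (Fin n)) : SimpleGraph ℕ where
  Adj i j := ∃ (hi : i < n) (hj : j < n), G.Adj ⟨i, hi⟩ ⟨j, hj⟩
  symm := ⟨fun _ _ ⟨hi, hj, h⟩ => ⟨hj, hi, h.symm⟩⟩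
  loopless := ⟨fun _ ⟨_, _, h⟩ => h.ne rfl⟩

theorem natGraph_adj {i j : ℕ} :
    (natGraph G).Adj i j ↔ ∃ (hi : i < n) (hj : j < n), G.Adj ⟨i, hi⟩ ⟨j, hj⟩ := Iff.rfl

theorem encode_getD_zero : (encode s G k).getD 0 0 = n := rfl

theorem encode_getD_one : (encode s G k).getD 1 0 = k := rfl

theorem encode_getD_two : (encode s G k).getD 2 0 = s := rfl

open Classical in
theorem encode_getD_adj {i j : ℕ} (hi : i < n) (hj : j < n) :
    (encode s G k).getD (3 + (i * n + j)) 0 ≠ 0 ↔ (natGraph G).Adj i j := by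
  have h1 : i * n + j < n * n := by nlinarith
  have h2 : (i * n + j) / n = i := by
    rw [mul_comm, Nat.mul_add_div (by omega), Nat.div_eq_of_lt hj, add_zero]
  have h3 : (i * n + j) % n = j := by
    rw [mul_comm, Nat.mul_add_mod, Nat.mod_eq_of_lt hj]
  rw [natGraph_adj]
  have h4 : (encode s G k).getD (3 + (i * n + j)) 0
      = if G.Adj ⟨i, hi⟩ ⟨j, hj⟩ then 1 else 0 := by
    rw [show 3 + (i * n + j) = (i * n + j) + 1 + 1 + 1 by ring]
    simp only [encode, List.getD_cons_succ]
    rw [List.getD_eq_getElem _ _ (by simpa using h1)]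
    simp only [List.getElem_ofFn]
    have h5 : ∀ h : i * n + j < n * n, (⟨i * n + j, h⟩ : Fin (n * n)).divNat = ⟨i, hi⟩ :=
      fun _ => Fin.ext h2
    have h6 : ∀ h : i * n + j < n * n, (⟨i * n + j, h⟩ : Fin (n * n)).modNat = ⟨j, hj⟩ :=
      fun _ => Fin.ext h3
    simp only [h5, h6]
  rw [h4]
  simp [hi, hj]

/-- The product of the row index and `n` is a sum of `n` equal terms. The range tests matter: a
column index beyond `n - 1` would point into a later row. Variable `99` is the summation variable,
so it cannot serve as the row index. -/
theorem Exp.tr_adj {ρ : Env} {x y : ℕ} (h : ρ.var 1 = n) (hx : x ≠ 99) :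
    (Exp.adj x y).Tr (encode s G k) ρ ↔ (natGraph G).Adj (ρ.var x) (ρ.var y) := by
  simp only [Exp.adj, Exp.tr_and, Exp.tr_lt, Exp.tr_inp, Exp.eval_add, Exp.eval_sum,
    Exp.eval_var, Exp.eval_lit, Env.set_var, if_neg hx, Finset.sum_const, Finset.card_range,
    smul_eq_mul, h]
  constructor
  · rintro ⟨h1, h2, h3⟩
    rwa [mul_comm, encode_getD_adj s G k h1 h2] at h3
  · intro h3
    obtain ⟨h1, h2, -⟩ := (natGraph_adj G).1 h3
    exact ⟨h1, h2, by rwa [mul_comm, encode_getD_adj s G k h1 h2]⟩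

end Input

/-! ## Graph theory -/

/-- The nonadjacent pairs `(u, v)` with `v < u` in `S`. -/
noncomputable def missing {V : Type*} [LinearOrder V] (H : SimpleGraph V) (S : Finset V) :
    Finset (V × V) :=
  open Classical in (S ×ˢ S).filter fun p => p.2 < p.1 ∧ ¬ H.Adj p.1 p.2

theorem mem_missing {V : Type*} [LinearOrder V] {H : SimpleGraph V} {S : Finset V} {p : V × V} :
    p ∈ missing H S ↔ (p.1 ∈ S ∧ p.2 ∈ S) ∧ p.2 < p.1 ∧ ¬ H.Adj p.1 p.2 := by
  simp [missing]

theorem missing_mono {V : Type*} [LinearOrder V] (H : SimpleGraph V) {S S' : Finset V}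
    (h : S ⊆ S') : missing H S ⊆ missing H S' := fun p hp => by
  rw [mem_missing] at hp ⊢
  exact ⟨⟨h hp.1.1, h hp.1.2⟩, hp.2⟩

theorem ncard_edgeSet_eq {V : Type*} [LinearOrder V] (F : SimpleGraph V) :
    F.edgeSet.ncard = {p : V × V | p.2 < p.1 ∧ F.Adj p.1 p.2}.ncard := by
  rw [← Set.InjOn.ncard_image (f := fun p : V × V => s(p.1, p.2))]
  · congr 1
    ext e
    induction e with
    | _ a b =>
      simp only [SimpleGraph.mem_edgeSet, Set.mem_image, Set.mem_ofPred_eq, Prod.exists]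
      constructor
      · intro h
        rcases lt_or_gt_of_ne h.ne with h' | h'
        · exact ⟨b, a, ⟨h', h.symm⟩, Sym2.eq_swap⟩
        · exact ⟨a, b, ⟨h', h⟩, rfl⟩
      · rintro ⟨c, d, ⟨-, h⟩, h'⟩
        rw [← SimpleGraph.mem_edgeSet, ← h']
        exact h
  · rintro ⟨a, b⟩ ⟨h, -⟩ ⟨c, d⟩ ⟨h', -⟩ heq
    simp only [Sym2.eq_iff] at heq
    rcases heq with ⟨rfl, rfl⟩ | ⟨rfl, rfl⟩
    · rfl
    · exact absurd h (not_lt.2 h'.le)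

/-- Counting the edges of the complete graph in the same way as those of `H` gives the binomial
coefficient; the difference of the two counts is the number of missing edges. -/
theorem isDefectiveClique_iff {V : Type*} [Fintype V] [LinearOrder V] (s : ℕ) (H : SimpleGraph V)
    (S : Finset V) : IsDefectiveClique s H S ↔ (missing H S).card ≤ s := by
  classical
  have h1 : ∀ F : SimpleGraph V, (F.induce (S : Set V)).edgeSet.ncard
      = ((S ×ˢ S).filter fun p => p.2 < p.1 ∧ F.Adj p.1 p.2).card := by
    intro F
    rw [ncard_edgeSet_eq, ← Set.ncard_coe_finset, ← Set.ncard_image_of_injective _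
      (Function.Injective.prodMap Subtype.val_injective Subtype.val_injective)]
    congr 1
    ext ⟨a, b⟩
    simp only [Set.mem_image, Set.mem_ofPred_eq, Prod.exists, Finset.coe_filter,
      Finset.mem_product, SimpleGraph.comap_adj, Function.Embedding.subtype_apply, Prod.map_apply,
      Prod.mk.injEq]
    constructor
    · rintro ⟨⟨a', ha⟩, ⟨b', hb⟩, ⟨h1, h2⟩, rfl, rfl⟩
      exact ⟨⟨ha, hb⟩, h1, h2⟩
    · rintro ⟨⟨ha, hb⟩, h1, h2⟩
      exact ⟨⟨a, ha⟩, ⟨b, hb⟩, ⟨h1, h2⟩, rfl, rfl⟩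
  have h2 : S.card.choose 2 = ((S ×ˢ S).filter fun p => p.2 < p.1).card := by
    have h3 := h1 ⊤
    have h4 : ((⊤ : SimpleGraph V).induce (S : Set V)) = ⊤ := by
      ext a b
      simp only [SimpleGraph.comap_adj, SimpleGraph.top_adj, ne_eq,
        Function.Embedding.subtype_apply, Subtype.val_inj]
    rw [h4, ← SimpleGraph.coe_edgeFinset, Set.ncard_coe_finset,
      SimpleGraph.card_edgeFinset_top_eq_card_choose_two] at h3
    simp only [SetLike.coe_sort_coe, Fintype.card_coe, SimpleGraph.top_adj] at h3
    rw [h3]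
    congr 1
    ext p
    simp only [Finset.mem_filter, and_congr_right_iff, and_iff_left_iff_imp]
    exact fun _ h => h.ne'
  have h5 : ((S ×ˢ S).filter fun p => p.2 < p.1).card
      = ((S ×ˢ S).filter fun p => p.2 < p.1 ∧ H.Adj p.1 p.2).card + (missing H S).card := by
    rw [← Finset.card_filter_add_card_filter_not (fun p : V × V => H.Adj p.1 p.2),
      Finset.filter_filter, Finset.filter_filter, missing]
  rw [IsDefectiveClique, h1, h2, h5]
  omega

theorem hasDefectiveClique_iff {n : ℕ} (s k : ℕ) (G : SimpleGraph (Fin n)) :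
    HasDefectiveClique s G k ↔
      ∃ S ⊆ Finset.range n, k ≤ S.card ∧ (missing (natGraph G) S).card ≤ s := by
  classical
  have h : ∀ S : Finset (Fin n), (missing (natGraph G) (S.map Fin.valEmbedding)).card
      = (missing G S).card := by
    intro S
    rw [← Finset.card_map (Fin.valEmbedding.prodMap Fin.valEmbedding) (s := missing G S)]
    congr 1
    ext ⟨a, b⟩
    simp only [mem_missing, Finset.mem_map, Fin.valEmbedding_apply, natGraph_adj,
      Function.Embedding.coe_prodMap, Prod.exists, Prod.map_apply, Prod.mk.injEq]
    constructor
    · rintro ⟨⟨⟨a', ha, rfl⟩, b', hb, rfl⟩, h1, h2⟩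
      exact ⟨a', b', ⟨⟨ha, hb⟩, h1, fun h => h2 ⟨a'.2, b'.2, h⟩⟩, rfl, rfl⟩
    · rintro ⟨a', b', ⟨⟨ha, hb⟩, h1, h2⟩, rfl, rfl⟩
      exact ⟨⟨⟨a', ha, rfl⟩, b', hb, rfl⟩, h1, fun ⟨_, _, h⟩ => h2 h⟩
  constructor
  · rintro ⟨S, hk, hS⟩
    refine ⟨S.map Fin.valEmbedding, fun x hx => ?_, by simpa using hk, ?_⟩
    · obtain ⟨y, -, rfl⟩ := Finset.mem_map.1 hx
      exact Finset.mem_range.2 y.2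
    · rw [h, ← isDefectiveClique_iff]; exact hS
  · rintro ⟨S, hS, hk, hm⟩
    have h1 : (Finset.univ.filter fun i : Fin n => (i : ℕ) ∈ S).map Fin.valEmbedding = S := by
      ext x
      simp only [Finset.mem_map, Finset.mem_filter, Finset.mem_univ, true_and,
        Fin.valEmbedding_apply]
      constructor
      · rintro ⟨y, hy, rfl⟩; exact hy
      · exact fun hx => ⟨⟨x, Finset.mem_range.1 (hS hx)⟩, hx, rfl⟩
    refine ⟨Finset.univ.filter fun i : Fin n => (i : ℕ) ∈ S, ?_, ?_⟩
    · rwa [← Finset.card_map Fin.valEmbedding, h1]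
    · rw [isDefectiveClique_iff, ← h, h1]; exact hm

/-- The instance may be normalised so that `1 ≤ k ≤ n + 1` and `s ≤ k * k`. -/
theorem hasDefectiveClique_iff_normalised {n : ℕ} (hn : 1 ≤ n) (s k : ℕ)
    (G : SimpleGraph (Fin n)) {k' : ℕ} (hk' : k' = min (max k 1) (n + 1)) :
    HasDefectiveClique s G k ↔
      ∃ S ⊆ Finset.range n, k' ≤ S.card ∧ (missing (natGraph G) S).card ≤ min s (k' * k') := by
  rw [hasDefectiveClique_iff]
  constructor
  · rintro ⟨S, hS, hk, hm⟩
    have hSn := Finset.card_le_card hS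
    rw [Finset.card_range] at hSn
    have h1 : ∃ S' ⊆ Finset.range n, k' = S'.card ∧ (missing (natGraph G) S').card ≤ s := by
      rcases Nat.eq_zero_or_pos k with h0 | h0
      · refine ⟨{0}, by simpa using Nat.lt_of_succ_le hn, by simp; omega, ?_⟩
        have : missing (natGraph G) {0} = ∅ := by
          ext p
          simp only [mem_missing, Finset.mem_singleton, Finset.notMem_empty, iff_false]
          rintro ⟨⟨h1, h2⟩, h3, -⟩
          omega
        simp [this]
      · obtain ⟨S', h1, h2⟩ := Finset.exists_subset_card_eq hk
        refine ⟨S', h1.trans hS, by omega, ?_⟩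
        exact (Finset.card_le_card (missing_mono _ h1)).trans hm
    obtain ⟨S', h2, h3, h4⟩ := h1
    -- Because `S'` has exactly `k'` vertices, its missing pairs lie in a product with `k' * k'`
    -- elements; this is what permits the cap on `s`.
    refine ⟨S', h2, h3.le, le_min h4 ?_⟩
    rw [h3, ← Finset.card_product]
    exact Finset.card_le_card fun p hp => Finset.mem_product.2 (mem_missing.1 hp).1
  · rintro ⟨S, hS, hk, hm⟩
    have hSn := Finset.card_le_card hS
    rw [Finset.card_range] at hSn
    exact ⟨S, hS, by omega, hm.trans (min_le_left _ _)⟩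

/-- The weak closure in terms of `natGraph`. -/
theorem exists_card_common_lt {n : ℕ} (G : SimpleGraph (Fin n)) {γ : ℕ} (h : WeaklyClosed γ G)
    [DecidableRel (natGraph G).Adj] {X : Finset ℕ} (hX : X ⊆ Finset.range n) (hX' : X.Nonempty) :
    ∃ v ∈ X, ∀ u ∈ X, u ≠ v → ¬ (natGraph G).Adj v u →
      (X.filter fun w => (natGraph G).Adj v w ∧ (natGraph G).Adj u w).card < γ := by
  classical
  obtain ⟨x, hx⟩ := hX'
  have hne : (Finset.univ.filter fun i : Fin n => (i : ℕ) ∈ X).Nonempty :=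
    ⟨⟨x, Finset.mem_range.1 (hX hx)⟩, by simpa using hx⟩
  obtain ⟨⟨v, hv⟩, h1⟩ := h _ hne
  refine ⟨v, (Finset.mem_filter.1 hv).2, fun u hu huv hadj => lt_of_le_of_lt ?_ h1⟩
  have hun := Finset.mem_range.1 (hX hu)
  set Y := Finset.univ.filter fun i : Fin n => (i : ℕ) ∈ X with hY
  have hmem : ∀ i : Fin n, i ∈ (Y : Set (Fin n)) ↔ (i : ℕ) ∈ X := by simp [hY]
  have h2 : (((G.induce (Y : Set (Fin n))).commonNeighbors ⟨v, hv⟩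
      ⟨⟨u, hun⟩, (hmem _).2 hu⟩).ncard) ≤ closureNumber (G.induce (Y : Set (Fin n)))
        ⟨v, hv⟩ := by
    unfold closureNumber
    refine Finset.le_sup (f := fun u => ((G.induce (Y : Set (Fin n))).commonNeighbors
      ⟨v, hv⟩ u).ncard) ?_
    simp only [Finset.mem_filter, Finset.mem_univ, true_and]
    refine ⟨fun h => huv (congrArg (fun t : (Y : Set (Fin n)) => ((t : Fin n) : ℕ)) h), ?_⟩
    intro h
    exact hadj ((natGraph_adj G).2 ⟨v.2, hun, h⟩)
  refine le_trans (le_of_eq ?_) h2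
  rw [← Set.ncard_coe_finset, ← Set.ncard_image_of_injective _
    (Fin.val_injective.comp Subtype.val_injective)]
  congr 1
  ext w
  simp only [Finset.coe_filter, Set.mem_ofPred_eq, Set.mem_image, Function.comp_apply,
    SimpleGraph.mem_commonNeighbors, SimpleGraph.comap_adj, Function.Embedding.subtype_apply,
    natGraph_adj]
  constructor
  · rintro ⟨hw, ⟨_, hwn, h3⟩, ⟨_, _, h4⟩⟩
    exact ⟨⟨⟨w, hwn⟩, (hmem _).2 hw⟩, ⟨h3, h4⟩, rfl⟩
  · rintro ⟨⟨w', hw'⟩, ⟨h3, h4⟩, rfl⟩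
    exact ⟨(hmem _).1 hw', ⟨v.2, w'.2, h3⟩, ⟨hun, w'.2, h4⟩⟩

/-! ### Covering by few cliques -/

/-- A set with few missing edges is a union of few cliques. -/
theorem exists_clique_partition {V : Type*} (H : SimpleGraph V) (q : ℕ) (S : Finset V)
    [DecidableEq V] [DecidableRel H.Adj]
    (h : (S.offDiag.filter fun p => ¬ H.Adj p.1 p.2).card < q * (q + 1)) :
    ∃ f : V → ℕ, (∀ v ∈ S, f v < q) ∧ ∀ u ∈ S, ∀ v ∈ S, u ≠ v → f u = f v → H.Adj u v := by
  induction S using Finset.strongInduction with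
  | H S ih =>
  rcases S.eq_empty_or_nonempty with rfl | hne
  · exact ⟨fun _ => 0, by simp, by simp⟩
  -- If every vertex had at least `q` nonneighbours in `S`, then `S` would have at least `q + 1`
  -- vertices, and there would be at least `q * (q + 1)` ordered nonadjacent pairs.
  have hdeg : ∃ v ∈ S, (S.filter fun u => u ≠ v ∧ ¬ H.Adj v u).card < q := by
    by_contra! hd
    have h1 : (S.offDiag.filter fun p => ¬ H.Adj p.1 p.2).card
        = ∑ v ∈ S, (S.filter fun u => u ≠ v ∧ ¬ H.Adj v u).card := by
      rw [Finset.card_eq_sum_card_fiberwise (f := Prod.fst) (t := S)]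
      · refine Finset.sum_congr rfl fun v hv => ?_
        refine Finset.card_bij (fun p _ => p.2) ?_ ?_ ?_
        · rintro ⟨a, b⟩ hp
          simp only [Finset.mem_filter, Finset.mem_offDiag] at hp ⊢
          obtain ⟨⟨⟨h1, h2, h3⟩, h4⟩, rfl⟩ := hp
          exact ⟨h2, Ne.symm h3, h4⟩
        · rintro ⟨a, b⟩ hp ⟨c, d⟩ hp' h
          simp only [Finset.mem_filter] at hp hp' h
          rw [Prod.mk.injEq]; exact ⟨hp.2.trans hp'.2.symm, h⟩
        · intro u hu
          simp only [Finset.mem_filter] at hu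
          exact ⟨(v, u), by simp [hv, hu.1, hu.2.1.symm, hu.2.2], rfl⟩
      · intro p hp
        simp only [Finset.coe_filter, Finset.mem_offDiag, Set.mem_ofPred_eq] at hp
        exact hp.1.1
    have h2 := Finset.card_nsmul_le_sum S _ q hd
    obtain ⟨v, hv⟩ := hne
    have h3 : (S.filter fun u => u ≠ v ∧ ¬ H.Adj v u).card < S.card :=
      Finset.card_lt_card (Finset.filter_ssubset.2 ⟨v, hv, by simp⟩)
    have h4 := hd v hv
    rw [smul_eq_mul] at h2
    have h5 : (q + 1) * q ≤ S.card * q := Nat.mul_le_mul_right q (by omega)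
    rw [mul_comm] at h5
    omega
  obtain ⟨v, hv, hvd⟩ := hdeg
  obtain ⟨f, hf, hf'⟩ := ih (S.erase v) (Finset.erase_ssubset hv) (lt_of_le_of_lt
    (Finset.card_le_card (Finset.filter_subset_filter _
      (Finset.offDiag_mono (Finset.erase_subset v S)))) h)
  -- Fewer than `q` nonneighbours of `v` occupy fewer than `q` colours, so one colour is free for
  -- `v`.
  obtain ⟨c, hc, hc'⟩ : ∃ c ∈ Finset.range q,
      c ∉ (S.filter fun u => u ≠ v ∧ ¬ H.Adj v u).image f := by
    by_contra! hall
    have := Finset.card_le_card (show Finset.range q ⊆ _ from fun c hc => hall c hc)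
    have h2 := Finset.card_image_le (s := S.filter fun u => u ≠ v ∧ ¬ H.Adj v u) (f := f)
    rw [Finset.card_range] at this
    omega
  have hadj : ∀ u ∈ S, u ≠ v → f u = c → H.Adj v u := by
    intro u hu huv hfu
    by_contra hn
    exact hc' (Finset.mem_image.2 ⟨u, Finset.mem_filter.2 ⟨hu, huv, hn⟩, hfu⟩)
  refine ⟨Function.update f v c, fun u hu => ?_, fun u hu w hw huw hfe => ?_⟩
  · rcases eq_or_ne u v with rfl | huv
    · simpa using hc
    · simpa [huv] using hf u (Finset.mem_erase.2 ⟨huv, hu⟩)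
  · rcases eq_or_ne u v with rfl | huv
    · rw [Function.update_self, Function.update_of_ne huw.symm] at hfe
      exact hadj w hw huw.symm hfe.symm
    · rcases eq_or_ne w v with rfl | hwv
      · rw [Function.update_self, Function.update_of_ne huv] at hfe
        exact (hadj u hu huv hfe).symm
      · rw [Function.update_of_ne huv, Function.update_of_ne hwv] at hfe
        exact hf' u (Finset.mem_erase.2 ⟨huv, hu⟩) w (Finset.mem_erase.2 ⟨hwv, hw⟩) huw hfe

/-! ### Maximal cliques and their seeds -/

/-- `K` is a maximal clique of the graph induced on `{0, …, n - 1}`. -/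
def IsMaxClique (H : SimpleGraph ℕ) (n : ℕ) (K : Finset ℕ) : Prop :=
  K ⊆ Finset.range n ∧ H.IsClique (K : Set ℕ) ∧ ∀ v < n, v ∉ K → ∃ w ∈ K, ¬ H.Adj v w

theorem exists_isMaxClique_superset {H : SimpleGraph ℕ} {n : ℕ} {C : Finset ℕ}
    (hC : C ⊆ Finset.range n) (hC' : H.IsClique (C : Set ℕ)) :
    ∃ K, C ⊆ K ∧ IsMaxClique H n K := by
  classical
  obtain ⟨K, hK, hmax⟩ := Finset.exists_max_image
    ((Finset.range n).powerset.filter fun K => C ⊆ K ∧ H.IsClique (K : Set ℕ)) Finset.card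
    ⟨C, by simp only [Finset.mem_filter, Finset.mem_powerset]; exact ⟨hC, subset_rfl, hC'⟩⟩
  simp only [Finset.mem_filter, Finset.mem_powerset] at hK hmax
  refine ⟨K, hK.2.1, hK.1, hK.2.2, fun v hv hvK => ?_⟩
  by_contra! hadj
  have := hmax (insert v K) ⟨Finset.insert_subset (Finset.mem_range.2 hv) hK.1,
    hK.2.1.trans (Finset.subset_insert _ _), ?_⟩
  · rw [Finset.card_insert_of_notMem hvK] at this; omega
  · rw [Finset.coe_insert]
    exact hK.2.2.insert fun w hw _ => hadj w hw

/-- Later common neighbours of `c` and `u` with respect to `rank`. -/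
noncomputable def laterCommon (H : SimpleGraph ℕ) (n : ℕ) (rank : ℕ → ℕ) (c u : ℕ) : Finset ℕ :=
  open Classical in (Finset.range n).filter fun w => rank c < rank w ∧ H.Adj c w ∧ H.Adj u w

theorem mem_laterCommon {H : SimpleGraph ℕ} {n : ℕ} {rank : ℕ → ℕ} {c u w : ℕ} :
    w ∈ laterCommon H n rank c u ↔ w < n ∧ rank c < rank w ∧ H.Adj c w ∧ H.Adj u w := by
  simp [laterCommon]

/-- A ranking of the vertices such that each vertex has fewer than `Γ` later common neighbours
with every later vertex that is not adjacent to it. -/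
structure IsClosedRanking (H : SimpleGraph ℕ) (n Γ : ℕ) (rank : ℕ → ℕ) : Prop where
  pos : ∀ v < n, 0 < rank v
  le : ∀ v < n, rank v ≤ n
  inj : ∀ v < n, ∀ u < n, rank v = rank u → v = u
  closed : ∀ v < n, ∀ u < n, rank v < rank u → ¬ H.Adj v u →
    (laterCommon H n rank v u).card < Γ

/-- A maximal clique is determined by a vertex `c` and a set of later common neighbours of `c`
and some vertex `u`. -/
theorem IsMaxClique.exists_seed {H : SimpleGraph ℕ} {n Γ : ℕ} {rank : ℕ → ℕ} {K : Finset ℕ}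
    (hK : IsMaxClique H n K) (hne : K.Nonempty) (hr : IsClosedRanking H n Γ rank) :
    ∃ c ∈ K, ∃ u < n, (∀ w ∈ K, rank c < rank w → w ∈ laterCommon H n rank c u) ∧
      ((∀ w ∈ K, rank w ≤ rank c) ∨ (laterCommon H n rank c u).card < Γ) ∧
      ∀ v < n, v ∉ K → rank v < rank c → ∃ w ∈ K, rank v < rank w ∧ ¬ H.Adj v w := by
  classical
  obtain ⟨hKn, hcl, hmax⟩ := hK
  have hlt : ∀ w ∈ K, w < n := fun w hw => Finset.mem_range.1 (hKn hw)
  -- A good `c` has this property: a vertex outside `K` that precedes `c` is blocked by a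
  -- nonneighbour in `K` not ranked before it, and any other outside vertex by a nonneighbour in `K`
  -- not ranked before `c`. The first member of `K` is good by maximality; the seed is the last good
  -- member.
  let Good : ℕ → Prop := fun c => ∀ v < n, v ∉ K →
    ∃ w ∈ K, min (rank c) (rank v) ≤ rank w ∧ ¬ H.Adj v w
  obtain ⟨m, hm, hmin⟩ := Finset.exists_min_image K rank hne
  have hgm : Good m := fun v hv hvK => by
    obtain ⟨w, hw, hvw⟩ := hmax v hv hvK
    exact ⟨w, hw, (min_le_left _ _).trans (hmin w hw), hvw⟩
  obtain ⟨c, hc, hcmax⟩ := Finset.exists_max_image (K.filter Good) rank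
    ⟨m, Finset.mem_filter.2 ⟨hm, hgm⟩⟩
  obtain ⟨hcK, hgc⟩ := Finset.mem_filter.1 hc
  have hearly : ∀ v < n, v ∉ K → rank v < rank c → ∃ w ∈ K, rank v < rank w ∧ ¬ H.Adj v w := by
    intro v hv hvK hvc
    obtain ⟨w, hw, h1, h2⟩ := hgc v hv hvK
    rw [min_eq_right hvc.le] at h1
    refine ⟨w, hw, lt_of_le_of_ne h1 fun h => hvK ?_, h2⟩
    rwa [hr.inj v hv w (hlt w hw) h]
  -- If `c` is the last member of `K`, there is nothing later to encode and `u = c` is a dummy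
  -- value.
  by_cases hlast : ∀ w ∈ K, rank w ≤ rank c
  · exact ⟨c, hcK, c, hlt c hcK, fun w hw h => absurd (hlast w hw) (not_le.2 h), .inl hlast,
      hearly⟩
  push Not at hlast
  obtain ⟨c', hc', hcmin⟩ := Finset.exists_min_image (K.filter fun w => rank c < rank w) rank
    (by obtain ⟨w, hw, h⟩ := hlast; exact ⟨w, Finset.mem_filter.2 ⟨hw, h⟩⟩)
  obtain ⟨hcK', hcc'⟩ := Finset.mem_filter.1 hc'
  have hbad : ¬ Good c' := fun hg =>
    absurd (hcmax c' (Finset.mem_filter.2 ⟨hcK', hg⟩)) (not_le.2 hcc')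
  -- The next member `c'` is not good; the witness `u` is outside `K` and adjacent to all members of
  -- rank at least `min (rank c') (rank u)`. Since `c` is good, `u` still has a nonneighbour `w` in
  -- `K` of rank at least `min (rank c) (rank u)`.
  simp only [Good, not_forall, not_exists, not_and, not_not] at hbad
  obtain ⟨u, hu, huK, hadj⟩ := hbad
  obtain ⟨w, hw, h1, h2⟩ := hgc u hu huK
  -- If `u` did not come after `c`, the two minima would both be `rank u`, and `w` would be adjacent
  -- to `u`.
  have hcu : rank c < rank u := by
    by_contra h
    have h3 : min (rank c') (rank u) = rank u := min_eq_right (by omega)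
    refine h2 (hadj w hw ?_)
    omega
  -- Any later choice of `w` would have rank at least `rank c'` and so be adjacent to `u`. Hence `c`
  -- and `u` are nonadjacent, `u` comes after `c`, and all members of `K` after `c` are adjacent to
  -- both.
  have hwc : w = c := by
    by_contra hne
    refine h2 (hadj w hw ?_)
    have h3 : rank c < rank w := by
      refine lt_of_le_of_ne (by omega) fun h => hne (hr.inj w (hlt w hw) c (hlt c hcK) h.symm)
    have := hcmin w (Finset.mem_filter.2 ⟨hw, h3⟩)
    omega
  subst hwc
  refine ⟨w, hcK, u, hu, fun x hx hwx => ?_, .inr (hr.closed w (hlt w hcK) u hu hcu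
    fun h => h2 h.symm), hearly⟩
  have h4 := hcmin x (Finset.mem_filter.2 ⟨hx, hwx⟩)
  refine mem_laterCommon.2 ⟨hlt x hx, hwx, hcl hcK hx ?_, hadj x hx (by omega)⟩
  rintro rfl
  exact lt_irrefl _ hwx

/-- The bits of `A` on the elements of `C` that are at least `i`, read upwards. -/
noncomputable def bitCode (C A : Finset ℕ) (n : ℕ) (i : ℕ) : ℕ :=
  if n ≤ i then 0
  else if i ∈ C then (if i ∈ A then 1 else 0) + 2 * bitCode C A n (i + 1)
  else bitCode C A n (i + 1)
termination_by n - i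

/-- Only elements of `C` use up a bit. The bound thus depends on the number of later common
neighbours and not on `n`. -/
theorem bitCode_lt (C A : Finset ℕ) (n i : ℕ) :
    bitCode C A n i < 2 ^ (C.filter fun w => i ≤ w).card := by
  induction h : n - i generalizing i with
  | zero => rw [bitCode, if_pos (by omega)]; positivity
  | succ m ih =>
    rw [bitCode, if_neg (by omega)]
    have h1 := ih (i + 1) (by omega)
    split_ifs with h2 h3 <;> first
      | have h4 : (C.filter fun w => i ≤ w).card = (C.filter fun w => i + 1 ≤ w).card + 1 := by
          rw [← Finset.card_insert_of_notMem (a := i) (by simp)]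
          congr 1; ext w; simp only [Finset.mem_filter, Finset.mem_insert]
          constructor
          · rintro ⟨h5, h6⟩
            rcases eq_or_ne w i with rfl | h7
            · exact .inl rfl
            · exact .inr ⟨h5, by omega⟩
          · rintro (rfl | ⟨h5, h6⟩)
            · exact ⟨h2, le_rfl⟩
            · exact ⟨h5, by omega⟩
        rw [h4, pow_succ]; omega
      | refine h1.trans_le (Nat.pow_le_pow_right (by omega) (Finset.card_le_card fun w hw => ?_))
        simp only [Finset.mem_filter] at hw ⊢
        exact ⟨hw.1, by omega⟩

theorem bitCode_empty (C : Finset ℕ) (n i : ℕ) : bitCode C ∅ n i = 0 := by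
  induction h : n - i generalizing i with
  | zero => rw [bitCode, if_pos (by omega)]
  | succ m ih => rw [bitCode, if_neg (by omega), ih (i + 1) (by omega)]; simp

/-! ## The elimination ordering -/

/-- `v` is unranked and has fewer than `g` unranked common neighbours with each unranked vertex
that is not adjacent to it. -/
def Removable (H : SimpleGraph ℕ) (n : ℕ) (r : ℕ → ℕ) (g v : ℕ) : Prop :=
  open Classical in r v = 0 ∧ ∀ u < n, r u = 0 → u ≠ v → ¬ H.Adj v u →
    ((Finset.range n).filter fun w => r w = 0 ∧ H.Adj v w ∧ H.Adj u w).card < g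

open Classical in
/-- The invariant of the elimination: `r` is the ranking so far, of `c` vertices. -/
structure PeelInv (H : SimpleGraph ℕ) (n g : ℕ) (r : ℕ → ℕ) (c Γ : ℕ) : Prop where
  le : ∀ v < n, r v ≤ c
  inj : ∀ v < n, ∀ u < n, r v ≠ 0 → r v = r u → v = u
  closed : ∀ v < n, ∀ u < n, r v ≠ 0 → (r u = 0 ∨ r v < r u) → ¬ H.Adj v u →
    ((Finset.range n).filter fun w => (r w = 0 ∨ r v < r w) ∧ H.Adj v w ∧ H.Adj u w).card < Γ
  count : c + ((Finset.range n).filter fun w => r w = 0).card = n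
  bound : Γ ≤ g

theorem PeelInv.mono {H : SimpleGraph ℕ} {n g g' : ℕ} {r : ℕ → ℕ} {c Γ : ℕ}
    (h : PeelInv H n g r c Γ) (hg : g ≤ g') : PeelInv H n g' r c Γ :=
  { h with bound := h.bound.trans hg }

-- The new label `c + 1` exceeds all earlier ones. For an earlier vertex the set of unranked or
-- later vertices therefore stays the same, and for `v` it becomes the set of unranked vertices
-- other than `v`, where removability gives the bound `g`. Raising the old bound `Γ` to `g` is
-- harmless since `Γ ≤ g`.
open Classical in
theorem PeelInv.remove {H : SimpleGraph ℕ} {n g : ℕ} {r r' : ℕ → ℕ} {c Γ v : ℕ}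
    (h : PeelInv H n g r c Γ) (hv : v < n) (hr : Removable H n r g v)
    (hr' : ∀ j, r' j = if j = v then c + 1 else r j) : PeelInv H n g r' (c + 1) g := by
  obtain ⟨h1, h2, h3, h4, h5⟩ := h
  obtain ⟨hr1, hr2⟩ := hr
  have later : ∀ x < n, r x ≠ 0 → ∀ w, (r' w = 0 ∨ r' x < r' w) ↔ (r w = 0 ∨ r x < r w) := by
    intro x hx hx0 w
    have hxv : x ≠ v := fun h => hx0 (h ▸ hr1)
    rw [hr' x, if_neg hxv, hr' w]
    have := h1 x hx
    split_ifs with hw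
    · subst hw; omega
    · rfl
  have later' : ∀ w < n, (r' w = 0 ∨ c + 1 < r' w) ↔ (r w = 0 ∧ w ≠ v) := by
    intro w hw
    rw [hr' w]
    have := h1 w hw
    split_ifs with hwv
    · simp [hwv]
    · simp only [hwv, ne_eq, not_false_eq_true, and_true]; omega
  refine ⟨fun w hw => ?_, fun x hx u hu hx0 hxu => ?_, fun x hx u hu hx0 hxu hadj => ?_, ?_,
    le_rfl⟩
  · rw [hr']; have := h1 w hw; split_ifs <;> omega
  · rw [hr' x, hr' u] at hxu
    rw [hr' x] at hx0
    have := h1 x hx; have := h1 u hu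
    split_ifs at hxu hx0 with h6 h7 h7
    · rw [h6, h7]
    · omega
    · omega
    · exact h2 x hx u hu hx0 hxu
  · by_cases hxv : x = v
    · subst hxv
      have hx' : r' x = c + 1 := by rw [hr', if_pos rfl]
      rw [hx'] at hxu ⊢
      rw [later' u hu] at hxu
      refine lt_of_le_of_lt (Finset.card_le_card fun w hw => ?_) (hr2 u hu hxu.1 hxu.2 hadj)
      simp only [Finset.mem_filter, Finset.mem_range] at hw ⊢
      rw [later' w hw.1] at hw
      exact ⟨hw.1, hw.2.1.1, hw.2.2⟩
    · rw [hr' x, if_neg hxv] at hx0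
      simp only [later x hx hx0] at hxu ⊢
      exact (h3 x hx u hu hx0 hxu hadj).trans_le h5
  · have h6 : (Finset.range n).filter (fun w => r w = 0)
        = insert v ((Finset.range n).filter fun w => r' w = 0) := by
      ext w
      simp only [Finset.mem_filter, Finset.mem_range, Finset.mem_insert, hr' w]
      constructor
      · rintro ⟨hw, hw0⟩
        by_cases hwv : w = v
        · exact .inl hwv
        · exact .inr ⟨hw, by rwa [if_neg hwv]⟩
      · rintro (rfl | ⟨hw, hw0⟩)
        · exact ⟨hv, hr1⟩
        · split_ifs at hw0 with hwv
          exact ⟨hw, hw0⟩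
    rw [h6, Finset.card_insert_of_notMem (by simp [hr' v])] at h4
    omega

/-- Weak closedness is applied to the set of unranked vertices, which is nonempty because fewer than
`n` vertices are ranked. -/
theorem PeelInv.exists_removable {H : SimpleGraph ℕ} {n g : ℕ} {r : ℕ → ℕ} {c Γ γ : ℕ}
    (h : PeelInv H n g r c Γ) (hc : c < n)
    (hW : ∀ X ⊆ Finset.range n, X.Nonempty → ∃ v ∈ X, ∀ u ∈ X, u ≠ v → ¬ H.Adj v u →
      open Classical in (X.filter fun w => H.Adj v w ∧ H.Adj u w).card < γ) :
    ∃ v < n, Removable H n r γ v := by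
  classical
  obtain ⟨v, hv, h1⟩ := hW ((Finset.range n).filter fun w => r w = 0)
    (Finset.filter_subset _ _) (Finset.card_pos.1 (by have := h.count; omega))
  simp only [Finset.mem_filter, Finset.mem_range, Finset.filter_filter] at hv h1
  exact ⟨v, hv.1, hv.2, fun u hu hu0 huv hadj => h1 u ⟨hu, hu0⟩ huv hadj⟩

/-- Once `n` labels are used no vertex is unranked, and the alternatives for unranked vertices in
the invariant become void. -/
theorem PeelInv.isClosedRanking {H : SimpleGraph ℕ} {n g : ℕ} {r : ℕ → ℕ} {Γ : ℕ}
    (h : PeelInv H n g r n Γ) : IsClosedRanking H n Γ r := by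
  classical
  have h0 : ∀ v < n, r v ≠ 0 := by
    intro v hv hr
    have h1 := h.count
    have h2 : 0 < ((Finset.range n).filter fun w => r w = 0).card :=
      Finset.card_pos.2 ⟨v, by simp [hv, hr]⟩
    omega
  refine ⟨fun v hv => Nat.pos_of_ne_zero (h0 v hv), h.le,
    fun v hv u hu => h.inj v hv u hu (h0 v hv), fun v hv u hu hvu hadj => ?_⟩
  refine lt_of_le_of_lt (Finset.card_le_card fun w hw => ?_)
    (h.closed v hv u hu (h0 v hv) (.inr hvu) hadj)
  obtain ⟨hw1, hw2, hw3⟩ := mem_laterCommon.1 hw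
  simp only [Finset.mem_filter, Finset.mem_range]
  exact ⟨hw1, .inr hw2, hw3⟩

namespace Program

open Exp Cmd

/-- Vertex `x` is not ranked. -/
def alive (x : ℕ) : Exp := eq (arr 0 (var x)) (lit 0)

def peelCond : Exp :=
  and (alive 21) <| all 22 1 <| or (not (alive 22)) <| or (eq (var 22) (var 21)) <|
    or (adj 21 22) <| lt (count 23 1 (and (alive 23) (and (adj 21 23) (adj 22 23)))) (var 20)

def peelStep : Cmd :=
  .ite peelCond
    (seq (assign 10 (add (var 10) (lit 1))) (seq (store 0 (var 21) (var 10)) (assign 6 (var 20))))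
    skip

/-- Compute the ranks of the vertices in array `0`; the bound is left in variable `6`. -/
def peel : Cmd := loop 20 9 <| loop 24 1 <| loop 21 1 peelStep

variable {n : ℕ} (s : ℕ) (G : SimpleGraph (Fin n)) (k : ℕ)

theorem tr_peelCond {ρ : Env} (h : ρ.var 1 = n) :
    peelCond.Tr (encode s G k) ρ
      ↔ Removable (natGraph G) n (ρ.arr 0) (ρ.var 20) (ρ.var 21) := by
  classical
  simp only [peelCond, alive, tr_and, tr_eq, eval_arr, eval_var, eval_lit, tr_all, tr_or, tr_not,
    tr_lt, eval_count, Env.set_var, Env.set_arr]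
  simp only [tr_adj s G k (n := n), Env.set_var, h, Nat.reduceEqDiff, if_true, if_false,
    ne_eq, not_false_eq_true, Removable]
  refine and_congr_right fun _ => forall₂_congr fun u _ => ?_
  tauto

/-- For a bound above `γ` no removal can occur: by `hdone` all `n` vertices are already ranked, and
one more would violate the count. So the last bound used, kept in variable `6`, never exceeds `γ`.
The final alternative records an idle step, for the progress argument of `run_peelPass`. -/
theorem run_peelStep {ρ : Env} (h : ρ.var 1 = n) (γ : ℕ) (hv : ρ.var 21 < n)
    (hI : PeelInv (natGraph G) n (ρ.var 20) (ρ.arr 0) (ρ.var 10) (ρ.var 6))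
    (hγ : ρ.var 6 ≤ γ) (hdone : γ < ρ.var 20 → ρ.var 10 = n) :
    let τ := peelStep.run (encode s G k) ρ
    PeelInv (natGraph G) n (ρ.var 20) (τ.arr 0) (τ.var 10) (τ.var 6) ∧ τ.var 6 ≤ γ ∧
      (γ < ρ.var 20 → τ.var 10 = n) ∧
      (τ.var 10 = ρ.var 10 + 1 ∨ τ.var 10 = ρ.var 10 ∧ τ.arr 0 = ρ.arr 0 ∧
        ¬ Removable (natGraph G) n (ρ.arr 0) (ρ.var 20) (ρ.var 21)) := by
  classical
  intro τ
  by_cases hr : Removable (natGraph G) n (ρ.arr 0) (ρ.var 20) (ρ.var 21)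
  · have hτ : τ = ((ρ.set 10 (ρ.var 10 + 1)).setArr 0 (ρ.var 21) (ρ.var 10 + 1)).set 6
        (ρ.var 20) := by
      simp [τ, peelStep, tr_peelCond s G k h, hr]
    have h1 := hI.remove (r' := τ.arr 0) hv hr (by simp [hτ])
    have h2 : τ.var 10 = ρ.var 10 + 1 := by simp [hτ]
    have h3 : τ.var 6 = ρ.var 20 := by simp [hτ]
    have h4 : ¬ γ < ρ.var 20 := by
      intro h4
      have := h1.count
      have := hdone h4
      omega
    rw [h2, h3]
    exact ⟨h1, not_lt.1 h4, fun h => absurd h h4, .inl rfl⟩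
  · have hτ : τ = ρ := by simp [τ, peelStep, tr_peelCond s G k h, hr]
    rw [hτ]
    exact ⟨hI, hγ, hdone, .inr ⟨rfl, rfl, hr⟩⟩

/-- One pass over the vertices. -/
theorem run_peelPass {ρ : Env} {t γ : ℕ} (h : ρ.var 1 = n) (ht : t < n)
    (hI : PeelInv (natGraph G) n (ρ.var 20) (ρ.arr 0) (ρ.var 10) (ρ.var 6))
    (hγ : ρ.var 6 ≤ γ) (hdone : γ < ρ.var 20 → ρ.var 10 = n)
    (hprog : ρ.var 20 = γ → t ≤ ρ.var 10)
    (hW : ∀ X ⊆ Finset.range n, X.Nonempty → ∃ v ∈ X, ∀ u ∈ X, u ≠ v →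
      ¬ (natGraph G).Adj v u → open Classical in
        (X.filter fun w => (natGraph G).Adj v w ∧ (natGraph G).Adj u w).card < γ) :
    let τ := (loop 21 1 peelStep).run (encode s G k) ρ
    PeelInv (natGraph G) n (ρ.var 20) (τ.arr 0) (τ.var 10) (τ.var 6) ∧ τ.var 6 ≤ γ ∧
      (γ < ρ.var 20 → τ.var 10 = n) ∧ (ρ.var 20 = γ → t + 1 ≤ τ.var 10) := by
  classical
  obtain ⟨h1, -, -, h4, h5, h6, h7⟩ := loop_induction (inp := encode s G k) (ρ := ρ) (x := 21)
    (b := 1) (c := peelStep)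
    (fun i τ => PeelInv (natGraph G) n (ρ.var 20) (τ.arr 0) (τ.var 10) (τ.var 6) ∧
      τ.var 1 = n ∧ τ.var 20 = ρ.var 20 ∧ τ.var 6 ≤ γ ∧ (γ < ρ.var 20 → τ.var 10 = n) ∧
      (ρ.var 10 ≤ τ.var 10) ∧ (ρ.var 10 + 1 ≤ τ.var 10 ∨ τ.arr 0 = ρ.arr 0 ∧
        ∀ v < i, ¬ Removable (natGraph G) n (ρ.arr 0) (ρ.var 20) v)) h
    ⟨hI, h, rfl, hγ, hdone, le_rfl, .inr ⟨rfl, by simp⟩⟩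
    (by
      rintro i τ hi ⟨h1, h2, h3, h4, h5, h6, h7⟩
      have hk1 := run_var (inp := encode s G k) (x := 1) peelStep (by decide) (τ.set 21 i)
      have hk20 := run_var (inp := encode s G k) (x := 20) peelStep (by decide) (τ.set 21 i)
      simp only [Env.set_var, Nat.reduceEqDiff, if_false] at hk1 hk20
      obtain ⟨g1, g2, g3, g4⟩ := run_peelStep s G k (ρ := τ.set 21 i) (by simpa using h2) γ
        (by simpa using hi) (by simpa [h3] using h1) (by simpa using h4) (by simpa [h3] using h5)
      simp only [Env.set_var, Env.set_arr, Nat.reduceEqDiff, if_true, if_false, h3] at g1 g3 g4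
      refine ⟨g1, hk1.trans h2, hk20.trans h3, g2, g3, by omega, ?_⟩
      rcases g4 with g4 | ⟨g4, g5, g6⟩
      · exact .inl (by omega)
      · rcases h7 with h7 | ⟨h7, h8⟩
        · exact .inl (by omega)
        · refine .inr ⟨g5.trans h7, fun v hv => ?_⟩
          rcases Nat.lt_succ_iff_lt_or_eq.1 hv with hv | rfl
          · exact h8 v hv
          · rwa [h7] at g6)
  refine ⟨h1, h4, h5, fun hg => ?_⟩
  have h8 := hprog hg
  -- If the pass ranked no vertex, all of them were tested against the same ranking, so none is
  -- removable for `γ`, and all `n` vertices must have been ranked before.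
  rcases h7 with h7 | ⟨-, h7⟩
  · omega
  · have : ¬ ρ.var 10 < n := fun hlt => by
      obtain ⟨v, hv, hr⟩ := hI.exists_removable hlt hW
      exact h7 v hv (hg ▸ hr)
    omega

/-- With the bound `γ`, each of the `n` passes ranks a vertex as long as one is left, so the ranking
is complete when the bound grows past `γ`. Vertices ranked earlier, under smaller bounds, do no
harm: weak closedness concerns every remaining set. The `n + 1` values of the bound reach `γ`
because `γ ≤ n`. -/
theorem run_peel {ρ : Env} {γ : ℕ} (h : ρ.var 1 = n) (h9 : ρ.var 9 = n + 1)
    (h0 : ρ.arr 0 = fun _ => 0) (h10 : ρ.var 10 = 0) (h6 : ρ.var 6 = 0) (hγ : γ ≤ n)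
    (hW : ∀ X ⊆ Finset.range n, X.Nonempty → ∃ v ∈ X, ∀ u ∈ X, u ≠ v →
      ¬ (natGraph G).Adj v u → open Classical in
        (X.filter fun w => (natGraph G).Adj v w ∧ (natGraph G).Adj u w).card < γ) :
    let τ := peel.run (encode s G k) ρ
    IsClosedRanking (natGraph G) n (τ.var 6) (τ.arr 0) ∧ τ.var 6 ≤ γ := by
  classical
  obtain ⟨h1, -, h3, h4⟩ := loop_induction (inp := encode s G k) (ρ := ρ) (x := 20)
    (b := 9) (c := loop 24 1 (loop 21 1 peelStep))
    (fun g τ => PeelInv (natGraph G) n g (τ.arr 0) (τ.var 10) (τ.var 6) ∧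
      τ.var 1 = n ∧ τ.var 6 ≤ γ ∧ (γ < g → τ.var 10 = n)) h9
    ⟨by rw [h0, h10, h6]; exact ⟨by simp, by simp, by simp, by simp, le_rfl⟩, h, by omega,
      by omega⟩
    (by
      rintro g τ - ⟨h1, h2, h3, h4⟩
      obtain ⟨g1, g2, -, g4, g5, g6⟩ := loop_induction (inp := encode s G k) (ρ := τ.set 20 g)
        (x := 24) (b := 1) (c := loop 21 1 peelStep)
        (fun t υ => PeelInv (natGraph G) n g (υ.arr 0) (υ.var 10) (υ.var 6) ∧ υ.var 1 = n ∧
          υ.var 20 = g ∧ υ.var 6 ≤ γ ∧ (γ < g → υ.var 10 = n) ∧ (g = γ → t ≤ υ.var 10))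
        (by simpa using h2)
        ⟨by simpa using h1, by simpa using h2, by simp, by simpa using h3, by simpa using h4,
          by simp⟩
        (by
          rintro t υ ht ⟨e1, e2, e3, e4, e5, e6⟩
          have hk1 := run_var (inp := encode s G k) (x := 1) (loop 21 1 peelStep) (by decide)
            (υ.set 24 t)
          have hk20 := run_var (inp := encode s G k) (x := 20) (loop 21 1 peelStep) (by decide)
            (υ.set 24 t)
          simp only [Env.set_var, Nat.reduceEqDiff, if_false] at hk1 hk20
          obtain ⟨f1, f2, f3, f4⟩ := run_peelPass s G k (ρ := υ.set 24 t) (t := t)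
            (by simpa using e2) ht (by simpa [e3] using e1) (by simpa using e4)
            (by simpa [e3] using e5) (by simpa [e3] using e6) hW
          simp only [Env.set_var, Nat.reduceEqDiff, if_false, e3] at f1 f3 f4
          exact ⟨f1, hk1.trans e2, hk20.trans e3, f2, f3, f4⟩)
      refine ⟨g1.mono (Nat.le_succ g), g2, g4, fun hg => ?_⟩
      -- At `g = γ` the `n` passes have ranked at least `n` vertices; at larger `g` this was already
      -- so.
      rcases eq_or_ne g γ with rfl | hne
      · have := g6 rfl
        have := g1.count
        simp only [run_loop] at *
        omega
      · exact g5 (by omega))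
  have h5 := h4 (by omega)
  exact ⟨(h5 ▸ h1).isClosedRanking, h3⟩

end Program

namespace Program

open Exp Cmd

/-! ## The search -/

/-- Read a seed from the number in variable `14`. -/
def readSeed : Cmd := seq (split 8 14 1 25) (seq (split 8 14 1 26) (split 8 14 7 15))

def startStep : Cmd :=
  .ite (eq (var 27) (var 25)) (store 4 (var 27) (lit 1)) <|
    .ite (and (lt (arr 0 (var 25)) (arr 0 (var 27))) (and (adj 25 27) (adj 26 27)))
      (seq (split 8 15 11 28) (store 4 (var 27) (var 28)))
      (store 4 (var 27) (lit 0))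

/-- Array `4` gets the seed vertex and the later common neighbours selected by variable `15`. -/
def startClique : Cmd := loop 27 1 startStep

def extendStep : Cmd :=
  .ite (and (eq (add (arr 0 (var 27)) (add (var 29) (lit 1))) (arr 0 (var 25)))
      (all 30 1 (or (not (arr 4 (var 30))) (adj 27 30))))
    (store 4 (var 27) (lit 1)) skip

/-- Extend array `4` greedily by vertices of decreasing rank. -/
def extendClique : Cmd := loop 29 1 (loop 27 1 extendStep)

def markStep : Cmd :=
  .ite (and (eq (arr 1 (var 31)) (var 32)) <| and (arr 4 (var 27)) <|
      eq (count 30 1 (and (arr 4 (var 30)) (le (var 30) (var 27)))) (arr 2 (var 31)))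
    (store 3 (var 27) (lit 1)) skip

/-- Mark the chosen members of array `4` in array `3`. -/
def mark : Cmd := loop 31 4 (loop 27 1 markStep)

def cliqueStep : Cmd := seq readSeed (seq startClique (seq extendClique mark))

def readChoices : Cmd :=
  loop 31 4 <| seq (split 8 14 5 28) <| seq (store 1 (var 31) (var 28)) <|
    seq (split 8 14 2 28) (store 2 (var 31) (var 28))

def clearMarks : Cmd := loop 27 1 (store 3 (var 27) (lit 0))

def buildStep : Cmd :=
  store 5 (var 27) (.ite (or (arr 3 (var 27)) (and (arr 4 (var 27))
    (all 30 1 (or (not (arr 3 (var 30))) (adj 30 27))))) (lit 1) (lit 0))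

/-- Array `5` gets the marked vertices and their common neighbours in array `4`. -/
def build : Cmd := loop 27 1 buildStep

/-- Accept if array `5` is a solution. -/
def check : Cmd :=
  .ite (and (le (var 2) (count 27 1 (arr 5 (var 27))))
      (le (sum 27 1 (count 30 1 (and (and (arr 5 (var 27)) (arr 5 (var 30)))
        (and (lt (var 30) (var 27)) (not (adj 27 30)))))) (var 3)))
    (assign 0 (lit 1)) skip

def candidate : Cmd :=
  seq (assign 14 (var 13)) <| seq readChoices <| seq clearMarks <| seq (loop 32 5 cliqueStep) build

def search : Cmd := loop 13 8 (seq candidate check)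

/-- The parameters of the search. -/
structure Params (n k s m q P T : ℕ) (r : ℕ → ℕ) (ρ : Env) : Prop where
  hn : ρ.var 1 = n
  hk : ρ.var 2 = k
  hs : ρ.var 3 = s
  hm : ρ.var 4 = m
  hq : ρ.var 5 = q
  hP : ρ.var 7 = P
  hT : ρ.var 8 = T
  h2 : ρ.var 11 = 2
  hr : ρ.arr 0 = r

/-- The command does not change the parameters. -/
def keepsParams (c : Cmd) : Bool :=
  c.keepsVar 1 && c.keepsVar 2 && c.keepsVar 3 && c.keepsVar 4 && c.keepsVar 5 && c.keepsVar 7 &&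
    c.keepsVar 8 && c.keepsVar 11 && c.keepsArr 0

/-! ### Correctness of the single steps of the search -/

section

variable {n k s m q P T : ℕ} {r : ℕ → ℕ} {ρ : Env} {inp : List ℕ}

theorem Params.run (h : Params n k s m q P T r ρ) (c : Cmd) (hc : keepsParams c) :
    Params n k s m q P T r (c.run inp ρ) := by
  simp only [keepsParams, Bool.and_eq_true] at hc
  obtain ⟨⟨⟨⟨⟨⟨⟨⟨h1, h2⟩, h3⟩, h4⟩, h5⟩, h6⟩, h7⟩, h8⟩, h9⟩ := hc
  exact ⟨(run_var c h1 ρ).trans h.hn, (run_var c h2 ρ).trans h.hk, (run_var c h3 ρ).trans h.hs,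
    (run_var c h4 ρ).trans h.hm, (run_var c h5 ρ).trans h.hq, (run_var c h6 ρ).trans h.hP,
    (run_var c h7 ρ).trans h.hT, (run_var c h8 ρ).trans h.h2, (run_arr c h9 ρ).trans h.hr⟩

theorem Params.set (h : Params n k s m q P T r ρ) (x v : ℕ) (hx : 11 < x) :
    Params n k s m q P T r (ρ.set x v) := by
  have : ∀ y ≤ 11, (ρ.set x v).var y = ρ.var y := fun y hy => by
    rw [Env.set_var, if_neg (by omega)]
  exact ⟨(this 1 (by omega)).trans h.hn, (this 2 (by omega)).trans h.hk,
    (this 3 (by omega)).trans h.hs, (this 4 (by omega)).trans h.hm,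
    (this 5 (by omega)).trans h.hq, (this 7 (by omega)).trans h.hP,
    (this 8 (by omega)).trans h.hT, (this 11 (by omega)).trans h.h2, h.hr⟩

/-- The number is read from its lowest digit: alternately a clique index in base `q` and a position
in base `k`. Quotients only decrease, so `T` remains a valid limit for every division. -/
theorem run_readChoices (h : Params n k s m q P T r ρ) {a b Y : ℕ → ℕ}
    (ha : ∀ e < m, a e < q) (hb : ∀ e < m, b e < k)
    (hY : ∀ e < m, Y e = a e + q * (b e + k * Y (e + 1))) (hT : Y 0 ≤ T) (h0 : ρ.var 14 = Y 0) :
    let τ := readChoices.run inp ρ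
    τ.var 14 = Y m ∧ Y m ≤ T ∧ (∀ e < m, τ.arr 1 e = a e) ∧ ∀ e < m, τ.arr 2 e = b e := by
  refine (loop_induction (inp := inp) (fun i τ => Params n k s m q P T r τ ∧
    τ.var 14 = Y i ∧ Y i ≤ T ∧ (∀ e < i, τ.arr 1 e = a e) ∧ ∀ e < i, τ.arr 2 e = b e)
    h.hm ⟨h, h0, hT, by simp, by simp⟩ ?_).2
  rintro i τ hi ⟨h1, h2, h3, h4, h5⟩
  refine ⟨(h1.set 31 i (by norm_num)).run _ (by decide), ?_⟩
  have hai := ha i hi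
  have hbi := hb i hi
  have hYi := hY i hi
  have hq : 0 < q := by omega
  have hk : 0 < k := by omega
  have e1 : Y i % q = a i := by
    rw [hYi, Nat.add_mul_mod_self_left, Nat.mod_eq_of_lt hai]
  have e2 : Y i / q = b i + k * Y (i + 1) := by
    rw [hYi, Nat.add_mul_div_left _ _ hq, Nat.div_eq_of_lt hai, zero_add]
  have e3 : Y i / q % k = b i := by
    rw [e2, Nat.add_mul_mod_self_left, Nat.mod_eq_of_lt hbi]
  have e4 : Y i / q / k = Y (i + 1) := by
    rw [e2, Nat.add_mul_div_left _ _ hk, Nat.div_eq_of_lt hbi, zero_add]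
  have e5 : Y i / q ≤ T := (Nat.div_le_self _ _).trans h3
  have e6 : Y (i + 1) ≤ T := by rw [← e4]; exact (Nat.div_le_self _ _).trans e5
  simp only [run_seq, run_store]
  rw [run_split (b := 5) (by norm_num) (by norm_num) (by norm_num) (by simpa [h1.hq] using hq)
    (by simpa [h1.hT, h2] using h3)]
  rw [run_split (b := 2) (by norm_num) (by norm_num) (by norm_num) (by simpa [h1.hk] using hk)
    (by simpa [h1.hT, h1.hq, h2] using e5)]
  simp only [Env.set_var, Env.setArr_var, Env.set_arr, Env.setArr_arr, eval_var,
    Nat.reduceEqDiff, if_true, if_false, h1.hq, h1.hk, h2, e1, e3, e4]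
  refine ⟨trivial, e6, fun e he => ?_, fun e he => ?_⟩
  · rcases eq_or_ne e i with rfl | hne
    · simp
    · simpa [hne] using h4 e (by omega)
  · rcases eq_or_ne e i with rfl | hne
    · simp
    · simpa [hne] using h5 e (by omega)

theorem run_clearMarks (h : Params n k s m q P T r ρ) :
    ∀ v < n, (clearMarks.run inp ρ).arr 3 v = 0 := by
  refine loop_induction (inp := inp) (fun i τ => ∀ v < i, τ.arr 3 v = 0) h.hn (by simp) ?_
  intro i τ hi h1 v hv
  simp only [run_store, eval_var, eval_lit, Env.setArr_arr, Env.set_var, if_true, true_and,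
    Env.set_arr]
  split_ifs with hvi
  · rfl
  · exact h1 v (by omega)

theorem run_readSeed (h : Params n k s m q P T r ρ) {c u z y : ℕ} (hc : c < n) (hu : u < n)
    (hz : z < P) (h0 : ρ.var 14 = c + n * (u + n * (z + P * y))) (hT : ρ.var 14 ≤ T) :
    let τ := readSeed.run inp ρ
    τ.var 25 = c ∧ τ.var 26 = u ∧ τ.var 15 = z ∧ τ.var 14 = y ∧ y ≤ T ∧ z ≤ T ∧
      τ.arr = ρ.arr := by
  have hn : 0 < n := by omega
  have hP : 0 < P := by omega
  have e1 : ρ.var 14 % n = c := by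
    rw [h0, Nat.add_mul_mod_self_left, Nat.mod_eq_of_lt hc]
  have e2 : ρ.var 14 / n = u + n * (z + P * y) := by
    rw [h0, Nat.add_mul_div_left _ _ hn, Nat.div_eq_of_lt hc, zero_add]
  have e3 : ρ.var 14 / n % n = u := by
    rw [e2, Nat.add_mul_mod_self_left, Nat.mod_eq_of_lt hu]
  have e4 : ρ.var 14 / n / n = z + P * y := by
    rw [e2, Nat.add_mul_div_left _ _ hn, Nat.div_eq_of_lt hu, zero_add]
  have e5 : ρ.var 14 / n / n % P = z := by
    rw [e4, Nat.add_mul_mod_self_left, Nat.mod_eq_of_lt hz]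
  have e6 : ρ.var 14 / n / n / P = y := by
    rw [e4, Nat.add_mul_div_left _ _ hP, Nat.div_eq_of_lt hz, zero_add]
  have e7 : ρ.var 14 / n ≤ T := (Nat.div_le_self _ _).trans hT
  have e8 : ρ.var 14 / n / n ≤ T := (Nat.div_le_self _ _).trans e7
  simp only [readSeed, run_seq]
  rw [run_split (t := 8) (y := 14) (b := 1) (x := 25) (by norm_num) (by norm_num) (by norm_num)
    (by simpa [h.hn] using hn) (by simpa [h.hT] using hT)]
  rw [run_split (t := 8) (y := 14) (b := 1) (x := 26) (by norm_num) (by norm_num) (by norm_num)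
    (by simpa [h.hn] using hn) (by simpa [h.hT, h.hn] using e7)]
  rw [run_split (t := 8) (y := 14) (b := 7) (x := 15) (by norm_num) (by norm_num) (by norm_num)
    (by simpa [h.hP] using hP) (by simpa [h.hT, h.hn] using e8)]
  simp only [Env.set_var, Env.set_arr, Nat.reduceEqDiff, if_true, if_false, h.hn, h.hP, e1, e3,
    e5, e6, true_and, and_true]
  refine ⟨?_, ?_⟩
  · rw [← e6]; exact (Nat.div_le_self _ _).trans e8
  · rw [← e5]; exact (Nat.mod_le _ _).trans e8

end

section

variable {n : ℕ} (s₀ : ℕ) (G : SimpleGraph (Fin n)) (k₀ : ℕ)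
variable {k s m q P T : ℕ} {r : ℕ → ℕ} {ρ : Env}

/-- The scan consumes a bit exactly at the elements of the later common neighbourhood, in the order
in which `bitCode` lists them. The vertex `c` is not among them, so treating it separately skips no
bit. -/
theorem run_startClique (h : Params n k s m q P T r ρ) {c u : ℕ} {A : Finset ℕ}
    (hA : A ⊆ laterCommon (natGraph G) n r c u) (h25 : ρ.var 25 = c) (h26 : ρ.var 26 = u)
    (h15 : ρ.var 15 = bitCode (laterCommon (natGraph G) n r c u) A n 0) (hT : ρ.var 15 ≤ T) :
    ∀ v < n, (startClique.run (encode s₀ G k₀) ρ).arr 4 v ≠ 0 ↔ v = c ∨ v ∈ A := by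
  set C := laterCommon (natGraph G) n r c u with hC
  refine (loop_induction (inp := encode s₀ G k₀) (fun i τ => Params n k s m q P T r τ ∧
    τ.var 25 = c ∧ τ.var 26 = u ∧ τ.var 15 = bitCode C A n i ∧ τ.var 15 ≤ T ∧
      ∀ v < i, τ.arr 4 v ≠ 0 ↔ v = c ∨ v ∈ A) h.hn ⟨h, h25, h26, h15, hT, by simp⟩ ?_).2.2.2.2.2
  rintro i τ hi ⟨h1, h2, h3, h4, h5, h6⟩
  have h1' := h1.set 27 i (by norm_num)
  have hk25 := run_var (inp := encode s₀ G k₀) (x := 25) startStep (by decide) (τ.set 27 i)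
  have hk26 := run_var (inp := encode s₀ G k₀) (x := 26) startStep (by decide) (τ.set 27 i)
  simp only [Env.set_var, Nat.reduceEqDiff, if_false] at hk25 hk26
  refine ⟨h1'.run _ (by decide), hk25.trans h2, hk26.trans h3, ?_⟩
  have hcc : c ∉ C := fun hc => lt_irrefl _ (mem_laterCommon.1 hc).2.1
  have hcond : (and (lt (arr 0 (var 25)) (arr 0 (var 27))) (and (adj 25 27) (adj 26 27))).Tr
      (encode s₀ G k₀) (τ.set 27 i) ↔ i ∈ C := by
    simp only [tr_and, tr_lt, eval_arr, eval_var, Env.set_var, Env.set_arr, h1.hr, h2, h3,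
      tr_adj s₀ G k₀ h1'.hn, Nat.reduceEqDiff, if_true, if_false, ne_eq, not_false_eq_true, hC,
      mem_laterCommon, hi, true_and]
  have hbit := h4
  rw [bitCode, if_neg (by omega)] at hbit
  simp only [startStep, run_ite, hcond, tr_eq, eval_var, Env.set_var, Nat.reduceEqDiff, if_true,
    if_false, h2]
  by_cases hic : i = c
  · subst hic
    rw [if_neg hcc] at hbit
    simp only [if_true, run_store, Env.setArr_var, Env.set_var, Nat.reduceEqDiff, if_false,
      Env.setArr_arr, Env.set_arr, eval_var, eval_lit, true_and]
    refine ⟨hbit, h5, fun v hv => ?_⟩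
    split_ifs with hvi
    · simp [hvi]
    · exact h6 v (by omega)
  rw [if_neg hic]
  by_cases hiC : i ∈ C
  · rw [if_pos hiC] at hbit ⊢
    rw [run_seq, run_split (by norm_num) (by norm_num) (by norm_num) (by simp [h1.h2])
      (by simpa [h1.hT] using h5)]
    have e1 : τ.var 15 / 2 = bitCode C A n (i + 1) := by rw [hbit]; split_ifs <;> omega
    have e2 : τ.var 15 % 2 = if i ∈ A then 1 else 0 := by rw [hbit]; split_ifs <;> omega
    simp only [run_store, Env.setArr_var, Env.set_var, Nat.reduceEqDiff, if_true, if_false,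
      Env.setArr_arr, Env.set_arr, eval_var, true_and, h1.h2, e1, e2]
    refine ⟨?_, fun v hv => ?_⟩
    · rw [← e1]; exact (Nat.div_le_self _ _).trans h5
    · split_ifs with hvi hiA
      · simp [hvi, hiA]
      · simp [hvi, hiA, hic]
      · exact h6 v (by omega)
  · rw [if_neg hiC] at hbit ⊢
    simp only [run_store, Env.setArr_var, Env.set_var, Nat.reduceEqDiff, if_true, if_false,
      Env.setArr_arr, Env.set_arr, eval_var, eval_lit, true_and]
    refine ⟨hbit, h5, fun v hv => ?_⟩
    split_ifs with hvi
    · have : i ∉ A := fun h => hiC (hA h)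
      simp [hvi, hic, this]
    · exact h6 v (by omega)

/-- Round `i` treats the rank `r c - (i + 1)`. When a vertex comes up, the array already holds
exactly the members of `K` of larger rank. A vertex of `K` is accepted because `K` is a clique; a
vertex outside is rejected because `hearly` provides a nonneighbour of larger rank in `K`. -/
theorem run_extendClique (h : Params n k s m q P T r ρ) {c Γ : ℕ} {K : Finset ℕ}
    (hr : IsClosedRanking (natGraph G) n Γ r) (hK : IsMaxClique (natGraph G) n K) (hc : c ∈ K)
    (h25 : ρ.var 25 = c)
    (hearly : ∀ v < n, v ∉ K → r v < r c → ∃ w ∈ K, r v < r w ∧ ¬ (natGraph G).Adj v w)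
    (h4 : ∀ v < n, ρ.arr 4 v ≠ 0 ↔ v ∈ K ∧ r c ≤ r v) :
    ∀ v < n, (extendClique.run (encode s₀ G k₀) ρ).arr 4 v ≠ 0 ↔ v ∈ K := by
  have hKn : ∀ w ∈ K, w < n := fun w hw => Finset.mem_range.1 (hK.1 hw)
  have main := loop_induction (inp := encode s₀ G k₀) (x := 29) (c := loop 27 1 extendStep)
    (fun i τ => Params n k s m q P T r τ ∧
    τ.var 25 = c ∧ ∀ v < n, τ.arr 4 v ≠ 0 ↔ v ∈ K ∧ r c ≤ r v + i) h.hn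
    ⟨h, h25, by simpa using h4⟩ (by
      rintro i τ hi ⟨h1, h2, h3⟩
      have h1' := h1.set 29 i (by norm_num)
      obtain ⟨g1, g2, -, g3⟩ := loop_induction (inp := encode s₀ G k₀) (x := 27) (c := extendStep)
        (ρ := τ.set 29 i) (fun j υ => Params n k s m q P T r υ ∧
        υ.var 25 = c ∧ υ.var 29 = i ∧ ∀ v < n, υ.arr 4 v ≠ 0 ↔
          v ∈ K ∧ (r c ≤ r v + i ∨ r c ≤ r v + i + 1 ∧ v < j)) h1'.hn
        ⟨h1', by simpa using h2, by simp, by simpa using h3⟩ (by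
          rintro j υ hj ⟨f1, f2, f3, f4⟩
          have f1' := f1.set 27 j (by norm_num)
          have hk25 := run_var (inp := encode s₀ G k₀) (x := 25) extendStep (by decide)
            (υ.set 27 j)
          have hk29 := run_var (inp := encode s₀ G k₀) (x := 29) extendStep (by decide)
            (υ.set 27 j)
          simp only [Env.set_var, Nat.reduceEqDiff, if_false] at hk25 hk29
          refine ⟨f1'.run _ (by decide), hk25.trans f2, hk29.trans f3, ?_⟩
          have hcond : (and (eq (add (arr 0 (var 27)) (add (var 29) (lit 1))) (arr 0 (var 25)))
              (all 30 1 (or (not (arr 4 (var 30))) (adj 27 30)))).Tr (encode s₀ G k₀) (υ.set 27 j)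
              ↔ r j + i + 1 = r c ∧ j ∈ K := by
            have hadj : ∀ w, (adj 27 30).Tr (encode s₀ G k₀) ((υ.set 27 j).set 30 w)
                ↔ (natGraph G).Adj j w := by
              intro w
              rw [tr_adj s₀ G k₀ (f1'.set 30 w (by norm_num)).hn (by norm_num)]
              simp
            simp only [tr_and, tr_eq, eval_add, eval_arr, eval_var, eval_lit, tr_all, tr_or,
              tr_not, tr_arr, hadj, Env.set_var, Env.set_arr, f1.hr, f1.hn, f2, f3,
              Nat.reduceEqDiff, if_true, if_false, ← add_assoc]
            refine and_congr_right fun hrank => ?_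
            constructor
            · intro hall
              by_contra hjK
              obtain ⟨w, hw, h5, h6⟩ := hearly j hj hjK (by omega)
              rcases hall w (hKn w hw) with h7 | h7
              · exact h7 ((f4 w (hKn w hw)).2 ⟨hw, .inl (by omega)⟩)
              · exact h6 h7
            · intro hjK w hw
              by_cases h5 : υ.arr 4 w ≠ 0
              · refine .inr ?_
                obtain ⟨hwK, h6⟩ := (f4 w hw).1 h5
                refine hK.2.1 hjK hwK ?_
                rintro rfl
                omega
              · exact .inl h5
          intro v hv
          simp only [extendStep, run_ite, hcond]
          by_cases hcj : r j + i + 1 = r c ∧ j ∈ K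
          · rw [if_pos hcj]
            simp only [run_store, Env.setArr_arr, Env.set_arr, eval_var, eval_lit, true_and,
              Env.set_var, if_true]
            split_ifs with hvj
            · subst hvj
              simp only [ne_eq, one_ne_zero, not_false_eq_true, hcj.2, true_and, true_iff]
              omega
            · rw [f4 v hv]
              refine and_congr_right fun _ => ?_
              omega
          · rw [if_neg hcj, run_skip, Env.set_arr, f4 v hv]
            refine and_congr_right fun hvK => ?_
            have : v = j → r v + i + 1 ≠ r c := by
              rintro rfl h5
              exact hcj ⟨h5, hvK⟩
            omega)
      refine ⟨g1, g2, fun v hv => ?_⟩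
      rw [g3 v hv]
      refine and_congr_right fun _ => ?_
      omega)
  intro v hv
  refine (main.2.2 v hv).trans ⟨And.left, fun hvK => ⟨hvK, ?_⟩⟩
  -- Ranks are at most `n`, so `n` rounds get below all ranks.
  have := hr.le c (hKn c hc)
  omega

/-- Clique number `j` serves only the choices `e` with `a e = j`, and marks accumulate. Thus the
cliques need not be stored side by side. -/
theorem run_mark (h : Params n k s m q P T r ρ) {K : Finset ℕ} {a b : ℕ → ℕ} {j : ℕ}
    (hKn : K ⊆ Finset.range n)
    (h4 : ∀ v < n, ρ.arr 4 v ≠ 0 ↔ v ∈ K) (h32 : ρ.var 32 = j)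
    (h1 : ∀ e < m, ρ.arr 1 e = a e) (h2 : ∀ e < m, ρ.arr 2 e = b e) :
    ∀ v < n, (mark.run (encode s₀ G k₀) ρ).arr 3 v ≠ 0 ↔ ρ.arr 3 v ≠ 0 ∨
      ∃ e < m, a e = j ∧ v ∈ K ∧ (K.filter fun w => w ≤ v).card = b e := by
  refine (loop_induction (inp := encode s₀ G k₀) (x := 31) (c := loop 27 1 markStep)
    (fun i τ => Params n k s m q P T r τ ∧ τ.var 32 = j ∧ τ.arr 1 = ρ.arr 1 ∧ τ.arr 2 = ρ.arr 2 ∧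
      τ.arr 4 = ρ.arr 4 ∧ ∀ v < n, τ.arr 3 v ≠ 0 ↔ ρ.arr 3 v ≠ 0 ∨
      ∃ e < i, a e = j ∧ v ∈ K ∧ (K.filter fun w => w ≤ v).card = b e) h.hm
    ⟨h, h32, rfl, rfl, rfl, by simp⟩ ?_).2.2.2.2.2
  rintro i τ hi ⟨e1, e2, e3, e4, e5, e6⟩
  have e1' := e1.set 31 i (by norm_num)
  obtain ⟨g1, g2, -, g3, g4, g5, g6⟩ := loop_induction (inp := encode s₀ G k₀) (x := 27)
    (c := markStep) (ρ := τ.set 31 i) (fun l υ => Params n k s m q P T r υ ∧ υ.var 32 = j ∧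
      υ.var 31 = i ∧ υ.arr 1 = ρ.arr 1 ∧ υ.arr 2 = ρ.arr 2 ∧
      υ.arr 4 = ρ.arr 4 ∧ ∀ v < n, υ.arr 3 v ≠ 0 ↔ τ.arr 3 v ≠ 0 ∨
        (v < l ∧ a i = j ∧ v ∈ K ∧ (K.filter fun w => w ≤ v).card = b i)) e1'.hn
    ⟨e1', by simpa using e2, by simp, e3, e4, e5, by simp⟩ (by
      rintro l υ hl ⟨f1, f2, f3, f4, f5, f6, f7⟩
      have f1' := f1.set 27 l (by norm_num)
      have hk31 := run_var (inp := encode s₀ G k₀) (x := 31) markStep (by decide) (υ.set 27 l)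
      have hk32 := run_var (inp := encode s₀ G k₀) (x := 32) markStep (by decide) (υ.set 27 l)
      have ha1 := run_arr (inp := encode s₀ G k₀) (a := 1) markStep (by decide) (υ.set 27 l)
      have ha2 := run_arr (inp := encode s₀ G k₀) (a := 2) markStep (by decide) (υ.set 27 l)
      have ha4 := run_arr (inp := encode s₀ G k₀) (a := 4) markStep (by decide) (υ.set 27 l)
      simp only [Env.set_var, Nat.reduceEqDiff, if_false] at hk31 hk32
      refine ⟨f1'.run _ (by decide), hk32.trans f2, hk31.trans f3, ha1.trans f4, ha2.trans f5,
        ha4.trans f6, ?_⟩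
      have hcard : ((Finset.range n).filter fun w => ρ.arr 4 w ≠ 0 ∧ w ≤ l).card
          = (K.filter fun w => w ≤ l).card := by
        congr 1
        ext w
        simp only [Finset.mem_filter, Finset.mem_range]
        constructor
        · rintro ⟨h5, h6, h7⟩; exact ⟨(h4 w h5).1 h6, h7⟩
        · rintro ⟨h5, h6⟩
          have h7 := Finset.mem_range.1 (hKn h5)
          exact ⟨h7, (h4 w h7).2 h5, h6⟩
      have hcond : (and (eq (arr 1 (var 31)) (var 32)) <| and (arr 4 (var 27)) <|
          eq (count 30 1 (and (arr 4 (var 30)) (le (var 30) (var 27)))) (arr 2 (var 31))).Tr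
          (encode s₀ G k₀) (υ.set 27 l)
          ↔ a i = j ∧ l ∈ K ∧ (K.filter fun w => w ≤ l).card = b i := by
        simp only [tr_and, tr_eq, tr_arr, tr_le, eval_count, eval_arr, eval_var, Env.set_var,
          Env.set_arr, Nat.reduceEqDiff, if_true, if_false, f2, f3, f4, f5, f6, f1.hn, h1 i hi,
          h2 i hi, hcard, h4 l hl]
      intro v hv
      simp only [markStep, run_ite, hcond]
      by_cases hcl : a i = j ∧ l ∈ K ∧ (K.filter fun w => w ≤ l).card = b i
      · rw [if_pos hcl]
        simp only [run_store, Env.setArr_arr, Env.set_arr, eval_var, eval_lit, true_and,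
          Env.set_var, if_true]
        split_ifs with hvl
        · subst hvl
          simp only [ne_eq, one_ne_zero, not_false_eq_true, true_iff]
          exact .inr ⟨by omega, hcl⟩
        · rw [f7 v hv]
          have : v < l + 1 ↔ v < l := by omega
          rw [this]
      · rw [if_neg hcl, run_skip, Env.set_arr, f7 v hv]
        refine or_congr_right (and_congr_left fun h5 => ?_)
        have : v ≠ l := by rintro rfl; exact hcl h5
        omega)
  refine ⟨g1, g2, g3, g4, g5, fun v hv => ?_⟩
  rw [g6 v hv, e6 v hv, or_assoc]
  refine or_congr_right ?_
  constructor
  · rintro (⟨e, he, h5⟩ | ⟨-, h5⟩)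
    · exact ⟨e, by omega, h5⟩
    · exact ⟨i, by omega, h5⟩
  · rintro ⟨e, he, h5⟩
    rcases Nat.lt_succ_iff_lt_or_eq.1 he with he | rfl
    · exact .inl ⟨e, he, h5⟩
    · exact .inr ⟨hv, h5⟩

theorem run_build (h : Params n k s m q P T r ρ) {D K : ℕ → Prop}
    (h3 : ∀ v < n, ρ.arr 3 v ≠ 0 ↔ D v) (h4 : ∀ v < n, ρ.arr 4 v ≠ 0 ↔ K v) :
    ∀ v < n, (build.run (encode s₀ G k₀) ρ).arr 5 v ≠ 0 ↔
      D v ∨ K v ∧ ∀ u < n, D u → (natGraph G).Adj u v := by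
  refine (loop_induction (inp := encode s₀ G k₀) (fun i τ => Params n k s m q P T r τ ∧
    τ.arr 3 = ρ.arr 3 ∧ τ.arr 4 = ρ.arr 4 ∧
    ∀ v < i, τ.arr 5 v ≠ 0 ↔ D v ∨ K v ∧ ∀ u < n, D u → (natGraph G).Adj u v) h.hn
    ⟨h, rfl, rfl, by simp⟩ ?_).2.2.2
  rintro i τ hi ⟨e1, e2, e3, e4⟩
  have e1' := e1.set 27 i (by norm_num)
  refine ⟨e1'.run _ (by decide), e2, e3, fun v hv => ?_⟩
  simp only [buildStep, run_store, Env.setArr_arr, eval_var, Env.set_var, if_true, true_and,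
    Env.set_arr]
  split_ifs with hvi
  · subst hvi
    have hadj : ∀ w, (adj 30 27).Tr (encode s₀ G k₀) ((τ.set 27 v).set 30 w)
        ↔ (natGraph G).Adj w v := by
      intro w
      rw [tr_adj s₀ G k₀ (e1'.set 30 w (by norm_num)).hn (by norm_num)]
      simp
    have hcond : (or (arr 3 (var 27)) (and (arr 4 (var 27))
        (all 30 1 (or (not (arr 3 (var 30))) (adj 30 27))))).Tr (encode s₀ G k₀) (τ.set 27 v)
        ↔ D v ∨ K v ∧ ∀ u < n, D u → (natGraph G).Adj u v := by
      simp only [tr_or, tr_and, tr_arr, eval_var, Env.set_var, Env.set_arr,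
        if_true, tr_all, tr_not, hadj, e2, e3, Nat.reduceEqDiff, if_false, e1.hn, h3 v hi, h4 v hi]
      refine or_congr_right (and_congr_right fun _ => forall₂_congr fun u hu => ?_)
      rw [h3 u hu]
      tauto
    rw [eval_ite, eval_lit, eval_lit, ite_ne_right_iff, and_iff_left one_ne_zero, hcond]
  · exact e4 v (by omega)

/-- Nothing is assumed about how array `5` arose. Soundness of the search therefore needs no
analysis of candidate numbers that encode no certificate. -/
theorem run_check (h : Params n k s m q P T r ρ) :
    (check.run (encode s₀ G k₀) ρ).var 0 =
      open Classical in
      if k ≤ ((Finset.range n).filter fun v => ρ.arr 5 v ≠ 0).card ∧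
        (missing (natGraph G) ((Finset.range n).filter fun v => ρ.arr 5 v ≠ 0)).card ≤ s
      then 1 else ρ.var 0 := by
  classical
  have hadj : ∀ u v, (adj 27 30).Tr (encode s₀ G k₀) ((ρ.set 27 u).set 30 v)
      ↔ (natGraph G).Adj u v := by
    intro u v
    rw [tr_adj s₀ G k₀ ((h.set 27 u (by norm_num)).set 30 v (by norm_num)).hn (by norm_num)]
    simp
  have hmiss : (missing (natGraph G) ((Finset.range n).filter fun v => ρ.arr 5 v ≠ 0)).card
      = ∑ u ∈ Finset.range n, ((Finset.range n).filter fun v =>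
        (ρ.arr 5 u ≠ 0 ∧ ρ.arr 5 v ≠ 0) ∧ v < u ∧ ¬ (natGraph G).Adj u v).card := by
    simp only [Finset.card_filter]
    rw [← Finset.sum_product', ← Finset.card_filter]
    congr 1
    ext ⟨u, v⟩
    simp only [mem_missing, Finset.mem_filter, Finset.mem_range, Finset.mem_product]
    tauto
  have hcond : (and (le (var 2) (count 27 1 (arr 5 (var 27))))
      (le (sum 27 1 (count 30 1 (and (and (arr 5 (var 27)) (arr 5 (var 30)))
        (and (lt (var 30) (var 27)) (not (adj 27 30)))))) (var 3))).Tr (encode s₀ G k₀) ρ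
      ↔ k ≤ ((Finset.range n).filter fun v => ρ.arr 5 v ≠ 0).card ∧
        (missing (natGraph G) ((Finset.range n).filter fun v => ρ.arr 5 v ≠ 0)).card ≤ s := by
    rw [hmiss]
    simp only [tr_and, tr_le, tr_lt, tr_not, tr_arr, eval_count, eval_sum, eval_var,
      hadj, Env.set_var, Env.set_arr, Nat.reduceEqDiff, if_true, if_false, h.hn, h.hk, h.hs]
  simp only [check, run_ite, hcond]
  split_ifs <;> simp

end

end Program

/-! ### Mixed radix numbers -/

/-- Every sequence of digits is the mixed radix expansion of some number. -/
theorem exists_digits (B m y : ℕ) (d : ℕ → ℕ) (hd : ∀ i < m, d i < B) :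
    ∃ Y : ℕ → ℕ, Y m = y ∧ (∀ i < m, Y i = d i + B * Y (i + 1)) ∧ Y 0 < B ^ m * (y + 1) := by
  induction m generalizing d with
  | zero => exact ⟨fun _ => y, rfl, by simp, by simp⟩
  | succ m ih =>
    obtain ⟨Y, h1, h2, h3⟩ := ih (fun i => d (i + 1)) fun i hi => hd (i + 1) (by omega)
    refine ⟨fun i => if i = 0 then d 0 + B * Y 0 else Y (i - 1), by simpa using h1,
      fun i hi => ?_, ?_⟩
    · rcases i with _ | i
      · simp
      · simpa using h2 i (by omega)
    · have h4 := hd 0 (by omega)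
      have h5 : B * (Y 0 + 1) ≤ B * (B ^ m * (y + 1)) := Nat.mul_le_mul_left B h3
      simp only [if_true]
      calc d 0 + B * Y 0 < B * (Y 0 + 1) := by rw [mul_add]; omega
        _ ≤ _ := h5
        _ = _ := by ring

/-! ### Certificates -/

/-- The vertices marked by the choices `a`, `b`: choice `e` marks the element number `b e` of the
clique `K (a e)`. -/
def Marked (m : ℕ) (K : ℕ → Finset ℕ) (a b : ℕ → ℕ) (v : ℕ) : Prop :=
  ∃ e < m, v ∈ K (a e) ∧ ((K (a e)).filter fun w => w ≤ v).card = b e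

open Classical in
/-- The marked vertices and their common neighbours in the clique `K q`. -/
noncomputable def certSet (H : SimpleGraph ℕ) (n m q : ℕ) (K : ℕ → Finset ℕ) (a b : ℕ → ℕ) :
    Finset ℕ :=
  (Finset.range n).filter fun v =>
    Marked m K a b v ∨ v ∈ K q ∧ ∀ u < n, Marked m K a b u → H.Adj u v

theorem IsMaxClique.nonempty {H : SimpleGraph ℕ} {n : ℕ} {K : Finset ℕ}
    (h : IsMaxClique H n K) (hn : 1 ≤ n) : K.Nonempty := by
  by_contra hK
  rw [Finset.not_nonempty_iff_eq_empty] at hK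
  subst hK
  obtain ⟨w, hw, -⟩ := h.2.2 0 hn (by simp)
  simp at hw

/-- The position of a member in the natural order of the clique determines it, so a choice marks at
most one vertex. Positions start at `1`, since a member counts itself. -/
theorem eq_of_card_filter_le_eq {K : Finset ℕ} {v w : ℕ} (hv : v ∈ K) (hw : w ∈ K)
    (h : (K.filter fun x => x ≤ v).card = (K.filter fun x => x ≤ w).card) : v = w := by
  wlog hvw : v ≤ w generalizing v w
  · exact (this hw hv h.symm (by omega)).symm
  have h1 : (K.filter fun x => x ≤ v) ⊆ K.filter fun x => x ≤ w := fun x hx => by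
    simp only [Finset.mem_filter] at hx ⊢
    exact ⟨hx.1, by omega⟩
  have h2 : w ∈ K.filter fun x => x ≤ v := by
    rw [Finset.eq_of_subset_of_card_le h1 h.ge]
    simp [hw]
  have := (Finset.mem_filter.1 h2).2
  omega

theorem card_offDiag_missing {V : Type*} [LinearOrder V] (H : SimpleGraph V) (S : Finset V)
    [DecidableRel H.Adj] :
    (S.offDiag.filter fun p => ¬ H.Adj p.1 p.2).card = 2 * (missing H S).card := by
  have h : S.offDiag.filter (fun p => ¬ H.Adj p.1 p.2)
      = missing H S ∪ (missing H S).map (Equiv.prodComm V V).toEmbedding := by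
    ext ⟨u, v⟩
    simp only [Finset.mem_filter, Finset.mem_offDiag, Finset.mem_union, mem_missing,
      Finset.mem_map, Equiv.coe_toEmbedding, Equiv.prodComm_apply, Prod.exists, Prod.swap_prod_mk,
      Prod.mk.injEq]
    constructor
    · rintro ⟨⟨h1, h2, h3⟩, h4⟩
      rcases lt_or_gt_of_ne h3 with h5 | h5
      · exact .inr ⟨v, u, ⟨⟨h2, h1⟩, h5, fun h => h4 h.symm⟩, rfl, rfl⟩
      · exact .inl ⟨⟨h1, h2⟩, h5, h4⟩
    · rintro (⟨⟨h1, h2⟩, h3, h4⟩ | ⟨v', u', ⟨⟨h1, h2⟩, h3, h4⟩, rfl, rfl⟩)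
      · exact ⟨⟨h1, h2, h3.ne'⟩, h4⟩
      · exact ⟨⟨h2, h1, h3.ne⟩, fun h => h4 h.symm⟩
  rw [h, Finset.card_union_of_disjoint, Finset.card_map, two_mul]
  rw [Finset.disjoint_left]
  rintro ⟨u, v⟩ h1 h2
  simp only [mem_missing, Finset.mem_map, Equiv.coe_toEmbedding, Equiv.prodComm_apply,
    Prod.exists, Prod.swap_prod_mk, Prod.mk.injEq] at h1 h2
  obtain ⟨v', u', ⟨-, h3, -⟩, rfl, rfl⟩ := h2
  exact lt_asymm h1.2.1 h3

/-- The certificate reproduces a superset of `S` with no further missing edges, or else a maximal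
clique with at least `k` vertices. Splitting off the second case makes all maximal cliques smaller
than `k`, so that positions in them are below `k`. -/
theorem exists_certificate {H : SimpleGraph ℕ} {n k s q : ℕ} (hk : 1 ≤ k)
    (hq : 2 * s < q * (q + 1)) {S : Finset ℕ} (hS : S ⊆ Finset.range n) (hkS : k ≤ S.card)
    (hsS : (missing H S).card ≤ s) :
    ∃ (K : ℕ → Finset ℕ) (a b : ℕ → ℕ), (∀ j, IsMaxClique H n (K j)) ∧ (∀ e, a e < q + 1) ∧
      (∀ e, b e < k) ∧ k ≤ (certSet H n (2 * s) q K a b).card ∧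
      (missing H (certSet H n (2 * s) q K a b)).card ≤ s := by
  classical
  have hcardpos : ∀ (K : Finset ℕ) (v : ℕ), v ∈ K → (K.filter fun w => w ≤ v).card ≠ 0 :=
    fun K v hv => Finset.card_ne_zero.2 ⟨v, by simp [hv]⟩
  -- No member of a clique has position `0`, so constant zero choices mark nothing, and the
  -- certified set is the large clique itself.
  by_cases hbig : ∃ K, IsMaxClique H n K ∧ k ≤ K.card
  · obtain ⟨K, hK, hkK⟩ := hbig
    have hM : ∀ v, ¬ Marked (2 * s) (fun _ => K) (fun _ => 0) (fun _ => 0) v := by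
      rintro v ⟨e, -, h1, h2⟩
      exact hcardpos K v h1 h2
    have hC : certSet H n (2 * s) q (fun _ => K) (fun _ => 0) (fun _ => 0) = K := by
      ext v
      simp only [certSet, hM, Finset.mem_filter, Finset.mem_range, false_or, false_imp_iff,
        implies_true, and_true, and_iff_right_iff_imp]
      exact fun hv => Finset.mem_range.1 (hK.1 hv)
    refine ⟨fun _ => K, fun _ => 0, fun _ => 0, fun _ => hK, by simp, fun _ => hk, ?_⟩
    rw [hC]
    refine ⟨hkK, ?_⟩
    have : missing H K = ∅ := by
      ext p
      simp only [mem_missing, Finset.notMem_empty, iff_false]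
      rintro ⟨⟨h1, h2⟩, h3, h4⟩
      exact h4 (hK.2.1 h1 h2 h3.ne')
    simp [this]
  push Not at hbig
  have hoff := card_offDiag_missing H S
  obtain ⟨f, hf, hf'⟩ := exists_clique_partition H q S (by omega)
  -- `D` collects the vertices of `S` that meet a missing edge; each is the first entry of one of
  -- the at most `2 * s` ordered nonadjacent pairs.
  set D := S.filter fun v => ∃ u ∈ S, u ≠ v ∧ ¬ H.Adj v u with hD
  have hDS : D ⊆ S := Finset.filter_subset _ _
  have hDcard : D.card ≤ 2 * s := by
    have h1 : D ⊆ (S.offDiag.filter fun p => ¬ H.Adj p.1 p.2).image Prod.fst := by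
      intro v hv
      obtain ⟨hv, u, hu, huv, hadj⟩ := Finset.mem_filter.1 hv
      exact Finset.mem_image.2 ⟨(v, u), by simp [hv, hu, huv.symm, hadj], rfl⟩
    have h2 := Finset.card_le_card h1
    have h3 := Finset.card_image_le (s := S.offDiag.filter fun p => ¬ H.Adj p.1 p.2)
      (f := Prod.fst)
    omega
  have hfull : ∀ v ∈ S, v ∉ D → ∀ u ∈ S, u ≠ v → H.Adj v u := by
    intro v hv hvD u hu huv
    by_contra hadj
    exact hvD (Finset.mem_filter.2 ⟨hv, u, hu, huv, hadj⟩)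
  -- The indices below `q` carry the colour classes, and index `q` carries the clique `S \ D`; both
  -- kinds extend to maximal cliques.
  have hcl : ∀ j, ∃ K, (if j < q then S.filter fun v => f v = j else S \ D) ⊆ K ∧
      IsMaxClique H n K := by
    intro j
    refine exists_isMaxClique_superset ?_ ?_
    · split_ifs
      · exact (Finset.filter_subset _ _).trans hS
      · exact Finset.sdiff_subset.trans hS
    · split_ifs
      · intro u hu v hv huv
        obtain ⟨hu, hu'⟩ := Finset.mem_filter.1 hu
        obtain ⟨hv, hv'⟩ := Finset.mem_filter.1 hv
        exact hf' u hu v hv huv (hu'.trans hv'.symm)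
      · intro u hu v hv huv
        obtain ⟨hu, hu'⟩ := Finset.mem_sdiff.1 hu
        exact hfull u hu hu' v (Finset.mem_sdiff.1 hv).1 huv.symm
  choose K hsub hmax using hcl
  have hKf : ∀ v ∈ S, v ∈ K (f v) := fun v hv => by
    have := hsub (f v)
    rw [if_pos (hf v hv)] at this
    exact this (Finset.mem_filter.2 ⟨hv, rfl⟩)
  have hKq : S \ D ⊆ K q := by
    have := hsub q
    rwa [if_neg (lt_irrefl q)] at this
  have hlen : D.toList.length ≤ 2 * s := by rwa [Finset.length_toList]
  -- The choices list `D`; the unused ones are padded with position `0`, which marks nothing.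
  let a : ℕ → ℕ := fun e => if e < D.toList.length then f (D.toList.getD e 0) else 0
  let b : ℕ → ℕ := fun e => if e < D.toList.length then
    ((K (f (D.toList.getD e 0))).filter fun w => w ≤ D.toList.getD e 0).card else 0
  have hget : ∀ e < D.toList.length, D.toList.getD e 0 ∈ D := fun e he => by
    rw [List.getD_eq_getElem _ _ he]
    exact Finset.mem_toList.1 (List.getElem_mem he)
  have hM : ∀ v, Marked (2 * s) K a b v ↔ v ∈ D := by
    intro v
    constructor
    · rintro ⟨e, -, h1, h2⟩
      simp only [a, b] at h1 h2
      split_ifs at h1 h2 with he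
      · have h3 := hget e he
        rw [eq_of_card_filter_le_eq h1 (hKf _ (hDS h3)) h2]
        exact h3
      · exact absurd h2 (hcardpos _ v h1)
    · intro hv
      obtain ⟨e, he, hev⟩ := List.getElem_of_mem (Finset.mem_toList.2 hv)
      have h3 : D.toList.getD e 0 = v := by rw [List.getD_eq_getElem _ _ he, hev]
      refine ⟨e, by omega, ?_, ?_⟩
      · simp only [a, if_pos he, h3]; exact hKf v (hDS hv)
      · simp only [a, b, if_pos he, h3]
  have hC : ∀ v, v ∈ certSet H n (2 * s) q K a b ↔
      v < n ∧ (v ∈ D ∨ v ∈ K q ∧ ∀ u < n, u ∈ D → H.Adj u v) := by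
    intro v
    simp only [certSet, hM, Finset.mem_filter, Finset.mem_range]
  refine ⟨K, a, b, hmax, fun e => ?_, fun e => ?_, hkS.trans (Finset.card_le_card ?_),
    le_trans (Finset.card_le_card ?_) hsS⟩
  · simp only [a]
    split_ifs with he
    · have := hf _ (hDS (hget e he)); omega
    · omega
  · simp only [b]
    split_ifs with he
    · exact (Finset.card_le_card (Finset.filter_subset _ _)).trans_lt (hbig _ (hmax _))
    · omega
  · intro v hv
    rw [hC]
    refine ⟨Finset.mem_range.1 (hS hv), ?_⟩
    by_cases hvD : v ∈ D
    · exact .inl hvD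
    · refine .inr ⟨hKq (Finset.mem_sdiff.2 ⟨hv, hvD⟩), fun u _ hu => ?_⟩
      exact (hfull v hv hvD u (hDS hu) (by rintro rfl; exact hvD hu)).symm
  · rintro ⟨u, v⟩ hp
    rw [mem_missing, hC, hC] at hp
    obtain ⟨⟨⟨hun, hu⟩, ⟨hvn, hv⟩⟩, hlt, hadj⟩ := hp
    -- A vertex of the certified set outside `D` is adjacent to all of `D`, and any two such
    -- vertices lie in the clique `K q`; a missing edge thus has both ends in `D`.
    have hboth : u ∈ D ∧ v ∈ D := by
      rcases hu with hu | ⟨hu, hu'⟩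
      · rcases hv with hv | ⟨hv, hv'⟩
        · exact ⟨hu, hv⟩
        · exact absurd (hv' u hun hu) hadj
      · rcases hv with hv | ⟨hv, hv'⟩
        · exact absurd (hu' v hvn hv).symm hadj
        · exact absurd ((hmax q).2.1 hu hv hlt.ne') hadj
    exact mem_missing.2 ⟨⟨hDS hboth.1, hDS hboth.2⟩, hlt, hadj⟩

/-- The data from which the program reconstructs a maximal clique. -/
theorem IsMaxClique.exists_code {H : SimpleGraph ℕ} {n Γ : ℕ} {r : ℕ → ℕ} {K : Finset ℕ}
    (hK : IsMaxClique H n K) (hne : K.Nonempty) (hr : IsClosedRanking H n Γ r) :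
    ∃ (c u : ℕ) (A : Finset ℕ), c ∈ K ∧ u < n ∧ A ⊆ laterCommon H n r c u ∧
      bitCode (laterCommon H n r c u) A n 0 < 2 ^ Γ ∧
      (∀ v < n, (v = c ∨ v ∈ A) ↔ v ∈ K ∧ r c ≤ r v) ∧
      ∀ v < n, v ∉ K → r v < r c → ∃ w ∈ K, r v < r w ∧ ¬ H.Adj v w := by
  obtain ⟨c, hc, u, hu, h1, h2, h3⟩ := hK.exists_seed hne hr
  refine ⟨c, u, K.filter fun w => r c < r w, hc, hu, fun w hw => ?_, ?_, fun v hv => ?_, h3⟩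
  · obtain ⟨hw1, hw2⟩ := Finset.mem_filter.1 hw
    exact h1 w hw1 hw2
  · rcases h2 with h2 | h2
    · rw [Finset.filter_false_of_mem (fun w hw => not_lt.2 (h2 w hw)), bitCode_empty]
      positivity
    · refine (bitCode_lt _ _ _ _).trans_le (Nat.pow_le_pow_right (by norm_num) ?_)
      exact (Finset.card_le_card (Finset.filter_subset _ _)).trans h2.le
  · rw [Finset.mem_filter]
    constructor
    · rintro (rfl | ⟨h4, h5⟩)
      · exact ⟨hc, le_rfl⟩
      · exact ⟨h4, h5.le⟩
    · rintro ⟨h4, h5⟩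
      rcases h5.eq_or_lt with h5 | h5
      · exact .inl (hr.inj c (Finset.mem_range.1 (hK.1 hc)) v hv h5).symm
      · exact .inr ⟨h4, h5⟩

/-! ### Correctness of the search -/

namespace Program

open Exp Cmd

variable {n : ℕ} (s₀ : ℕ) (G : SimpleGraph (Fin n)) (k₀ : ℕ)
variable {k s m q P T Γ : ℕ} {r : ℕ → ℕ} {ρ : Env}

/-- The cliques are rebuilt one after the other in array `4`, which at the end still holds the last
one. This is why the clique that contains `S \ D` has the last index. -/
theorem run_cliques (h : Params n k s m q P T r ρ) (hP : P = 2 ^ Γ)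
    (hr : IsClosedRanking (natGraph G) n Γ r) {K : ℕ → Finset ℕ} {a b : ℕ → ℕ}
    (hK : ∀ j, IsMaxClique (natGraph G) n (K j))
    (h1 : ∀ e < m, ρ.arr 1 e = a e) (h2 : ∀ e < m, ρ.arr 2 e = b e)
    (h3 : ∀ v < n, ρ.arr 3 v = 0) {c u : ℕ → ℕ} {A : ℕ → Finset ℕ} {Y : ℕ → ℕ}
    (hc : ∀ j, c j ∈ K j) (hu : ∀ j, u j < n)
    (hA : ∀ j, A j ⊆ laterCommon (natGraph G) n r (c j) (u j))
    (hz : ∀ j, bitCode (laterCommon (natGraph G) n r (c j) (u j)) (A j) n 0 < 2 ^ Γ)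
    (hcA : ∀ j, ∀ v < n, (v = c j ∨ v ∈ A j) ↔ v ∈ K j ∧ r (c j) ≤ r v)
    (he : ∀ j, ∀ v < n, v ∉ K j → r v < r (c j) →
      ∃ w ∈ K j, r v < r w ∧ ¬ (natGraph G).Adj v w)
    (hY : ∀ j < q, Y j = c j + n * (u j + n *
      (bitCode (laterCommon (natGraph G) n r (c j) (u j)) (A j) n 0 + P * Y (j + 1))))
    (h14 : ρ.var 14 = Y 0) (hT : Y 0 ≤ T) :
    let τ := (loop 32 5 cliqueStep).run (encode s₀ G k₀) ρ
    (∀ v < n, τ.arr 3 v ≠ 0 ↔ ∃ e < m, a e < q ∧ v ∈ K (a e) ∧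
      ((K (a e)).filter fun w => w ≤ v).card = b e) ∧
    (0 < q → ∀ v < n, τ.arr 4 v ≠ 0 ↔ v ∈ K (q - 1)) := by
  refine (loop_induction (inp := encode s₀ G k₀) (x := 32) (c := cliqueStep)
    (fun j τ => Params n k s m q P T r τ ∧ τ.var 14 = Y j ∧ Y j ≤ T ∧ τ.arr 1 = ρ.arr 1 ∧
      τ.arr 2 = ρ.arr 2 ∧
      (∀ v < n, τ.arr 3 v ≠ 0 ↔ ∃ e < m, a e < j ∧ v ∈ K (a e) ∧
        ((K (a e)).filter fun w => w ≤ v).card = b e) ∧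
      (0 < j → ∀ v < n, τ.arr 4 v ≠ 0 ↔ v ∈ K (j - 1))) h.hq
    ⟨h, h14, hT, rfl, rfl, by simpa using h3, by simp⟩ ?_).2.2.2.2.2
  rintro j τ hj ⟨e1, e2, e3, e4, e5, e6, -⟩
  have e1' := e1.set 32 j (by norm_num)
  have hKn : ∀ j, K j ⊆ Finset.range n := fun j => (hK j).1
  obtain ⟨f1, f2, f3, f4, f5, f6, f7⟩ := run_readSeed (inp := encode s₀ G k₀) e1'
    (Finset.mem_range.1 (hKn j (hc j))) (hu j) (hP ▸ hz j) (e2.trans (hY j hj)) (e2.trans_le e3)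
  set τ₁ := readSeed.run (encode s₀ G k₀) (τ.set 32 j) with hτ₁
  have p1 : Params n k s m q P T r τ₁ := e1'.run _ (by decide)
  have g1 := run_startClique s₀ G k₀ p1 (hA j) f1 f2 f3 (f3.trans_le f6)
  set τ₂ := startClique.run (encode s₀ G k₀) τ₁ with hτ₂
  have p2 : Params n k s m q P T r τ₂ := p1.run _ (by decide)
  have k25 : τ₂.var 25 = c j := (run_var startClique (by decide) τ₁).trans f1
  have g2 := run_extendClique s₀ G k₀ p2 hr (hK j) (hc j) k25 (he j)
    fun v hv => (g1 v hv).trans (hcA j v hv)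
  set τ₃ := extendClique.run (encode s₀ G k₀) τ₂ with hτ₃
  have p3 : Params n k s m q P T r τ₃ := p2.run _ (by decide)
  have k32 : τ₃.var 32 = j :=
    (run_var extendClique (by decide) τ₂).trans <| (run_var startClique (by decide) τ₁).trans <|
      (run_var readSeed (by decide) _).trans (by simp)
  have karr : ∀ i : Fin 8, i ≠ 4 → τ₃.arr i = τ.arr i := by
    intro i hi
    have q1 : startClique.keepsArr i := by revert i; decide
    have q2 : extendClique.keepsArr i := by revert i; decide
    exact (run_arr extendClique q2 τ₂).trans <| (run_arr startClique q1 τ₁).trans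
      (by rw [f7]; rfl)
  have g3 := run_mark s₀ G k₀ (a := a) (b := b) p3 (hKn j) g2 k32
    (fun e he => by rw [karr 1 (by decide), e4]; exact h1 e he)
    (fun e he => by rw [karr 2 (by decide), e5]; exact h2 e he)
  have hrun : cliqueStep.run (encode s₀ G k₀) (τ.set 32 j) = mark.run (encode s₀ G k₀) τ₃ := rfl
  rw [hrun]
  refine ⟨p3.run _ (by decide), ?_, f5, ?_, ?_, fun v hv => ?_, fun _ v hv => ?_⟩
  · exact (run_var mark (by decide) τ₃).trans <| (run_var extendClique (by decide) τ₂).trans <|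
      (run_var startClique (by decide) τ₁).trans f4
  · exact (run_arr mark (by decide) τ₃).trans <| (karr 1 (by decide)).trans e4
  · exact (run_arr mark (by decide) τ₃).trans <| (karr 2 (by decide)).trans e5
  · rw [g3 v hv, karr 3 (by decide), e6 v hv]
    constructor
    · rintro (⟨e, h5, h6, h7⟩ | ⟨e, h5, h6, h7⟩)
      · exact ⟨e, h5, by omega, h7⟩
      · subst h6; exact ⟨e, h5, by omega, h7⟩
    · rintro ⟨e, h5, h6, h7⟩
      rcases Nat.lt_succ_iff_lt_or_eq.1 h6 with h6 | h6
      · exact .inl ⟨e, h5, h6, h7⟩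
      · exact .inr ⟨e, h5, h6, h6 ▸ h7⟩
  · rw [show mark.run (encode s₀ G k₀) τ₃ = _ from rfl, run_arr mark (by decide) τ₃]
    simpa using g2 v hv

/-- Every certificate is found by the search. -/
theorem exists_run_candidate (hn : 1 ≤ n) (hP : P = 2 ^ Γ)
    (hT : T = (n * n * P) ^ (q + 1) * ((q + 1) * k) ^ m)
    (hr : IsClosedRanking (natGraph G) n Γ r) {K : ℕ → Finset ℕ} {a b : ℕ → ℕ}
    (hK : ∀ j, IsMaxClique (natGraph G) n (K j)) (ha : ∀ e, a e < q + 1) (hb : ∀ e, b e < k) :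
    ∃ x < T, ∀ ρ, Params n k s m (q + 1) P T r ρ → ρ.var 13 = x →
      ∀ v < n, (candidate.run (encode s₀ G k₀) ρ).arr 5 v ≠ 0 ↔
        v ∈ certSet (natGraph G) n m q K a b := by
  choose c u A hc hu hA hz hcA he using fun j => (hK j).exists_code ((hK j).nonempty hn) hr
  set z : ℕ → ℕ := fun j =>
    bitCode (laterCommon (natGraph G) n r (c j) (u j)) (A j) n 0 with hzdef
  -- The seeds, with digits in base `n * n * P`, form the number `Y 0`; it is the high part of the
  -- candidate number, below which the digits of the choices in base `(q + 1) * k` are placed.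
  obtain ⟨Y, hY1, hY2, hY3⟩ := exists_digits (n * n * P) (q + 1) 0
    (fun j => c j + n * (u j + n * z j)) (fun j _ => by
      have h1 : c j < n := Finset.mem_range.1 ((hK j).1 (hc j))
      have h2 : z j + 1 ≤ P := hP ▸ hz j
      have h3 : u j + n * z j + 1 ≤ n * P := by
        have h4 := Nat.mul_le_mul_left n h2
        have h5 := hu j
        rw [mul_add] at h4
        omega
      have h4 := Nat.mul_le_mul_left n h3
      rw [mul_add, ← mul_assoc] at h4
      show c j + n * (u j + n * z j) < _
      omega)
  obtain ⟨X, hX1, hX2, hX3⟩ := exists_digits ((q + 1) * k) m (Y 0)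
    (fun e => a e + (q + 1) * b e) (fun e _ => by
      have h1 := ha e
      have h2 := Nat.mul_le_mul_left (q + 1) (hb e)
      rw [Nat.succ_eq_add_one, mul_add] at h2
      show a e + (q + 1) * b e < _
      omega)
  have hXT : X 0 < T := by
    refine hX3.trans_le ?_
    rw [hT, mul_comm]
    exact Nat.mul_le_mul_right _ (by simpa using hY3)
  refine ⟨X 0, hXT, fun ρ h h13 => ?_⟩
  have p0 : Params n k s m (q + 1) P T r (ρ.set 14 (ρ.var 13)) := h.set 14 _ (by norm_num)
  obtain ⟨f1, f2, f3, f4⟩ := run_readChoices (inp := encode s₀ G k₀) p0 (a := a) (b := b) (Y := X)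
    (fun e _ => ha e) (fun e _ => hb e) (fun e he => by rw [hX2 e he]; ring) hXT.le (by simpa)
  set τ₁ := readChoices.run (encode s₀ G k₀) (ρ.set 14 (ρ.var 13)) with hτ₁
  have p1 : Params n k s m (q + 1) P T r τ₁ := p0.run _ (by decide)
  have g3 := run_clearMarks (inp := encode s₀ G k₀) p1
  set τ₂ := clearMarks.run (encode s₀ G k₀) τ₁ with hτ₂
  have p2 : Params n k s m (q + 1) P T r τ₂ := p1.run _ (by decide)
  have k14 : τ₂.var 14 = Y 0 :=
    (run_var clearMarks (by decide) τ₁).trans (f1.trans hX1)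
  have k1 : τ₂.arr 1 = τ₁.arr 1 := run_arr clearMarks (by decide) τ₁
  have k2 : τ₂.arr 2 = τ₁.arr 2 := run_arr clearMarks (by decide) τ₁
  obtain ⟨e3, e4⟩ := run_cliques s₀ G k₀ (a := a) (b := b) (Y := Y) p2 hP hr hK
    (fun e he => by rw [k1]; exact f3 e he)
    (fun e he => by rw [k2]; exact f4 e he) g3 hc hu hA hz hcA he
    (fun j hj => by rw [hY2 j hj]; ring) k14 (hX1 ▸ f2)
  set τ₃ := (loop 32 5 cliqueStep).run (encode s₀ G k₀) τ₂ with hτ₃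
  have p3 : Params n k s m (q + 1) P T r τ₃ := p2.run _ (by decide)
  have hfin := run_build s₀ G k₀ p3 (D := Marked m K a b) (K := fun v => v ∈ K q)
    (fun v hv => (e3 v hv).trans (by simp [Marked, ha])) (by simpa using e4)
  intro v hv
  refine (hfin v hv).trans ?_
  simp [certSet, hv]

/-- Acceptance is sound because the tested set is itself a solution, and it is never revoked. A
solution yields a certificate, whose number is below `T` and hence visited. -/
theorem run_search (hρ : Params n k s (2 * s) (q + 1) P T r ρ) (h0 : ρ.var 0 = 0) (hn : 1 ≤ n)
    (hk : 1 ≤ k) (hq : 2 * s < q * (q + 1)) (hP : P = 2 ^ Γ)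
    (hT : T = (n * n * P) ^ (q + 1) * ((q + 1) * k) ^ (2 * s))
    (hr : IsClosedRanking (natGraph G) n Γ r) :
    (search.run (encode s₀ G k₀) ρ).var 0 ≠ 0 ↔
      ∃ S ⊆ Finset.range n, k ≤ S.card ∧ (missing (natGraph G) S).card ≤ s := by
  classical
  -- `x₀` is the number of a certificate, or the value `T`, which the loop does not reach, if there
  -- is no solution. One loop invariant then covers both cases.
  obtain ⟨x₀, hx₀, hfound⟩ : ∃ x₀, ((∃ S ⊆ Finset.range n, k ≤ S.card ∧
      (missing (natGraph G) S).card ≤ s) → x₀ < T) ∧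
      ∀ ρ, Params n k s (2 * s) (q + 1) P T r ρ → ρ.var 13 = x₀ → x₀ < T →
        k ≤ ((Finset.range n).filter fun v =>
          (candidate.run (encode s₀ G k₀) ρ).arr 5 v ≠ 0).card ∧
        (missing (natGraph G) ((Finset.range n).filter fun v =>
          (candidate.run (encode s₀ G k₀) ρ).arr 5 v ≠ 0)).card ≤ s := by
    by_cases hS : ∃ S ⊆ Finset.range n, k ≤ S.card ∧ (missing (natGraph G) S).card ≤ s
    · obtain ⟨S, hS1, hS2, hS3⟩ := hS
      obtain ⟨K, a, b, hK, ha, hb, hC1, hC2⟩ := exists_certificate hk hq hS1 hS2 hS3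
      obtain ⟨x, hx, hrun⟩ := exists_run_candidate s₀ G k₀ (s := s) hn hP hT hr hK ha hb
      refine ⟨x, fun _ => hx, fun ρ h h13 _ => ?_⟩
      have : ((Finset.range n).filter fun v =>
          (candidate.run (encode s₀ G k₀) ρ).arr 5 v ≠ 0)
          = certSet (natGraph G) n (2 * s) q K a b := by
        ext v
        rw [Finset.mem_filter, Finset.mem_range]
        constructor
        · rintro ⟨h1, h2⟩; exact (hrun ρ h h13 v h1).1 h2
        · intro h1
          have h2 : v < n := Finset.mem_range.1 (Finset.mem_filter.1 h1).1
          exact ⟨h2, (hrun ρ h h13 v h2).2 h1⟩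
      rw [this]
      exact ⟨hC1, hC2⟩
    · exact ⟨T, fun h => absurd h hS, fun _ _ _ h => absurd h (lt_irrefl _)⟩
  obtain ⟨-, h2, h3⟩ := loop_induction (inp := encode s₀ G k₀) (x := 13)
    (c := seq candidate check)
    (fun i τ => Params n k s (2 * s) (q + 1) P T r τ ∧
      (τ.var 0 ≠ 0 → ∃ S ⊆ Finset.range n, k ≤ S.card ∧ (missing (natGraph G) S).card ≤ s) ∧
      (x₀ < i → τ.var 0 ≠ 0)) hρ.hT
    ⟨hρ, fun h => absurd h0 h, by omega⟩
    (by
      rintro i τ hi ⟨h1, h2, h3⟩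
      have h1' := h1.set 13 i (by norm_num)
      have p : Params n k s (2 * s) (q + 1) P T r (candidate.run (encode s₀ G k₀) (τ.set 13 i)) :=
        h1'.run _ (by decide)
      have hk0 : (candidate.run (encode s₀ G k₀) (τ.set 13 i)).var 0 = τ.var 0 :=
        (run_var candidate (by decide) _).trans (by simp)
      have hcheck := run_check s₀ G k₀ p
      rw [hk0] at hcheck
      refine ⟨h1'.run _ (by decide), fun h => ?_, fun hxi => ?_⟩
      · rw [run_seq, hcheck] at h
        split_ifs at h with h4
        · exact ⟨_, Finset.filter_subset _ _, h4⟩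
        · exact h2 h
      · rw [run_seq, hcheck]
        split_ifs with h4
        · exact one_ne_zero
        · refine h3 (lt_of_le_of_ne (by omega) ?_)
          rintro rfl
          exact h4 (hfound _ h1' (by simp) hi))
  exact ⟨h2, fun hS => h3 (hx₀ hS)⟩

end Program

namespace Program

open Exp Cmd

/-! ## The whole program -/

/-- Read the numbers `n` and `k`, `s`, and bring `k` between `1` and `n + 1`. -/
def readInput : Cmd :=
  seq (assign 1 (inp (lit 0))) <| seq (assign 2 (inp (lit 1))) <| seq (assign 3 (inp (lit 2))) <|
  seq (assign 9 (add (var 1) (lit 1))) <| seq (assign 11 (lit 2)) <|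
  seq (assign 2 (.ite (le (lit 1) (var 2)) (var 2) (lit 1)))
    (assign 2 (.ite (le (var 2) (var 9)) (var 2) (var 9)))

/-- Replace `s` by the minimum of `s` and `k * k`. -/
def capDefect : Cmd :=
  seq (assign 3 (.ite (le (var 3) (sum 98 2 (var 2))) (var 3) (sum 98 2 (var 2)))) <|
  seq (assign 4 (add (var 3) (var 3))) (assign 12 (add (var 4) (lit 1)))

/-- Compute the number of cliques. -/
def cliqueNumber : Cmd :=
  assign 5 (add (count 97 12
    (le (sum 98 12 (.ite (lt (var 98) (var 97)) (var 97) (lit 0))) (var 4))) (lit 1))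

def powerOfTwo : Cmd := seq (assign 7 (lit 1)) (loop 20 6 (assign 7 (add (var 7) (var 7))))

/-- Compute the number of candidates. -/
def candidateNumber : Cmd :=
  seq (assign 8 (lit 1)) <|
  seq (loop 20 5 <| seq (assign 8 (sum 98 1 (var 8))) <| seq (assign 8 (sum 98 1 (var 8)))
    (assign 8 (sum 98 7 (var 8))))
  (loop 20 4 <| seq (assign 8 (sum 98 5 (var 8))) (assign 8 (sum 98 2 (var 8))))

def main : Cmd :=
  seq readInput <| seq capDefect <| seq cliqueNumber <| seq peel <| seq powerOfTwo <|
    seq candidateNumber search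

variable {inp : List ℕ} {ρ : Env}

/-- The inner sum adds `i` once for every `j < i` and so equals `i * i`, as the range extends beyond
`i`. The count runs over `0, …, Nat.sqrt _`, whence one more than the square root; the final unit is
for the extra clique. -/
theorem run_cliqueNumber (h : ρ.var 12 = ρ.var 4 + 1) :
    cliqueNumber.run inp ρ = ρ.set 5 (Nat.sqrt (ρ.var 4) + 2) := by
  have hcard : ((Finset.range (ρ.var 12)).filter fun i =>
      (le (sum 98 12 (.ite (lt (var 98) (var 97)) (var 97) (lit 0))) (var 4)).Tr inp
        (ρ.set 97 i)).card = Nat.sqrt (ρ.var 4) + 1 := by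
    rw [← Finset.card_range (Nat.sqrt (ρ.var 4) + 1)]
    congr 1
    ext i
    simp only [Finset.mem_filter, Finset.mem_range, tr_le, eval_sum, eval_ite, tr_lt, eval_var,
      eval_lit, Env.set_var, Nat.reduceEqDiff, if_true, if_false, h]
    have hsq := Nat.sqrt_le_self (ρ.var 4)
    rw [← Finset.sum_filter, Finset.sum_const, smul_eq_mul, Nat.lt_succ_iff (n := Nat.sqrt _),
      Nat.le_sqrt]
    have h1 : i < ρ.var 4 + 1 →
        ((Finset.range (ρ.var 4 + 1)).filter fun j => j < i).card = i := by
      intro hi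
      have : (Finset.range (ρ.var 4 + 1)).filter (fun j => j < i) = Finset.range i := by
        ext j; simp only [Finset.mem_filter, Finset.mem_range]; omega
      rw [this, Finset.card_range]
    constructor
    · rintro ⟨h2, h3⟩; rwa [h1 h2] at h3
    · intro h2
      have h3 : i < ρ.var 4 + 1 := by
        have := Nat.le_mul_self i
        omega
      exact ⟨h3, by rwa [h1 h3]⟩
  simp only [cliqueNumber, run_assign, eval_add, eval_count, hcard, eval_lit]

theorem run_powerOfTwo : (powerOfTwo.run inp ρ).var 7 = 2 ^ ρ.var 6 := by
  have h := loop_induction (inp := inp) (ρ := ρ.set 7 1) (x := 20) (b := 6)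
    (c := assign 7 (add (var 7) (var 7))) (m := ρ.var 6) (fun i τ => τ.var 7 = 2 ^ i) (by simp)
    (by simp) (by
      intro i τ _ h
      simp [h, pow_succ, mul_two])
  exact h

theorem run_candidateNumber {n k m q P : ℕ} (h1 : ρ.var 1 = n) (h2 : ρ.var 2 = k)
    (h4 : ρ.var 4 = m) (h5 : ρ.var 5 = q) (h7 : ρ.var 7 = P) :
    (candidateNumber.run inp ρ).var 8 = (n * n * P) ^ q * (q * k) ^ m := by
  have g := loop_induction (inp := inp) (ρ := ρ.set 8 1) (x := 20) (b := 5)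
    (c := seq (assign 8 (sum 98 1 (var 8))) <| seq (assign 8 (sum 98 1 (var 8)))
      (assign 8 (sum 98 7 (var 8)))) (m := q)
    (fun i τ => τ.var 8 = (n * n * P) ^ i ∧ τ.var 1 = n ∧ τ.var 2 = k ∧ τ.var 4 = m ∧
      τ.var 5 = q ∧ τ.var 7 = P) (by simpa using h5) (by simp [*]) (by
      rintro i τ - ⟨e0, e1, e2, e4, e5, e7⟩
      simp only [run_seq, run_assign, eval_sum, eval_var, Env.set_var, Nat.reduceEqDiff, if_true,
        if_false, Finset.sum_const, Finset.card_range, smul_eq_mul, e0, e1, e2, e4, e5, e7,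
        and_true]
      ring)
  obtain ⟨g0, g1, g2, g4, g5, g7⟩ := g
  have g' := loop_induction (inp := inp) (x := 20) (b := 4)
    (c := seq (assign 8 (sum 98 5 (var 8))) (assign 8 (sum 98 2 (var 8)))) (m := m)
    (fun i τ => τ.var 8 = (n * n * P) ^ q * (q * k) ^ i ∧ τ.var 2 = k ∧ τ.var 5 = q) g4
    ⟨by rw [g0]; ring, g2, g5⟩ (by
      rintro i τ - ⟨e0, e2, e5⟩
      simp only [run_seq, run_assign, eval_sum, eval_var, Env.set_var, Nat.reduceEqDiff, if_true,
        if_false, Finset.sum_const, Finset.card_range, smul_eq_mul, e0, e2, e5, and_true]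
      ring)
  exact g'.1

/-- The number of candidates dominates all loop bounds. -/
theorem le_candidateNumber {n k s q P T : ℕ} (hn : 1 ≤ n) (hk : 1 ≤ k) (hs : 1 ≤ s) (hq : 3 ≤ q)
    (hP : 1 ≤ P) (hT : T = (n * n * P) ^ q * (q * k) ^ (2 * s)) :
    n + 1 ≤ T ∧ k ≤ T ∧ 2 * s + 1 ≤ T ∧ q ≤ T ∧ P ≤ T ∧ 2 ≤ T := by
  have hnP : 1 ≤ n * n * P := Nat.mul_pos (Nat.mul_pos hn hn) hP
  have h1 : n * n * P ≤ (n * n * P) ^ q := Nat.le_self_pow (by omega) _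
  have h2 : q * k ≤ (q * k) ^ (2 * s) := Nat.le_self_pow (by omega) _
  have h3 : (n * n * P) ^ q * 1 ≤ T := hT ▸ Nat.mul_le_mul_left _ (by nlinarith)
  have h4 : 1 * (q * k) ^ (2 * s) ≤ T := hT ▸ Nat.mul_le_mul_right _ (by omega)
  have h5 : 2 * s < 2 ^ (2 * s) := Nat.lt_two_pow_self
  have h6 : 2 ^ (2 * s) ≤ (q * k) ^ (2 * s) := Nat.pow_le_pow_left (by nlinarith) _
  have h7 : (n * n * P) * (q * k) ≤ T := hT ▸ Nat.mul_le_mul h1 h2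
  have h8 : q ≤ q * k := Nat.le_mul_of_pos_right _ hk
  have h9 : k ≤ q * k := Nat.le_mul_of_pos_left _ (by omega)
  have h10 : P ≤ n * n * P := Nat.le_mul_of_pos_left _ (Nat.mul_pos hn hn)
  have h11 : n ≤ n * n * P := by
    calc n ≤ n * n := Nat.le_mul_of_pos_left _ hn
      _ ≤ _ := Nat.le_mul_of_pos_right _ hP
  have h12 : (n * n * P) * 3 ≤ (n * n * P) * (q * k) := Nat.mul_le_mul_left _ (by nlinarith)
  refine ⟨?_, ?_, ?_, ?_, ?_, ?_⟩ <;> omega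

variable {n : ℕ} (s : ℕ) (G : SimpleGraph (Fin n)) (k : ℕ)

/-- The number of candidates bounds every loop and sum limit in all phases of the program, so the
same argument of `cost` serves for all of them. -/
theorem main_spec (hs : 1 ≤ s) (hn : 1 ≤ n) {k' s' q : ℕ} (hk' : k' = min (max k 1) (n + 1))
    (hs' : s' = min s (k' * k')) (hq : q = Nat.sqrt (2 * s') + 1) :
    ∃ Γ ≤ weakClosure G,
      ((main.run (encode s G k) State.init.env).var 0 ≠ 0 ↔ HasDefectiveClique s G k) ∧
      main.time (encode s G k) State.init.env
        ≤ main.cost ((n * n * 2 ^ Γ) ^ (q + 1) * ((q + 1) * k') ^ (2 * s')) := by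
  classical
  set E := encode s G k with hE
  have hk1 : 1 ≤ k' := by omega
  have hs1 : 1 ≤ s' := by
    have := Nat.mul_pos hk1 hk1
    omega
  have hq2 : 2 ≤ q := by
    have : 1 ≤ Nat.sqrt (2 * s') := Nat.le_sqrt.2 (by omega)
    omega
  have hqs : 2 * s' < q * (q + 1) := by
    have := Nat.lt_succ_sqrt (2 * s')
    rw [Nat.succ_eq_add_one, ← hq] at this
    nlinarith
  set ρ₀ : Env := State.init.env with hρ₀
  have v0 : ∀ x, ρ₀.var x = 0 := fun _ => rfl
  have a0 : ∀ a i, ρ₀.arr a i = 0 := fun _ _ => rfl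
  set ρ₁ := readInput.run E ρ₀ with hρ₁
  have r1 : ρ₁.var 1 = n ∧ ρ₁.var 2 = k' ∧ ρ₁.var 3 = s ∧ ρ₁.var 9 = n + 1 ∧ ρ₁.var 11 = 2 := by
    simp only [hρ₁, readInput, run_seq, run_assign, eval_inp, eval_lit, eval_add, eval_var,
      eval_ite, tr_le, Env.set_var, Nat.reduceEqDiff, if_true, if_false]
    rw [hE, encode_getD_zero, encode_getD_one, encode_getD_two]
    refine ⟨rfl, ?_, by simp⟩
    rw [hk']
    split_ifs <;> omega
  set ρ₂ := capDefect.run E ρ₁ with hρ₂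
  have r2 : ρ₂.var 3 = s' ∧ ρ₂.var 4 = 2 * s' ∧ ρ₂.var 12 = 2 * s' + 1 := by
    have e3 : (if s ≤ k' * k' then s else k' * k') = s' := by
      rw [hs']; split_ifs <;> omega
    simp only [hρ₂, capDefect, run_seq, run_assign, eval_sum, eval_lit, eval_add, eval_var,
      eval_ite, tr_le, Env.set_var, Nat.reduceEqDiff, if_true, if_false, Finset.sum_const,
      Finset.card_range, smul_eq_mul, r1.2.1, r1.2.2.1, e3, two_mul, and_self]
  set ρ₃ := cliqueNumber.run E ρ₂ with hρ₃
  have r3 : ρ₃.var 5 = q + 1 := by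
    rw [hρ₃, run_cliqueNumber (by rw [r2.2.1, r2.2.2]), r2.2.1, hq]
    simp
  set ρ₄ := peel.run E ρ₃ with hρ₄
  have i3 : ∀ x, capDefect.keepsVar x → cliqueNumber.keepsVar x → ρ₃.var x = ρ₁.var x :=
    fun x h1 h2 => (run_var cliqueNumber h2 ρ₂).trans (run_var capDefect h1 ρ₁)
  have z3 : ∀ x, readInput.keepsVar x → capDefect.keepsVar x → cliqueNumber.keepsVar x →
      ρ₃.var x = 0 := fun x h0 h1 h2 => (i3 x h1 h2).trans (run_var readInput h0 ρ₀)
  -- The minimum with `n` keeps the bound within the range that `peel` tries; it is admissible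
  -- because `v` is not its own neighbour, so fewer than `n` vertices are common neighbours.
  have hW : ∀ X ⊆ Finset.range n, X.Nonempty → ∃ v ∈ X, ∀ u ∈ X, u ≠ v →
      ¬ (natGraph G).Adj v u → (X.filter fun w => (natGraph G).Adj v w ∧
        (natGraph G).Adj u w).card < min (weakClosure G) n := by
    intro X hX hne
    obtain ⟨v, hv, h1⟩ := exists_card_common_lt G (weaklyClosed_weakClosure G) hX hne
    refine ⟨v, hv, fun u hu huv hadj => lt_min (h1 u hu huv hadj) ?_⟩
    have h2 : (X.filter fun w => (natGraph G).Adj v w ∧ (natGraph G).Adj u w).card < X.card :=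
      Finset.card_lt_card (Finset.filter_ssubset.2 ⟨v, hv, by simp⟩)
    have h3 := Finset.card_le_card hX
    rw [Finset.card_range] at h3
    omega
  obtain ⟨hr, hΓ⟩ := run_peel s G k (ρ := ρ₃) ((i3 1 (by decide) (by decide)).trans r1.1)
    ((i3 9 (by decide) (by decide)).trans r1.2.2.2.1)
    (((run_arr cliqueNumber (by decide) ρ₂).trans (run_arr capDefect (by decide) ρ₁)).trans
      (run_arr readInput (by decide) ρ₀)) (z3 10 (by decide) (by decide) (by decide))
    (z3 6 (by decide) (by decide) (by decide)) (min_le_right _ _) hW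
  simp only [← hE, ← hρ₄] at hr hΓ
  set Γ := ρ₄.var 6 with hΓdef
  set ρ₅ := powerOfTwo.run E ρ₄ with hρ₅
  have r5 : ρ₅.var 7 = 2 ^ Γ := run_powerOfTwo
  set ρ₆ := candidateNumber.run E ρ₅ with hρ₆
  have j5 : ∀ x, peel.keepsVar x → powerOfTwo.keepsVar x → ρ₅.var x = ρ₃.var x :=
    fun x h1 h2 => (run_var powerOfTwo h2 ρ₄).trans (run_var peel h1 ρ₃)
  have n4 : ρ₄.var 1 = n := (run_var peel (by decide) ρ₃).trans
    ((i3 1 (by decide) (by decide)).trans r1.1)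
  have p1 : ρ₅.var 1 = n := (run_var powerOfTwo (by decide) ρ₄).trans n4
  have p2 : ρ₅.var 2 = k' := (j5 2 (by decide) (by decide)).trans
    ((i3 2 (by decide) (by decide)).trans r1.2.1)
  have p3 : ρ₅.var 3 = s' := (j5 3 (by decide) (by decide)).trans
    ((run_var cliqueNumber (by decide) ρ₂).trans r2.1)
  have p4 : ρ₅.var 4 = 2 * s' := (j5 4 (by decide) (by decide)).trans
    ((run_var cliqueNumber (by decide) ρ₂).trans r2.2.1)
  have p5 : ρ₅.var 5 = q + 1 := (j5 5 (by decide) (by decide)).trans r3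
  have p11 : ρ₅.var 11 = 2 := (j5 11 (by decide) (by decide)).trans
    ((i3 11 (by decide) (by decide)).trans r1.2.2.2.2)
  have r6 : ρ₆.var 8 = _ := run_candidateNumber (inp := E) p1 p2 p4 p5 r5
  set T := (n * n * 2 ^ Γ) ^ (q + 1) * ((q + 1) * k') ^ (2 * s') with hT
  have k6 : ∀ x, candidateNumber.keepsVar x → ρ₆.var x = ρ₅.var x :=
    fun x h => run_var candidateNumber h ρ₅
  have pars : Params n k' s' (2 * s') (q + 1) (2 ^ Γ) T (ρ₄.arr 0) ρ₆ :=
    ⟨(k6 1 (by decide)).trans p1, (k6 2 (by decide)).trans p2, (k6 3 (by decide)).trans p3,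
      (k6 4 (by decide)).trans p4, (k6 5 (by decide)).trans p5, (k6 7 (by decide)).trans r5, r6,
      (k6 11 (by decide)).trans p11, (run_arr candidateNumber (by decide) ρ₅).trans
        (run_arr powerOfTwo (by decide) ρ₄)⟩
  have z6 : ρ₆.var 0 = 0 := (k6 0 (by decide)).trans <| (j5 0 (by decide) (by decide)).trans
    (z3 0 (by decide) (by decide) (by decide))
  have hfinal := run_search s G k pars z6 hn hk1 hqs rfl hT hr
  have hnorm := hasDefectiveClique_iff_normalised hn s k G hk'
  rw [← hs'] at hnorm
  rw [← hnorm] at hfinal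
  refine ⟨Γ, hΓ.trans (min_le_left _ _), hfinal, ?_⟩
  obtain ⟨t1, t2, t3, t4, t5, t6⟩ := le_candidateNumber hn hk1 hs1 (show 3 ≤ q + 1 by omega)
    (Nat.one_le_two_pow (n := Γ)) hT
  have hΓT : Γ ≤ T := (Nat.lt_two_pow_self (n := Γ)).le.trans t5
  have c1 := readInput.time_le_cost (inp := E) (B := []) (M := T) (ρ := ρ₀) (by decide) (by simp)
  have c2 := capDefect.time_le_cost (inp := E) (B := [2]) (M := T) (ρ := ρ₁) (by decide)
    (by simp [r1, t2])
  have c3 := cliqueNumber.time_le_cost (inp := E) (B := [12]) (M := T) (ρ := ρ₂) (by decide)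
    (by simp [r2, t3])
  have c4 := peel.time_le_cost (inp := E) (B := [1, 9]) (M := T) (ρ := ρ₃) (by decide)
    (by
      have h1 : ρ₃.var 1 ≤ T := by rw [i3 1 (by decide) (by decide), r1.1]; omega
      have h9 : ρ₃.var 9 ≤ T := by rw [i3 9 (by decide) (by decide), r1.2.2.2.1]; omega
      simp [h1, h9])
  have c5 := powerOfTwo.time_le_cost (inp := E) (B := [6]) (M := T) (ρ := ρ₄) (by decide)
    (by simpa using hΓT)
  have c6 := candidateNumber.time_le_cost (inp := E) (B := [1, 7, 5, 2, 4]) (M := T) (ρ := ρ₅)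
    (by decide) (by
      simp only [List.mem_cons, List.not_mem_nil, or_false, forall_eq_or_imp, forall_eq, p1, p2,
        p4, p5, r5]
      omega)
  have c7 := search.time_le_cost (inp := E) (B := [1, 2, 4, 5, 7, 8, 11]) (M := T) (ρ := ρ₆)
    (by decide) (by
      simp only [List.mem_cons, List.not_mem_nil, or_false, forall_eq_or_imp, forall_eq, pars.hn,
        pars.hk, pars.hm, pars.hq, pars.hP, pars.hT, pars.h2]
      omega)
  show readInput.time E ρ₀ + (capDefect.time E ρ₁ + (cliqueNumber.time E ρ₂ + (peel.time E ρ₃ +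
    (powerOfTwo.time E ρ₄ + (candidateNumber.time E ρ₅ + search.time E ρ₆)))))
    ≤ readInput.cost T + (capDefect.cost T + (cliqueNumber.cost T + (peel.cost T +
    (powerOfTwo.cost T + (candidateNumber.cost T + search.cost T)))))
  omega

end Program

/-! ### The running time -/

/-- A bound for the number of candidates. -/
theorem candidateNumber_le {n k s γ Γ k' s' q : ℕ} (hs : 1 ≤ s) (hn : 1 ≤ n) (hγ : 1 ≤ γ)
    (hΓ : Γ ≤ γ) (hk' : k' = min (max k 1) (n + 1))
    (hs' : s' = min s (k' * k')) (hq : q = Nat.sqrt (2 * s') + 1) :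
    (((n * n * 2 ^ Γ) ^ (q + 1) * ((q + 1) * k') ^ (2 * s') : ℕ) : ℝ)
      ≤ (2 : ℝ) ^ (8 * ((γ : ℝ) * √(s : ℝ) + (s : ℝ) * Real.logb 2 ((max k 1 : ℕ) : ℝ)))
        * (n : ℝ) ^ (8 * √(s : ℝ)) := by
  set κ := max k 1 with hκ
  have hκ1 : 1 ≤ κ := le_max_right _ _
  have hs1 : (1 : ℝ) ≤ √(s : ℝ) := by
    rw [Real.one_le_sqrt]; exact_mod_cast hs
  have hn1 : (1 : ℝ) ≤ n := by exact_mod_cast hn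
  have hq1 : ((q + 1 : ℕ) : ℝ) ≤ 4 * √(s : ℝ) := by
    -- The remaining summand `2` of `q + 1` is at most `2 * √s`, which makes `4 * √s` in total.
    have h1 : ((Nat.sqrt (2 * s') : ℕ) : ℝ) ≤ 2 * √(s : ℝ) := by
      refine (Real.nat_sqrt_le_real_sqrt).trans ?_
      rw [show (2 : ℝ) * √(s : ℝ) = √(4 * s) by
        rw [Real.sqrt_mul (by norm_num), show (4 : ℝ) = 2 ^ 2 by norm_num,
          Real.sqrt_sq (by norm_num)]]
      apply Real.sqrt_le_sqrt
      have : 2 * s' ≤ 4 * s := by omega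
      exact_mod_cast this
    rw [hq]
    push_cast
    linarith
  have hA : (((n * n * 2 ^ Γ) ^ (q + 1) : ℕ) : ℝ)
      ≤ (2 : ℝ) ^ (4 * (γ : ℝ) * √(s : ℝ)) * (n : ℝ) ^ (8 * √(s : ℝ)) := by
    have h1 : (((n * n * 2 ^ Γ) ^ (q + 1) : ℕ) : ℝ)
        = (2 : ℝ) ^ ((Γ : ℝ) * ((q + 1 : ℕ) : ℝ)) * (n : ℝ) ^ (2 * ((q + 1 : ℕ) : ℝ)) := by
      rw [show (Γ : ℝ) * ((q + 1 : ℕ) : ℝ) = ((Γ * (q + 1) : ℕ) : ℝ) by push_cast; ring,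
        show 2 * ((q + 1 : ℕ) : ℝ) = ((2 * (q + 1) : ℕ) : ℝ) by push_cast; ring,
        Real.rpow_natCast, Real.rpow_natCast]
      push_cast
      ring
    rw [h1]
    refine mul_le_mul (Real.rpow_le_rpow_of_exponent_le (by norm_num) ?_)
      (Real.rpow_le_rpow_of_exponent_le hn1 (by linarith)) (by positivity) (by positivity)
    have : (Γ : ℝ) ≤ γ := by exact_mod_cast hΓ
    calc (Γ : ℝ) * ((q + 1 : ℕ) : ℝ) ≤ γ * (4 * √(s : ℝ)) := by gcongr
      _ = _ := by ring
  -- The cap `s' ≤ k' * k'` gives `q + 1 ≤ 4 * k'`, so the base is at most `4 * κ ^ 2`.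
  have hB : ((q + 1) * k') ^ (2 * s') ≤ 16 * κ ^ (8 * s) := by
    have hk1 : 1 ≤ k' := by omega
    have h1 : Nat.sqrt (2 * s') ≤ 2 * k' := by
      refine (Nat.sqrt_le_sqrt (show 2 * s' ≤ (2 * k') * (2 * k') by
        have : s' ≤ k' * k' := by omega
        nlinarith)).trans ?_
      rw [Nat.sqrt_eq]
    have h2 : (q + 1) * k' ≤ 4 * κ ^ 2 := by
      have h3 : q + 1 ≤ 4 * k' := by omega
      have h4 : k' ≤ κ := by omega
      nlinarith
    have h3 : 16 ^ s' ≤ 16 * κ ^ (4 * s) := by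
      -- For `κ = 1` the logarithm vanishes and no power of `κ` can absorb `16 ^ s'`; there the cap
      -- gives `s' ≤ 1`. For `κ ≥ 2` the power `κ ^ (4 * s)` suffices.
      rcases Nat.lt_or_ge κ 2 with h4 | h4
      · have h5 : κ = 1 := by omega
        have h6 : k' = 1 := by omega
        have h7 : s' ≤ 1 := by rw [h6] at hs'; omega
        rw [h5, one_pow, mul_one]
        calc 16 ^ s' ≤ 16 ^ 1 := Nat.pow_le_pow_right (by norm_num) h7
          _ = 16 := by norm_num
      · calc 16 ^ s' ≤ 16 ^ s := Nat.pow_le_pow_right (by norm_num) (by omega)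
          _ = 2 ^ (4 * s) := by rw [pow_mul]; norm_num
          _ ≤ κ ^ (4 * s) := Nat.pow_le_pow_left h4 _
          _ ≤ 16 * κ ^ (4 * s) := by omega
    calc ((q + 1) * k') ^ (2 * s') ≤ (4 * κ ^ 2) ^ (2 * s') := Nat.pow_le_pow_left h2 _
      _ = 16 ^ s' * κ ^ (4 * s') := by
        rw [mul_pow, pow_mul 4, ← pow_mul κ, ← mul_assoc 2 2 s']; norm_num
      _ ≤ 16 * κ ^ (4 * s) * κ ^ (4 * s) :=
        Nat.mul_le_mul h3 (Nat.pow_le_pow_right hκ1 (by omega))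
      _ = 16 * κ ^ (8 * s) := by ring
  have hκpow : ((κ ^ (8 * s) : ℕ) : ℝ) = (2 : ℝ) ^ (8 * ((s : ℝ) * Real.logb 2 (κ : ℝ))) := by
    have h1 : (2 : ℝ) ^ Real.logb 2 (κ : ℝ) = κ :=
      Real.rpow_logb (by norm_num) (by norm_num) (by exact_mod_cast hκ1)
    rw [show 8 * ((s : ℝ) * Real.logb 2 (κ : ℝ)) = Real.logb 2 (κ : ℝ) * ((8 * s : ℕ) : ℝ) by
      push_cast; ring, Real.rpow_mul (by norm_num), h1, Real.rpow_natCast]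
    push_cast
    rfl
  -- The stray factor `16` goes into the other exponent, which is at least `4` since `γ ≥ 1` and `s
  -- ≥ 1`.
  have h16 : (16 : ℝ) ≤ (2 : ℝ) ^ (4 * (γ : ℝ) * √(s : ℝ)) := by
    have h1 : (1 : ℝ) ≤ γ := by exact_mod_cast hγ
    calc (16 : ℝ) = (2 : ℝ) ^ (4 : ℝ) := by norm_num
      _ ≤ _ := Real.rpow_le_rpow_of_exponent_le (by norm_num) (by nlinarith)
  rw [Nat.cast_mul]
  have hB' : ((((q + 1) * k') ^ (2 * s') : ℕ) : ℝ)
      ≤ (2 : ℝ) ^ (4 * (γ : ℝ) * √(s : ℝ)) * (2 : ℝ) ^ (8 * ((s : ℝ) * Real.logb 2 (κ : ℝ))) := by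
    calc ((((q + 1) * k') ^ (2 * s') : ℕ) : ℝ) ≤ ((16 * κ ^ (8 * s) : ℕ) : ℝ) := by
          exact_mod_cast hB
      _ = 16 * ((κ ^ (8 * s) : ℕ) : ℝ) := by push_cast; ring
      _ ≤ _ := by rw [hκpow]; gcongr
  calc _ ≤ _ := mul_le_mul hA hB' (by positivity) (by positivity)
    _ = ((2 : ℝ) ^ (4 * (γ : ℝ) * √(s : ℝ)) * (2 : ℝ) ^ (4 * (γ : ℝ) * √(s : ℝ))
        * (2 : ℝ) ^ (8 * ((s : ℝ) * Real.logb 2 (κ : ℝ)))) * (n : ℝ) ^ (8 * √(s : ℝ)) := by ring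
    _ = _ := by
      rw [← Real.rpow_add (by norm_num), ← Real.rpow_add (by norm_num)]
      congr 2
      ring

theorem one_le_weakClosure_mul_add {γ s k : ℕ} (hγ : 1 ≤ γ) (hs : 1 ≤ s) :
    1 ≤ (γ : ℝ) * √(s : ℝ) + (s : ℝ) * Real.logb 2 ((max k 1 : ℕ) : ℝ) := by
  have h1 : (1 : ℝ) ≤ γ := by exact_mod_cast hγ
  have h2 : (1 : ℝ) ≤ √(s : ℝ) := by
    rw [Real.one_le_sqrt]; exact_mod_cast hs
  have h3 : 0 ≤ (s : ℝ) * Real.logb 2 ((max k 1 : ℕ) : ℝ) := by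
    refine mul_nonneg (by positivity) (Real.logb_nonneg (by norm_num) ?_)
    exact_mod_cast le_max_right k 1
  nlinarith

/-- Since `x ≥ 1`, constant factors become powers of two: `A ≤ 2 ^ (A * x)`, and passing from `T` to
`T + 1` costs a factor `2 ≤ 2 ^ x`, which turns the exponent `8 * x` into `9 * x`. -/
theorem le_rpow_mul_rpow {A d T t : ℕ} {x y n : ℝ} (ht : t ≤ A * (T + 1) ^ d)
    (hT : (T : ℝ) ≤ (2 : ℝ) ^ (8 * x) * n ^ (8 * y)) (hx : 1 ≤ x) (hy : 1 ≤ y) (hn : 1 ≤ n) :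
    (t : ℝ) ≤ (2 : ℝ) ^ (((A : ℝ) + 9 * d + 1) * x) * n ^ (((A : ℝ) + 9 * d + 1) * y) := by
  have hA0 : (0 : ℝ) ≤ A := A.cast_nonneg
  have hd : (0 : ℝ) ≤ d := d.cast_nonneg
  have hA : (A : ℝ) ≤ (2 : ℝ) ^ ((A : ℝ) * x) := by
    calc (A : ℝ) ≤ (2 : ℝ) ^ (A : ℝ) := by
          rw [Real.rpow_natCast]; exact_mod_cast (Nat.lt_two_pow_self (n := A)).le
      _ ≤ _ := Real.rpow_le_rpow_of_exponent_le (by norm_num) (le_mul_of_one_le_right hA0 hx)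
  have hbig : (1 : ℝ) ≤ (2 : ℝ) ^ (8 * x) * n ^ (8 * y) :=
    one_le_mul_of_one_le_of_one_le (Real.one_le_rpow (by norm_num) (by positivity))
      (Real.one_le_rpow hn (by positivity))
  have hT1 : (T : ℝ) + 1 ≤ (2 : ℝ) ^ (9 * x) * n ^ (9 * y) := by
    calc (T : ℝ) + 1 ≤ 2 * ((2 : ℝ) ^ (8 * x) * n ^ (8 * y)) := by linarith
      _ ≤ (2 : ℝ) ^ x * ((2 : ℝ) ^ (8 * x) * n ^ (9 * y)) := by
        have h2 : (2 : ℝ) ≤ (2 : ℝ) ^ x := by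
          calc (2 : ℝ) = (2 : ℝ) ^ (1 : ℝ) := by norm_num
            _ ≤ _ := Real.rpow_le_rpow_of_exponent_le (by norm_num) hx
        have h3 : n ^ (8 * y) ≤ n ^ (9 * y) :=
          Real.rpow_le_rpow_of_exponent_le hn (by linarith)
        gcongr
      _ = _ := by
        rw [← mul_assoc, ← Real.rpow_add (by norm_num)]
        congr 2
        ring
  calc (t : ℝ) ≤ ((A * (T + 1) ^ d : ℕ) : ℝ) := by exact_mod_cast ht
    _ = (A : ℝ) * ((T : ℝ) + 1) ^ d := by push_cast; ring
    _ ≤ (2 : ℝ) ^ ((A : ℝ) * x) * ((2 : ℝ) ^ (9 * x) * n ^ (9 * y)) ^ d := by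
      gcongr
    _ = (2 : ℝ) ^ (((A : ℝ) + 9 * d) * x) * n ^ ((9 * d) * y) := by
      rw [mul_pow, ← Real.rpow_natCast ((2 : ℝ) ^ (9 * x)), ← Real.rpow_natCast
        (n ^ (9 * y)), ← Real.rpow_mul (by norm_num), ← Real.rpow_mul (by positivity),
        ← mul_assoc, ← Real.rpow_add (by norm_num)]
      ring_nf
    _ ≤ _ := by
      refine mul_le_mul (Real.rpow_le_rpow_of_exponent_le (by norm_num) ?_)
        (Real.rpow_le_rpow_of_exponent_le hn ?_) (by positivity) (by positivity)
      · exact mul_le_mul_of_nonneg_right (by linarith) (by linarith)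
      · exact mul_le_mul_of_nonneg_right (by linarith) (by linarith)

end DefectiveClique

theorem mainTheorem5 :
    ∃ (P : DefectiveClique.Prog) (C : ℝ), 0 < C ∧
      ∀ (s n k : ℕ) (G : SimpleGraph (Fin n)), 1 ≤ s → 1 ≤ n →
        P.DecidesWithin (DefectiveClique.encode s G k)
          (DefectiveClique.HasDefectiveClique s G k)
          ((2 : ℝ) ^ (C * ((DefectiveClique.weakClosure G : ℝ) * √(s : ℝ)
              + (s : ℝ) * Real.logb 2 ((max k 1 : ℕ) : ℝ)))
            * (n : ℝ) ^ (C * √(s : ℝ))) := by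
  obtain ⟨A, d, hA⟩ := DefectiveClique.Program.main.polyBounded_cost
  refine ⟨DefectiveClique.Program.main.comp 0, A + 9 * d + 1, by positivity, ?_⟩
  intro s n k G hs hn
  obtain ⟨k', hk'⟩ : ∃ k', k' = min (max k 1) (n + 1) := ⟨_, rfl⟩
  obtain ⟨s', hs'⟩ : ∃ s', s' = min s (k' * k') := ⟨_, rfl⟩
  obtain ⟨q, hq⟩ : ∃ q, q = Nat.sqrt (2 * s') + 1 := ⟨_, rfl⟩
  obtain ⟨Γ, hΓ, hdec, htime⟩ := DefectiveClique.Program.main_spec s G k hs hn hk' hs' hq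
  obtain ⟨τ, hexec, henv, -⟩ := DefectiveClique.Program.main.exec_comp
    (DefectiveClique.encode s G k) 0 DefectiveClique.State.init
  refine ⟨τ, _, hexec, ?_, ?_⟩
  · rw [← hdec, ← henv]
    rfl
  -- The graph has a vertex, and a closure number strictly below the weak closure forces the latter
  -- to be positive.
  have hγ : 1 ≤ DefectiveClique.weakClosure G := by
    obtain ⟨v, hv⟩ := DefectiveClique.weaklyClosed_weakClosure G Finset.univ
      ⟨⟨0, hn⟩, Finset.mem_univ _⟩
    omega
  exact DefectiveClique.le_rpow_mul_rpow (htime.trans (hA _))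
    (DefectiveClique.candidateNumber_le (k := k) hs hn hγ hΓ hk' hs' hq)
    (DefectiveClique.one_le_weakClosure_mul_add hγ hs)
    (by rw [Real.one_le_sqrt]; exact_mod_cast hs) (by exact_mod_cast hn)
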